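/- Let $\mathbb E^4_2$ be $\mathbb R^4$ with the metric $\langle x,y\rangle=-x_1y_1-x_2y_2+x_3y_3+x_4y_4$. A vector $v$ is light-like if $v\neq0$ and $\langle v,v\rangle=0$; a curve is light-like if its velocity is light-like everywhere; $\mathcal{LC}=\{x:\langle x,x\rangle=0\}$. A congruence is a map $x\mapsto Ax+b$ with $A$ linear and $\langle Ax,Ay\rangle=\langle x,y\rangle$. A surface is a smooth map $f:M\to\mathbb E^4_2$ from a smooth 2-manifold whose induced metric is non-degenerate; let $K$, $H$, $\nabla^\perp$, $A_H$ be its Gaussian curvature, mean curvature vector, normal connection and shape operator along $H$. Let $\tau(f)=-\mathrm{trace}\,\nabla df$ and $\tau_2(f)=-\Delta\tau(f)$, where $\Delta=-\mathrm{trace}(\nabla\nabla-\nabla_\nabla)$ is the rough Laplacian. The surface is quasi-minimal if $H$ is light-like at every point, biconservative if $\langle\tau_2(f),df\rangle=0$, and proper biconservative if moreover $\nabla^\perp H\neq0$ at every point. Consider the following families of surfaces ($I,J\subseteq\mathbb R$ are open intervals, and all data are smooth). (i) $f(s,t)=\big(\psi(s,t),\tfrac{s-t}{\sqrt2},\tfrac{s+t}{\sqrt2},\psi(s,t)\big)$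 on an open set $U\subseteq\mathbb R^2$, where $\psi_{st}\neq0$ and $(\psi_{sst},\psi_{stt})\neq(0,0)$ at every point. (ii) $f(s,t)=t\,z(s)+w(s)$ on $I\times J$, where $z$ is a light-like curve in $\mathcal{LC}$, $w$ is a light-like curve, $\langle z',w'\rangle=0$, $\langle z,w'\rangle=-1$, and $z(s),z''(s)$ are linearly independent for all $s$. (iii) $f(s,t)=\eta(t)+\big(s\,a'(t)-a(t)(m(s,t)+sL(t))\big)\alpha(t)+s\,a(t)\,\alpha'(t)$ on $I\times J$, where $m$ is a function on $I\times J$ such that $\kappa=m_{ss}$ (the Gaussian curvature of the metric $-(ds\otimes dt+dt\otimes ds)+2m\,dt\otimes dt$) vanishes nowhere and $-\frac{\kappa_t+m\kappa_s+3m_s\kappa}{\kappa}=L(t)$ depends on $t$ only; $a$ is nowhere zero on $J$; $\alpha:J\to\mathcal{LC}$ is a light-like curve with $\alpha(t),\alpha'(t)$ linearly independent for all $t$; and $\eta:J\to\mathbb R^4$ satisfies $$\langle\eta',\eta'\rangle=0,\quad\langle\alpha,\eta'\rangle=0,\quad\langle\eta',\alpha'\rangle=-\frac1a,\quad\langle\eta',\alpha''\rangle=\frac{2a'-aL}{a^2}.$$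 Moreover, $N=f_{st}+m f_{ss}+m_s f_s$ is nowhere zero, and $f_s,N_t$ are linearly independent at every point. Say that $f:M\to\mathbb E^4_2$ is locally congruent at $p$ to a family if on some neighbourhood of $p$, in suitable local coordinates $(s,t)$ of $M$ and up to a congruence of $\mathbb E^4_2$, it is a member of that family. Call $p$ regular if $K(p)\neq0$; or $K=0$ near $p$ and $A_H\neq0$ at $p$; or $A_H=0$ near $p$. Theorem. Let $f:M\to\mathbb E^4_2$ be a surface. (a) If all points of $M$ are regular, then $f$ is quasi-minimal and proper biconservative if and only if at every point of $M$ it is locally congruent to one of the families (i), (ii), (iii). (b) The implication "if" in (a) holds without the assumption that all points are regular. (c) The set of regular points is open and dense in $M$. (d) If $f$ is quasi-minimal and proper biconservative, then at each $p\in M$ it is locally congruent to (iii) if $K(p)\neq0$, to (ii) if $K=0$ near $p$ and $A_H\neq0$ at $p$, and to (i) if $A_H=0$ near $p$. -/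

import Mathlib

open Set Filter Topology
open scoped Manifold ContDiff Matrix

noncomputable section

namespace NeutralSurface

/-! ### The pseudo-Euclidean space `𝔼⁴₂` and its congruences -/

/-- The underlying vector space of `𝔼⁴₂` (the norm of `Fin 4 → ℝ` only provides the topology). -/
abbrev E42 : Type := Fin 4 → ℝ

/-- The neutral metric `-dx₁² - dx₂² + dx₃² + dx₄²`. -/
def nip (x y : E42) : ℝ := -(x 0 * y 0) - x 1 * y 1 + x 2 * y 2 + x 3 * y 3

/-- A non-zero vector `v` with `⟨v, v⟩ = 0`. -/
def IsLightlike (v : E42) : Prop := v ≠ 0 ∧ nip v v = 0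

/-- Congruences (rigid motions) of `𝔼⁴₂`: a linear isometry followed by a translation. -/
def IsCongruence (T : E42 → E42) : Prop :=
  ∃ (A : E42 →ₗ[ℝ] E42) (b : E42), (∀ x y, nip (A x) (A y) = nip x y) ∧ ∀ x, T x = A x + b

/-! ### Geometry of a parametrized surface `f : ℝ × ℝ → 𝔼⁴₂` at a point of its open domain -/

/-- The coordinate vectors of `ℝ × ℝ`. -/
def dir : Fin 2 → ℝ × ℝ := ![(1, 0), (0, 1)]

/-- Partial derivative with respect to the `i`-th coordinate. -/
def pd {F : Type*} [NormedAddCommGroup F] [NormedSpace ℝ F] (i : Fin 2) (u : ℝ × ℝ → F) :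
    ℝ × ℝ → F :=
  fun p => fderiv ℝ u p (dir i)

/-- The induced metric `g_{ij} = ⟨∂ᵢf, ∂ⱼf⟩`. -/
def metric (f : ℝ × ℝ → E42) (p : ℝ × ℝ) : Matrix (Fin 2) (Fin 2) ℝ :=
  Matrix.of fun i j => nip (pd i f p) (pd j f p)

/-- The inverse metric `g^{ij}`. -/
def metricInv (f : ℝ × ℝ → E42) (p : ℝ × ℝ) : Matrix (Fin 2) (Fin 2) ℝ := (metric f p)⁻¹

/-- Tangential part of an ambient vector `v` at `f p`. -/
def tangentPart (f : ℝ × ℝ → E42) (p : ℝ × ℝ) (v : E42) : E42 :=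
  ∑ i, ∑ j, (metricInv f p i j * nip v (pd i f p)) • pd j f p

/-- Normal part of an ambient vector `v` at `f p`. -/
def normalPart (f : ℝ × ℝ → E42) (p : ℝ × ℝ) (v : E42) : E42 := v - tangentPart f p v

/-- Second fundamental form: the normal part of the ambient derivative `∂ᵢ∂ⱼf`
(Gauss formula). -/
def secondFund (f : ℝ × ℝ → E42) (i j : Fin 2) (p : ℝ × ℝ) : E42 :=
  normalPart f p (pd i (pd j f) p)

/-- Mean curvature vector `H = (1/2) trace α`. -/
def meanCurv (f : ℝ × ℝ → E42) (p : ℝ × ℝ) : E42 :=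
  (1 / 2 : ℝ) • ∑ i, ∑ j, metricInv f p i j • secondFund f i j p

/-- Normal connection `∇^⊥_{∂ᵢ} ξ` (Weingarten formula). -/
def normalDeriv (f : ℝ × ℝ → E42) (i : Fin 2) (ξ : ℝ × ℝ → E42) (p : ℝ × ℝ) : E42 :=
  normalPart f p (pd i ξ p)

/-- The tangent vector `f_*(A_ξ ∂ᵢ)`, where `A_ξ` is the shape operator along the normal field `ξ`
(Weingarten formula). -/
def shapeOp (f : ℝ × ℝ → E42) (ξ : ℝ × ℝ → E42) (i : Fin 2) (p : ℝ × ℝ) : E42 :=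
  -tangentPart f p (pd i ξ p)

/-- Christoffel symbol `Γ^k_{ij}` of the Levi-Civita connection of the induced metric. -/
def christoffel (f : ℝ × ℝ → E42) (k i j : Fin 2) (p : ℝ × ℝ) : ℝ :=
  (1 / 2 : ℝ) * ∑ l, metricInv f p k l *
    (pd i (fun q => metric f q j l) p + pd j (fun q => metric f q i l) p
      - pd l (fun q => metric f q i j) p)

/-- Gaussian curvature `⟨R(∂₁,∂₂)∂₂, ∂₁⟩ / det g` of the induced metric. -/
def gaussCurv (f : ℝ × ℝ → E42) (p : ℝ × ℝ) : ℝ :=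
  (∑ l, (pd 0 (christoffel f l 1 1) p - pd 1 (christoffel f l 0 1) p
      + ∑ k, (christoffel f k 1 1 p * christoffel f l 0 k p
        - christoffel f k 0 1 p * christoffel f l 1 k p)) * metric f p l 0) / (metric f p).det

/-- Rough Laplacian `Δ = -trace (∇∇ - ∇_∇)` on sections of `f⁻¹(T𝔼⁴₂)`, that is on
`𝔼⁴₂`-valued functions. -/
def roughLaplacian (f : ℝ × ℝ → E42) (u : ℝ × ℝ → E42) (p : ℝ × ℝ) : E42 :=
  -∑ i, ∑ j, metricInv f p i j • (pd i (pd j u) p - ∑ k, christoffel f k i j p • pd k u p)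

/-- Tension field `τ(f) = -trace ∇df`. -/
def tension (f : ℝ × ℝ → E42) (p : ℝ × ℝ) : E42 :=
  -∑ i, ∑ j, metricInv f p i j • (pd i (pd j f) p - ∑ k, christoffel f k i j p • pd k f p)

/-- Bitension field `τ₂(f) = -Δ τ(f)`; the curvature term is zero since `𝔼⁴₂` is flat. -/
def bitension (f : ℝ × ℝ → E42) (p : ℝ × ℝ) : E42 := -roughLaplacian f (tension f) p

/-! ### Immersed surfaces `f : M → 𝔼⁴₂`, `M` a smooth 2-manifold -/

section Manifold

variable {M : Type*} [TopologicalSpace M] [ChartedSpace (ℝ × ℝ) M]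

/-- The local parametrization of `f` obtained from the preferred chart at `p`. -/
def rep (f : M → E42) (p : M) : ℝ × ℝ → E42 := f ∘ (chartAt (ℝ × ℝ) p).symm

/-- The coordinates of `p` in the preferred chart at `p`. -/
def coord (p : M) : ℝ × ℝ := chartAt (ℝ × ℝ) p p

/-- `f` is smooth and the induced metric is non-degenerate (so that `f` is an isometric immersion
of the semi-Riemannian manifold `M` carrying the induced metric). -/
def IsSurface (f : M → E42) : Prop :=
  ContMDiff 𝓘(ℝ, ℝ × ℝ) 𝓘(ℝ, E42) ∞ f ∧ ∀ p, (metric (rep f p) (coord p)).det ≠ 0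

/-- The mean curvature vector is light-like at every point. -/
def IsQuasiMinimal (f : M → E42) : Prop :=
  ∀ p, IsLightlike (meanCurv (rep f p) (coord p))

/-- `⟨τ₂(f), df⟩ = 0`. -/
def IsBiconservative (f : M → E42) : Prop :=
  ∀ p, ∀ i, nip (bitension (rep f p) (coord p)) (pd i (rep f p) (coord p)) = 0

/-- Biconservative, with `∇^⊥ H ≠ 0` at every point. -/
def IsProperBiconservative (f : M → E42) : Prop :=
  IsBiconservative f ∧
    ∀ p, ∃ i, normalDeriv (rep f p) i (meanCurv (rep f p)) (coord p) ≠ 0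

/-- The Gaussian curvature of `M` at `p`. -/
def curvAt (f : M → E42) (p : M) : ℝ := gaussCurv (rep f p) (coord p)

/-- `A_H = 0` at `p`. -/
def ShapeHVanishesAt (f : M → E42) (p : M) : Prop :=
  ∀ i, shapeOp (rep f p) (meanCurv (rep f p)) i (coord p) = 0

/-- `p` is regular if `K(p) ≠ 0`, or `K = 0` near `p` and `A_H ≠ 0` at `p`,
or `A_H = 0` near `p`. -/
def IsRegularPoint (f : M → E42) (p : M) : Prop :=
  curvAt f p ≠ 0 ∨ ((∀ᶠ q in 𝓝 p, curvAt f q = 0) ∧ ¬ ShapeHVanishesAt f p) ∨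
    ∀ᶠ q in 𝓝 p, ShapeHVanishesAt f q

/-- In suitable local coordinates `φ` around `p`, and up to a congruence of `𝔼⁴₂`, the surface `f`
is a parametrized surface `g : φ.target → 𝔼⁴₂` of the family `Fam`. -/
def LocallyCongruentTo (Fam : (ℝ × ℝ → E42) → Set (ℝ × ℝ) → Prop) (f : M → E42) (p : M) : Prop :=
  ∃ φ ∈ IsManifold.maximalAtlas 𝓘(ℝ, ℝ × ℝ) ∞ M, p ∈ φ.source ∧
    ∃ T, IsCongruence T ∧ ∃ g, Fam g φ.target ∧ ∀ q ∈ φ.source, T (f q) = g (φ q)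

end Manifold

/-! ### The three families, on open sets `V ⊆ ℝ²` with coordinates `(s, t)` -/

/-- An open interval of `ℝ`, bounded or not. -/
def IsOpenInterval (I : Set ℝ) : Prop := IsOpen I ∧ I.OrdConnected

/-- `f(s,t) = (ψ, (s-t)/√2, (s+t)/√2, ψ)` with `ψ` smooth, `ψ_{st}` nowhere zero, and
`(ψ_{sst}, ψ_{stt})` nowhere zero. -/
def FamilyI (f : ℝ × ℝ → E42) (V : Set (ℝ × ℝ)) : Prop :=
  ∃ ψ : ℝ × ℝ → ℝ, ContDiffOn ℝ ∞ ψ V ∧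
    (∀ p ∈ V, pd 0 (pd 1 ψ) p ≠ 0) ∧
    (∀ p ∈ V, pd 0 (pd 0 (pd 1 ψ)) p ≠ 0 ∨ pd 1 (pd 0 (pd 1 ψ)) p ≠ 0) ∧
    ∀ p ∈ V, f p = ![ψ p, (p.1 - p.2) / √2, (p.1 + p.2) / √2, ψ p]

/-- `f(s,t) = t z(s) + w(s)` with `z` a light-like curve in the light cone, `w` a light-like curve,
`⟨z', w'⟩ = 0`, `⟨z, w'⟩ = -1`, and `z, z''` linearly independent. -/
def FamilyII (f : ℝ × ℝ → E42) (V : Set (ℝ × ℝ)) : Prop :=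
  ∃ (I J : Set ℝ) (z w : ℝ → E42), IsOpenInterval I ∧ IsOpenInterval J ∧ V = I ×ˢ J ∧
    ContDiffOn ℝ ∞ z I ∧ ContDiffOn ℝ ∞ w I ∧
    (∀ s ∈ I, nip (z s) (z s) = 0) ∧
    (∀ s ∈ I, IsLightlike (deriv z s)) ∧
    (∀ s ∈ I, IsLightlike (deriv w s)) ∧
    (∀ s ∈ I, nip (deriv z s) (deriv w s) = 0) ∧
    (∀ s ∈ I, nip (z s) (deriv w s) = -1) ∧
    (∀ s ∈ I, LinearIndependent ℝ ![z s, deriv (deriv z) s]) ∧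
    ∀ p ∈ V, f p = p.2 • z p.1 + w p.1

/-- The Gaussian curvature `K = m_{ss}` of the metric `g_m = -(ds dt + dt ds) + 2 m dt dt`. -/
def curvM (m : ℝ × ℝ → ℝ) : ℝ × ℝ → ℝ := pd 0 (pd 0 m)

/-- The intrinsic function `L = -(K_t + m K_s + 3 m_s K) / K` of the metric `g_m`. -/
def funL (m : ℝ × ℝ → ℝ) (p : ℝ × ℝ) : ℝ :=
  -((pd 1 (curvM m) p + m p * pd 0 (curvM m) p + 3 * pd 0 m p * curvM m p) / curvM m p)

/-- The vector `f_{st} + m f_{ss} + m_s f_s`. -/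
def vecN (m : ℝ × ℝ → ℝ) (f : ℝ × ℝ → E42) (p : ℝ × ℝ) : E42 :=
  pd 0 (pd 1 f) p + m p • pd 0 (pd 0 f) p + pd 0 m p • pd 0 f p

/-- The non-flat family
`f(s,t) = η(t) + (s a'(t) - a(t) (m(s,t) + s L(t))) α(t) + s a(t) α'(t)` on `I × J`, where
`m_{ss} ≠ 0` everywhere, the function `L` of `g_m` depends on `t` only, `α` is a light-like curve in
the light cone with `α, α'` linearly independent, `a` is nowhere zero, and `η` satisfies the four
conditions below. The last two requirements, on `N = f_{st} + m f_{ss} + m_s f_s`, are that `N` is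
nowhere zero and that `f_s`, `N_t` are linearly independent. -/
def FamilyIII (f : ℝ × ℝ → E42) (V : Set (ℝ × ℝ)) : Prop :=
  ∃ (I J : Set ℝ) (m : ℝ × ℝ → ℝ) (L a : ℝ → ℝ) (α η : ℝ → E42),
    IsOpenInterval I ∧ IsOpenInterval J ∧ V = I ×ˢ J ∧
    ContDiffOn ℝ ∞ m V ∧ (∀ p ∈ V, curvM m p ≠ 0) ∧ (∀ p ∈ V, funL m p = L p.2) ∧
    ContDiffOn ℝ ∞ a J ∧ (∀ t ∈ J, a t ≠ 0) ∧
    ContDiffOn ℝ ∞ α J ∧ ContDiffOn ℝ ∞ η J ∧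
    (∀ t ∈ J, nip (α t) (α t) = 0) ∧
    (∀ t ∈ J, IsLightlike (deriv α t)) ∧
    (∀ t ∈ J, LinearIndependent ℝ ![α t, deriv α t]) ∧
    (∀ t ∈ J, nip (deriv η t) (deriv η t) = 0) ∧
    (∀ t ∈ J, nip (α t) (deriv η t) = 0) ∧
    (∀ t ∈ J, nip (deriv η t) (deriv α t) = -(1 / a t)) ∧
    (∀ t ∈ J, nip (deriv η t) (deriv (deriv α) t) = (2 * deriv a t - a t * L t) / a t ^ 2) ∧
    (∀ p ∈ V, f p = η p.2 + (p.1 * deriv a p.2 - a p.2 * (m p + p.1 * L p.2)) • α p.2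
      + (p.1 * a p.2) • deriv α p.2) ∧
    (∀ p ∈ V, vecN m f p ≠ 0) ∧
    ∀ p ∈ V, LinearIndependent ℝ ![pd 0 f p, pd 1 (vecN m f) p]

/-- Membership in one of the three families. -/
def Families (f : ℝ × ℝ → E42) (V : Set (ℝ × ℝ)) : Prop :=
  FamilyI f V ∨ FamilyII f V ∨ FamilyIII f V

end NeutralSurface

end

open NeutralSurface

/-!
Write `H` for the mean curvature vector. When `H` is null, `⟨τ₂(f), df⟩` is four times the one-form
`trace A_{∇^⊥ H}` (`IsPatch.nip_bitension`), so that all conditions become pointwise conditions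
`IsProperAt` on `H`, on `∇^⊥ H` and on the second fundamental form. They do not depend on the
coordinates and are preserved by congruences (`IsPatch.isProperAt_comp`, `isProperAt_congruence`).

*The families satisfy the conditions.* In the first one `H` has a fixed null direction. The other
two carry coordinates with metric `-(ds dt + dt ds) + 2 m dt dt`, possibly after exchanging `s` and
`t`, and `H` is a null vector depending on `t` only; the biconservative equation is then automatic
(`IsSemiNull.isProperAt`).

*The conditions force the families.* The normal planes are Lorentzian and `H` is null, hence `∇^⊥ H
= ω ⊗ H` for a one-form `ω ≠ 0`. Let `e` be the tangent vector metrically dual to `ω`. The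
biconservative equation says `A_H e = 0`, and `A_H` is trace-free since `⟨H, H⟩ = 0`. Where `A_H ≠
0` this makes `e` null, and then the derivative of `H` in the direction `e` vanishes, in the
tangential and in the normal component (`IsPatch.exists_null_direction`).

Thus, if `A_H ≠ 0`, the direction of `H` is constant along null curves and moves transversally to
them; a quotient of two components of `H` is a coordinate `t`, constant along these curves
(`IsPatch.pd_zero_meanCurv_of_quotient`). Let `α` be the multiple of `H` with one component equal
to `1`. A suitable second coordinate `s` is explicit in terms of `α` and of the components of the
surface (`IsAdapted.hasPd_normalizer`), and the metric becomes `-(ds dt + dt ds) + 2 m dt dt`. The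
vectors `f_s` and `α'` lie in the totally null plane which contains `α`; hence `f_s` is a
combination of `α` and `α'`, and integration in `s` gives the third family if `K ≠ 0`
(`IsAdapted.familyIII`). If `K = 0` the null curves are straight lines, and null coordinates give
the second family (`IsSemiNull.familyII`).

If `A_H = 0`, then `dH` is proportional to `H`, whose direction is therefore a constant null
vector, `(1, 0, 0, 1)` after a congruence. The surface lies in a degenerate hyperplane and is a
graph over a Lorentzian plane: the first family (`locallyCongruentTo_familyI`).

Points where `K ≠ 0` satisfy `A_H ≠ 0` by the Gauss equation, and the regular points are open and
dense by continuity of `K` and of `A_H`.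
-/

namespace NeutralSurface

/-! ### Linear algebra of the neutral metric -/

section LinearAlgebra

theorem nip_comm (x y : E42) : nip x y = nip y x := by unfold nip; ring

@[simp] theorem nip_add_left (x y z : E42) : nip (x + y) z = nip x z + nip y z := by
  simp only [nip, Pi.add_apply]; ring

@[simp] theorem nip_add_right (x y z : E42) : nip x (y + z) = nip x y + nip x z := by
  simp only [nip, Pi.add_apply]; ring

@[simp] theorem nip_sub_left (x y z : E42) : nip (x - y) z = nip x z - nip y z := by
  simp only [nip, Pi.sub_apply]; ring

@[simp] theorem nip_sub_right (x y z : E42) : nip x (y - z) = nip x y - nip x z := by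
  simp only [nip, Pi.sub_apply]; ring

@[simp] theorem nip_smul_left (c : ℝ) (x y : E42) : nip (c • x) y = c * nip x y := by
  simp only [nip, Pi.smul_apply, smul_eq_mul]; ring

@[simp] theorem nip_smul_right (c : ℝ) (x y : E42) : nip x (c • y) = c * nip x y := by
  simp only [nip, Pi.smul_apply, smul_eq_mul]; ring

@[simp] theorem nip_neg_left (x y : E42) : nip (-x) y = -nip x y := by
  simp only [nip, Pi.neg_apply]; ring

@[simp] theorem nip_neg_right (x y : E42) : nip x (-y) = -nip x y := by
  simp only [nip, Pi.neg_apply]; ring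

@[simp] theorem nip_zero_left (x : E42) : nip 0 x = 0 := by simp [nip]

@[simp] theorem nip_zero_right (x : E42) : nip x 0 = 0 := by simp [nip]

/-- The neutral metric as a bilinear form. -/
def nipForm : LinearMap.BilinForm ℝ E42 :=
  LinearMap.mk₂ ℝ nip nip_add_left nip_smul_left nip_add_right nip_smul_right

@[simp] theorem nipForm_apply (x y : E42) : nipForm x y = nip x y := rfl

theorem nip_self_reflect (x : E42) :
    nip x ![-x 0, -x 1, x 2, x 3] = x 0 ^ 2 + x 1 ^ 2 + x 2 ^ 2 + x 3 ^ 2 := by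
  simp [nip]; ring

theorem eq_zero_of_nip_eq_zero {x : E42} (h : ∀ y, nip x y = 0) : x = 0 := by
  have h1 := h ![-x 0, -x 1, x 2, x 3]
  rw [nip_self_reflect] at h1
  have key : ∀ i, x i ^ 2 ≤ x 0 ^ 2 + x 1 ^ 2 + x 2 ^ 2 + x 3 ^ 2 := fun i => by
    fin_cases i <;> simp <;> nlinarith [sq_nonneg (x 0), sq_nonneg (x 1), sq_nonneg (x 2),
      sq_nonneg (x 3)]
  ext i
  exact pow_eq_zero_iff two_ne_zero |>.1 (le_antisymm ((key i).trans h1.le) (sq_nonneg _))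

theorem nipForm_nondegenerate : nipForm.Nondegenerate := by
  constructor
  · intro x h; exact eq_zero_of_nip_eq_zero fun y => by simpa using h y
  · intro x h; exact eq_zero_of_nip_eq_zero fun y => by simpa [nip_comm] using h y

theorem finrank_orthogonal_span {n : ℕ} {v : Fin n → E42} (hv : LinearIndependent ℝ v) :
    Module.finrank ℝ (nipForm.orthogonal (Submodule.span ℝ (range v))) = 4 - n := by
  rw [LinearMap.BilinForm.finrank_orthogonal nipForm_nondegenerate,
    finrank_span_eq_card hv]
  simp

theorem mem_orthogonal_span {n : ℕ} {v : Fin n → E42} {x : E42} :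
    x ∈ nipForm.orthogonal (Submodule.span ℝ (range v)) ↔ ∀ i, nip x (v i) = 0 := by
  constructor
  · intro h i
    have := h (v i) (Submodule.subset_span ⟨i, rfl⟩)
    rw [nip_comm]; exact this
  · intro h y hy
    induction hy using Submodule.span_induction with
    | mem y hy => obtain ⟨i, rfl⟩ := hy; simpa [nip_comm] using h i
    | zero => simp
    | add y z _ _ hy hz =>
      have hy' : nip y x = 0 := hy
      have hz' : nip z x = 0 := hz
      show nip (y + z) x = 0
      simp [hy', hz']
    | smul c y _ hy =>
      have hy' : nip y x = 0 := hy
      show nip (c • y) x = 0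
      simp [hy']

/-- A null vector orthogonal to a non-degenerate plane spans the null line through it in the
(two-dimensional, Lorentzian) orthogonal complement of that plane. -/
theorem exists_smul_of_orthogonal_null {X Y α v : E42}
    (hXY : nip X X * nip Y Y - nip X Y * nip X Y ≠ 0) (hα0 : α ≠ 0) (hα : nip α α = 0)
    (hαX : nip α X = 0) (hαY : nip α Y = 0)
    (hvX : nip v X = 0) (hvY : nip v Y = 0) (hvα : nip v α = 0) : ∃ c : ℝ, v = c • α := by
  have hli : LinearIndependent ℝ ![X, Y, α] := by
    rw [Fintype.linearIndependent_iff]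
    intro g hg
    simp only [Fin.sum_univ_three, Matrix.cons_val] at hg
    have hX := congrArg (fun w => nip w X) hg
    have hY := congrArg (fun w => nip w Y) hg
    simp only [nip_add_left, nip_smul_left, nip_zero_left, hαX, hαY, nip_comm Y X] at hX hY
    have g0 : g 0 = 0 := by
      have : g 0 * (nip X X * nip Y Y - nip X Y * nip X Y) = 0 := by
        linear_combination nip Y Y * hX - nip X Y * hY
      exact (mul_eq_zero.1 this).resolve_right hXY
    have g1 : g 1 = 0 := by
      have : g 1 * (nip X X * nip Y Y - nip X Y * nip X Y) = 0 := by
        linear_combination nip X X * hY - nip X Y * hX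
      exact (mul_eq_zero.1 this).resolve_right hXY
    have g2 : g 2 = 0 := by
      rw [g0, g1] at hg
      simpa [hα0] using hg
    intro i; fin_cases i <;> assumption
  have h1 := finrank_orthogonal_span hli
  have hαm : α ∈ nipForm.orthogonal (Submodule.span ℝ (range ![X, Y, α])) := by
    rw [mem_orthogonal_span]; intro i; fin_cases i <;> simp [hαX, hαY, hα]
  have hvm : v ∈ nipForm.orthogonal (Submodule.span ℝ (range ![X, Y, α])) := by
    rw [mem_orthogonal_span]; intro i; fin_cases i <;> simp [hvX, hvY, hvα]
  obtain ⟨c, hc⟩ := (finrank_eq_one_iff_of_nonzero' (⟨α, hαm⟩ : nipForm.orthogonal _)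
    (by simpa using hα0)).1 h1 ⟨v, hvm⟩
  exact ⟨c, by simpa using (congrArg Subtype.val hc).symm⟩

/-- A totally null plane is its own orthogonal complement. -/
theorem exists_combination_of_orthogonal_null_plane {α β v : E42}
    (hli : LinearIndependent ℝ ![α, β]) (h11 : nip α α = 0) (h12 : nip α β = 0)
    (h22 : nip β β = 0) (h1 : nip v α = 0) (h2 : nip v β = 0) :
    ∃ c d : ℝ, v = c • α + d • β := by
  set S := Submodule.span ℝ (range ![α, β])
  have hle : S ≤ nipForm.orthogonal S := by
    rw [Submodule.span_le]
    rintro _ ⟨i, rfl⟩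
    rw [SetLike.mem_coe, mem_orthogonal_span]
    intro j; fin_cases i <;> fin_cases j <;> simp [h11, h12, h22, nip_comm β α]
  have heq : S = nipForm.orthogonal S := by
    apply Submodule.eq_of_le_of_finrank_eq hle
    rw [finrank_orthogonal_span hli, finrank_span_eq_card hli]; simp
  have hv : v ∈ S := by
    rw [heq, mem_orthogonal_span]; intro i; fin_cases i <;> simp [h1, h2]
  have : S = Submodule.span ℝ {α, β} := by
    show Submodule.span ℝ _ = _
    congr 1; ext x; simp [eq_comm, or_comm]
  rw [this, Submodule.mem_span_pair] at hv
  obtain ⟨c, d, h⟩ := hv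
  exact ⟨c, d, h.symm⟩

end LinearAlgebra

/-! ### Partial derivatives -/

section PartialDerivatives

variable {F G : Type*} [NormedAddCommGroup F] [NormedSpace ℝ F]
  [NormedAddCommGroup G] [NormedSpace ℝ G]

/-- `u` is differentiable at `x` and its `i`-th partial derivative there is `d`. Differentiability
is part of the notion, so that `pd` never takes the junk value of `fderiv`. -/
def HasPd (i : Fin 2) (u : ℝ × ℝ → F) (d : F) (x : ℝ × ℝ) : Prop :=
  DifferentiableAt ℝ u x ∧ pd i u x = d

theorem hasPd_of_hasFDerivAt {u : ℝ × ℝ → F} {u' : ℝ × ℝ →L[ℝ] F} {x : ℝ × ℝ}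
    (h : HasFDerivAt u u' x) (i : Fin 2) : HasPd i u (u' (dir i)) x :=
  ⟨h.differentiableAt, by simp [pd, h.fderiv]⟩

theorem HasPd.hasFDerivAt {i : Fin 2} {u : ℝ × ℝ → F} {d : F} {x : ℝ × ℝ} (h : HasPd i u d x) :
    HasFDerivAt u (fderiv ℝ u x) x := h.1.hasFDerivAt

theorem DifferentiableAt.hasPd {u : ℝ × ℝ → F} {x : ℝ × ℝ} (h : DifferentiableAt ℝ u x)
    (i : Fin 2) : HasPd i u (pd i u x) x := ⟨h, rfl⟩

theorem HasPd.congr_deriv {i : Fin 2} {u : ℝ × ℝ → F} {d d' : F} {x : ℝ × ℝ}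
    (h : HasPd i u d x) (hd : d = d') : HasPd i u d' x := hd ▸ h

theorem HasPd.add {i : Fin 2} {u v : ℝ × ℝ → F} {a b : F} {x : ℝ × ℝ}
    (hu : HasPd i u a x) (hv : HasPd i v b x) : HasPd i (fun q => u q + v q) (a + b) x := by
  have := hasPd_of_hasFDerivAt (hu.hasFDerivAt.add hv.hasFDerivAt) i
  exact this.congr_deriv (by rw [← hu.2, ← hv.2]; rfl)

theorem HasPd.sub {i : Fin 2} {u v : ℝ × ℝ → F} {a b : F} {x : ℝ × ℝ}
    (hu : HasPd i u a x) (hv : HasPd i v b x) : HasPd i (fun q => u q - v q) (a - b) x := by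
  have := hasPd_of_hasFDerivAt (hu.hasFDerivAt.sub hv.hasFDerivAt) i
  exact this.congr_deriv (by rw [← hu.2, ← hv.2]; rfl)

theorem HasPd.neg {i : Fin 2} {u : ℝ × ℝ → F} {a : F} {x : ℝ × ℝ}
    (hu : HasPd i u a x) : HasPd i (fun q => -u q) (-a) x := by
  have := hasPd_of_hasFDerivAt hu.hasFDerivAt.neg i
  exact this.congr_deriv (by rw [← hu.2]; rfl)

theorem hasPd_const (i : Fin 2) (c : F) (x : ℝ × ℝ) : HasPd i (fun _ => c) 0 x :=
  hasPd_of_hasFDerivAt (hasFDerivAt_const c x) i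

theorem HasPd.smul {i : Fin 2} {c : ℝ × ℝ → ℝ} {u : ℝ × ℝ → F} {a : ℝ} {b : F} {x : ℝ × ℝ}
    (hc : HasPd i c a x) (hu : HasPd i u b x) :
    HasPd i (fun q => c q • u q) (c x • b + a • u x) x := by
  have := hasPd_of_hasFDerivAt (hc.hasFDerivAt.smul hu.hasFDerivAt) i
  exact this.congr_deriv (by rw [← hc.2, ← hu.2]; rfl)

theorem HasPd.mul {i : Fin 2} {c u : ℝ × ℝ → ℝ} {a b : ℝ} {x : ℝ × ℝ}
    (hc : HasPd i c a x) (hu : HasPd i u b x) :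
    HasPd i (fun q => c q * u q) (c x * b + a * u x) x := hc.smul hu

theorem HasPd.const_mul {i : Fin 2} {u : ℝ × ℝ → ℝ} {b : ℝ} {x : ℝ × ℝ} (c : ℝ)
    (hu : HasPd i u b x) : HasPd i (fun q => c * u q) (c * b) x :=
  ((hasPd_const i c x).mul hu).congr_deriv (by ring)

theorem HasPd.div {i : Fin 2} {c u : ℝ × ℝ → ℝ} {a b : ℝ} {x : ℝ × ℝ}
    (hc : HasPd i c a x) (hu : HasPd i u b x) (h0 : u x ≠ 0) :
    HasPd i (fun q => c q / u q) ((a * u x - c x * b) / u x ^ 2) x := by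
  have h1 : HasFDerivAt (fun q => (u q)⁻¹) _ x :=
    (hasDerivAt_inv h0).comp_hasFDerivAt x hu.hasFDerivAt
  have h2 : HasPd i (fun q => (u q)⁻¹) (-b / u x ^ 2) x :=
    (hasPd_of_hasFDerivAt h1 i).congr_deriv (by
      rw [← hu.2, pd]; simp [div_eq_mul_inv, mul_comm])
  have := hc.mul h2
  simp only [div_eq_mul_inv] at this ⊢
  exact this.congr_deriv (by field_simp; ring)

theorem HasPd.comp_clm {i : Fin 2} {u : ℝ × ℝ → F} {d : F} {x : ℝ × ℝ} (L : F →L[ℝ] G)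
    (hu : HasPd i u d x) : HasPd i (fun q => L (u q)) (L d) x :=
  (hasPd_of_hasFDerivAt (L.hasFDerivAt.comp x hu.hasFDerivAt) i).congr_deriv
    (by rw [← hu.2]; rfl)

theorem HasPd.apply {i : Fin 2} {u : ℝ × ℝ → E42} {d : E42} {x : ℝ × ℝ}
    (hu : HasPd i u d x) (k : Fin 4) : HasPd i (fun q => u q k) (d k) x :=
  hu.comp_clm (ContinuousLinearMap.proj (R := ℝ) (φ := fun _ : Fin 4 => ℝ) k)

theorem hasPd_pi {i : Fin 2} {u : ℝ × ℝ → E42} {d : E42} {x : ℝ × ℝ}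
    (hu : ∀ k, HasPd i (fun q => u q k) (d k) x) : HasPd i u d x := by
  have h := hasFDerivAt_pi.2 fun k => (hu k).hasFDerivAt
  refine (hasPd_of_hasFDerivAt h i).congr_deriv ?_
  ext k; exact (hu k).2

theorem HasPd.nip {i : Fin 2} {u v : ℝ × ℝ → E42} {a b : E42} {x : ℝ × ℝ}
    (hu : HasPd i u a x) (hv : HasPd i v b x) :
    HasPd i (fun q => nip (u q) (v q)) (nip a (v x) + nip (u x) b) x := by
  have h := ((((hu.apply 0).mul (hv.apply 0)).neg.sub ((hu.apply 1).mul (hv.apply 1))).add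
    ((hu.apply 2).mul (hv.apply 2))).add ((hu.apply 3).mul (hv.apply 3))
  exact h.congr_deriv (by simp only [NeutralSurface.nip]; ring)

theorem hasPd_fst_zero (x : ℝ × ℝ) : HasPd 0 (fun q : ℝ × ℝ => q.1) 1 x :=
  (hasPd_of_hasFDerivAt hasFDerivAt_fst 0).congr_deriv (by simp [dir])
theorem hasPd_fst_one (x : ℝ × ℝ) : HasPd 1 (fun q : ℝ × ℝ => q.1) 0 x :=
  (hasPd_of_hasFDerivAt hasFDerivAt_fst 1).congr_deriv (by simp [dir])
theorem hasPd_snd_zero (x : ℝ × ℝ) : HasPd 0 (fun q : ℝ × ℝ => q.2) 0 x :=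
  (hasPd_of_hasFDerivAt hasFDerivAt_snd 0).congr_deriv (by simp [dir])
theorem hasPd_snd_one (x : ℝ × ℝ) : HasPd 1 (fun q : ℝ × ℝ => q.2) 1 x :=
  (hasPd_of_hasFDerivAt hasFDerivAt_snd 1).congr_deriv (by simp [dir])

/-- Functions agreeing on an open set have the same partial derivatives there. This is the form in
which identities valid on an open set are differentiated. -/
theorem HasPd.eq_of_eqOn {i : Fin 2} {u v : ℝ × ℝ → F} {a b : F} {x : ℝ × ℝ} {W : Set (ℝ × ℝ)}
    (hu : HasPd i u a x) (hv : HasPd i v b x) (hW : IsOpen W) (hx : x ∈ W)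
    (h : EqOn u v W) : a = b := by
  rw [← hu.2, ← hv.2, pd, pd, Filter.EventuallyEq.fderiv_eq]
  exact Filter.eventuallyEq_of_mem (hW.mem_nhds hx) h

theorem HasPd.congr_of_eqOn {i : Fin 2} {u v : ℝ × ℝ → F} {a : F} {x : ℝ × ℝ} {W : Set (ℝ × ℝ)}
    (hu : HasPd i u a x) (hW : IsOpen W) (hx : x ∈ W) (h : EqOn v u W) : HasPd i v a x := by
  have h' : v =ᶠ[𝓝 x] u := Filter.eventuallyEq_of_mem (hW.mem_nhds hx) h
  exact ⟨h'.differentiableAt_iff.2 hu.1, by rw [← hu.2, pd, pd, h'.fderiv_eq]⟩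

theorem pd_congr_of_eqOn (i : Fin 2) {u v : ℝ × ℝ → F} {W : Set (ℝ × ℝ)} (hW : IsOpen W)
    (h : EqOn u v W) : EqOn (pd i u) (pd i v) W := fun x hx => by
  rw [pd, pd, Filter.EventuallyEq.fderiv_eq]
  exact Filter.eventuallyEq_of_mem (hW.mem_nhds hx) h

theorem differentiableAt_of_contDiffOn {u : ℝ × ℝ → F} {W : Set (ℝ × ℝ)} (hu : ContDiffOn ℝ ∞ u W)
    (hW : IsOpen W) {x : ℝ × ℝ} (hx : x ∈ W) : DifferentiableAt ℝ u x :=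
  (hu.contDiffAt (hW.mem_nhds hx)).differentiableAt (by simp)

theorem hasPd_of_contDiffOn (i : Fin 2) {u : ℝ × ℝ → F} {W : Set (ℝ × ℝ)}
    (hu : ContDiffOn ℝ ∞ u W) (hW : IsOpen W) {x : ℝ × ℝ} (hx : x ∈ W) : HasPd i u (pd i u x) x :=
  ⟨differentiableAt_of_contDiffOn hu hW hx, rfl⟩

theorem contDiffOn_pd (i : Fin 2) {u : ℝ × ℝ → F} {W : Set (ℝ × ℝ)} (hu : ContDiffOn ℝ ∞ u W)
    (hW : IsOpen W) : ContDiffOn ℝ ∞ (pd i u) W :=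
  (hu.fderiv_of_isOpen (m := ∞) hW (by simp)).clm_apply contDiffOn_const

theorem pd_comm (i j : Fin 2) {u : ℝ × ℝ → F} {W : Set (ℝ × ℝ)} (hu : ContDiffOn ℝ ∞ u W)
    (hW : IsOpen W) {x : ℝ × ℝ} (hx : x ∈ W) : pd i (pd j u) x = pd j (pd i u) x := by
  have hsymm : IsSymmSndFDerivAt ℝ u x :=
    (hu.contDiffAt (hW.mem_nhds hx)).isSymmSndFDerivAt
      (by rw [minSmoothness_of_isRCLikeNormedField]; exact WithTop.coe_le_coe.2 le_top)
  have hd : DifferentiableAt ℝ (fderiv ℝ u) x :=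
    ((hu.fderiv_of_isOpen (m := ∞) hW (by simp)).contDiffAt (hW.mem_nhds hx)).differentiableAt
      (by simp)
  have key : ∀ k l : Fin 2, pd k (pd l u) x = fderiv ℝ (fderiv ℝ u) x (dir k) (dir l) := by
    intro k l
    have := (hd.hasFDerivAt.clm_apply (hasFDerivAt_const (dir l) x)).fderiv
    show fderiv ℝ (fun p => fderiv ℝ u p (dir l)) x (dir k) = _
    rw [this]; simp
  rw [key, key]
  exact hsymm.eq _ _

theorem fderiv_eq_pd {u : ℝ × ℝ → F} {x : ℝ × ℝ} (w : ℝ × ℝ) :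
    fderiv ℝ u x w = w.1 • pd 0 u x + w.2 • pd 1 u x := by
  have : w = w.1 • dir 0 + w.2 • dir 1 := by simp [dir]
  conv_lhs => rw [this]
  simp [pd]

/-- Jacobian matrix of a map of the plane: the entry `(a, i)` is the `i`-th partial derivative of
the `a`-th component. -/
noncomputable def jac (Ψ : ℝ × ℝ → ℝ × ℝ) (y : ℝ × ℝ) : Matrix (Fin 2) (Fin 2) ℝ :=
  Matrix.of fun a i => ![(pd i Ψ y).1, (pd i Ψ y).2] a

theorem hasPd_comp (i : Fin 2) {u : ℝ × ℝ → F} {Ψ : ℝ × ℝ → ℝ × ℝ} {y : ℝ × ℝ}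
    (hu : DifferentiableAt ℝ u (Ψ y)) (hΨ : DifferentiableAt ℝ Ψ y) :
    HasPd i (u ∘ Ψ) (∑ a, jac Ψ y a i • pd a u (Ψ y)) y := by
  refine (hasPd_of_hasFDerivAt (hu.hasFDerivAt.comp y hΨ.hasFDerivAt) i).congr_deriv ?_
  rw [ContinuousLinearMap.comp_apply, fderiv_eq_pd]
  simp [jac, Fin.sum_univ_two, pd]

/-- A function on a box with vanishing first partial derivative depends on the second coordinate
only. -/
theorem eq_of_pd_zero_eq_zero {u : ℝ × ℝ → F} {I J : Set ℝ} (hI : IsOpen I) (hI' : I.OrdConnected)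
    (hJ : IsOpen J) (hu : ContDiffOn ℝ ∞ u (I ×ˢ J)) (h : ∀ x ∈ I ×ˢ J, pd 0 u x = 0)
    {s s' t : ℝ} (hs : s ∈ I) (hs' : s' ∈ I) (ht : t ∈ J) : u (s, t) = u (s', t) := by
  have hd : ∀ r ∈ I, HasDerivAt (fun r => u (r, t)) 0 r := by
    intro r hr
    have h1 := (differentiableAt_of_contDiffOn hu (hI.prod hJ) (mk_mem_prod hr ht)).hasFDerivAt
    have h2 := h1.comp_hasDerivAt r ((hasDerivAt_id r).prodMk (hasDerivAt_const r t))
    have h3 := h _ (mk_mem_prod hr ht)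
    simp only [pd, dir, Matrix.cons_val_zero] at h3
    rw [h3] at h2
    exact h2
  have := hI'.convex.is_const_of_fderivWithin_eq_zero (𝕜 := ℝ) (f := fun r => u (r, t))
    (fun r hr => (hd r hr).differentiableAt.differentiableWithinAt) (fun r hr => by
      rw [fderivWithin_of_isOpen hI hr]
      ext; simp [(hd r hr).deriv]) hs hs'
  exact this

theorem contDiffOn_slice {u : ℝ × ℝ → F} {I J : Set ℝ}
    (hu : ContDiffOn ℝ ∞ u (I ×ˢ J)) {s : ℝ} (hs : s ∈ I) :
    ContDiffOn ℝ ∞ (fun t => u (s, t)) J :=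
  hu.comp (contDiffOn_const.prodMk contDiffOn_id) fun _ ht => mk_mem_prod hs ht

theorem hasPd_zero_comp_snd {a : ℝ → F} {x : ℝ × ℝ} (ha : DifferentiableAt ℝ a x.2) :
    HasPd 0 (fun q => a q.2) 0 x :=
  (hasPd_of_hasFDerivAt (ha.hasFDerivAt.comp x hasFDerivAt_snd) 0).congr_deriv (by simp [dir])

theorem hasPd_one_comp_snd {a : ℝ → F} {x : ℝ × ℝ} (ha : DifferentiableAt ℝ a x.2) :
    HasPd 1 (fun q => a q.2) (deriv a x.2) x :=
  (hasPd_of_hasFDerivAt (ha.hasFDerivAt.comp x hasFDerivAt_snd) 1).congr_deriv (by simp [dir])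

end PartialDerivatives

/-! ### Gauss, Codazzi and the biconservative equation on a patch -/

section Patch

theorem metric_apply (u : ℝ × ℝ → E42) (x : ℝ × ℝ) (i j : Fin 2) :
    metric u x i j = nip (pd i u x) (pd j u x) := rfl

theorem metric_symm (u : ℝ × ℝ → E42) (x : ℝ × ℝ) (i j : Fin 2) :
    metric u x i j = metric u x j i := nip_comm _ _

theorem metric_transpose (u : ℝ × ℝ → E42) (x : ℝ × ℝ) : (metric u x)ᵀ = metric u x := by
  ext i j; exact metric_symm u x j i

theorem metricInv_symm (u : ℝ × ℝ → E42) (x : ℝ × ℝ) (i j : Fin 2) :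
    metricInv u x i j = metricInv u x j i := by
  have : (metricInv u x)ᵀ = metricInv u x := by
    rw [metricInv, Matrix.transpose_nonsing_inv, metric_transpose]
  exact congrFun (congrFun this j) i

theorem metric_det (u : ℝ × ℝ → E42) (x : ℝ × ℝ) :
    (metric u x).det = nip (pd 0 u x) (pd 0 u x) * nip (pd 1 u x) (pd 1 u x) -
      nip (pd 0 u x) (pd 1 u x) * nip (pd 0 u x) (pd 1 u x) := by
  rw [Matrix.det_fin_two]; simp only [metric_apply, nip_comm (pd 1 u x) (pd 0 u x)]

/-- A parametrized surface on an open set: smooth, with non-degenerate induced metric. -/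
structure IsPatch (u : ℝ × ℝ → E42) (W : Set (ℝ × ℝ)) : Prop where
  isOpen : IsOpen W
  smooth : ContDiffOn ℝ ∞ u W
  det_ne : ∀ x ∈ W, (metric u x).det ≠ 0

theorem IsPatch.mono {u : ℝ × ℝ → E42} {W W' : Set (ℝ × ℝ)} (h : IsPatch u W) (hW : IsOpen W')
    (hle : W' ⊆ W) : IsPatch u W' :=
  ⟨hW, h.smooth.mono hle, fun x hx => h.det_ne x (hle hx)⟩

theorem metricInv_mul_metric {u : ℝ × ℝ → E42} {x : ℝ × ℝ} (h : (metric u x).det ≠ 0)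
    (i j : Fin 2) : ∑ k, metricInv u x i k * metric u x k j = if i = j then 1 else 0 := by
  have := Matrix.nonsing_inv_mul (metric u x) (isUnit_iff_ne_zero.2 h)
  have := congrFun (congrFun this i) j
  simp only [Matrix.mul_apply, Matrix.one_apply] at this
  exact this

theorem tangentPart_add (u : ℝ × ℝ → E42) (x : ℝ × ℝ) (v w : E42) :
    tangentPart u x (v + w) = tangentPart u x v + tangentPart u x w := by
  simp only [tangentPart, Fin.sum_univ_two, nip_add_left]; module

theorem tangentPart_smul (u : ℝ × ℝ → E42) (x : ℝ × ℝ) (c : ℝ) (w : E42) :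
    tangentPart u x (c • w) = c • tangentPart u x w := by
  simp only [tangentPart, Fin.sum_univ_two, nip_smul_left]; module

theorem normalPart_add (u : ℝ × ℝ → E42) (x : ℝ × ℝ) (v w : E42) :
    normalPart u x (v + w) = normalPart u x v + normalPart u x w := by
  simp only [normalPart, tangentPart_add]; module

theorem normalPart_smul (u : ℝ × ℝ → E42) (x : ℝ × ℝ) (c : ℝ) (w : E42) :
    normalPart u x (c • w) = c • normalPart u x w := by
  simp only [normalPart, tangentPart_smul]; module

theorem tangentPart_eq_zero {u : ℝ × ℝ → E42} {x : ℝ × ℝ} {v : E42}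
    (h : ∀ k, nip v (pd k u x) = 0) : tangentPart u x v = 0 := by
  simp [tangentPart, h]

theorem normalPart_eq_self {u : ℝ × ℝ → E42} {x : ℝ × ℝ} {v : E42}
    (h : ∀ k, nip v (pd k u x) = 0) : normalPart u x v = v := by
  simp [normalPart, tangentPart_eq_zero h]

theorem nip_tangentPart {u : ℝ × ℝ → E42} {x : ℝ × ℝ} (h : (metric u x).det ≠ 0) (v : E42)
    (k : Fin 2) : nip (tangentPart u x v) (pd k u x) = nip v (pd k u x) := by
  have h0 := metricInv_mul_metric h 0 k
  have h1 := metricInv_mul_metric h 1 k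
  simp only [Fin.sum_univ_two, metric_apply] at h0 h1
  simp only [tangentPart, Fin.sum_univ_two, nip_add_left, nip_smul_left]
  have : nip v (pd k u x) = nip v (pd 0 u x) * (if (0 : Fin 2) = k then 1 else 0) +
      nip v (pd 1 u x) * (if (1 : Fin 2) = k then 1 else 0) := by
    fin_cases k <;> simp
  rw [this, ← h0, ← h1]; ring

theorem nip_normalPart {u : ℝ × ℝ → E42} {x : ℝ × ℝ} (h : (metric u x).det ≠ 0) (v : E42)
    (k : Fin 2) : nip (normalPart u x v) (pd k u x) = 0 := by
  rw [normalPart, nip_sub_left, nip_tangentPart h, sub_self]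

theorem tangentPart_pd {u : ℝ × ℝ → E42} {x : ℝ × ℝ} (h : (metric u x).det ≠ 0)
    (k : Fin 2) : tangentPart u x (pd k u x) = pd k u x := by
  have h0 := metricInv_mul_metric h 0 k
  have h1 := metricInv_mul_metric h 1 k
  simp only [Fin.sum_univ_two, metric_apply] at h0 h1
  have : tangentPart u x (pd k u x) = (if (0 : Fin 2) = k then (1:ℝ) else 0) • pd 0 u x +
      (if (1 : Fin 2) = k then (1:ℝ) else 0) • pd 1 u x := by
    rw [← h0, ← h1]
    simp only [tangentPart, Fin.sum_univ_two, nip_comm (pd k u x), metricInv_symm u x 1 0]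
    module
  rw [this]; fin_cases k <;> simp

theorem normalPart_pd {u : ℝ × ℝ → E42} {x : ℝ × ℝ} (h : (metric u x).det ≠ 0)
    (k : Fin 2) : normalPart u x (pd k u x) = 0 := by
  rw [normalPart, tangentPart_pd h, sub_self]

theorem nip_normal_tangentPart {u : ℝ × ℝ → E42} {x : ℝ × ℝ} {n : E42}
    (hn : ∀ k, nip n (pd k u x) = 0) (v : E42) : nip n (tangentPart u x v) = 0 := by
  simp [tangentPart, Fin.sum_univ_two, hn]

theorem nip_normal_normalPart {u : ℝ × ℝ → E42} {x : ℝ × ℝ} {n : E42}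
    (hn : ∀ k, nip n (pd k u x) = 0) (v : E42) : nip n (normalPart u x v) = nip n v := by
  simp [normalPart, nip_normal_tangentPart hn]

variable {u : ℝ × ℝ → E42} {W : Set (ℝ × ℝ)}

theorem contDiffOn_nip {a b : ℝ × ℝ → E42} (ha : ContDiffOn ℝ ∞ a W) (hb : ContDiffOn ℝ ∞ b W) :
    ContDiffOn ℝ ∞ (fun x => nip (a x) (b x)) W := by
  have ha' := contDiffOn_pi.1 ha
  have hb' := contDiffOn_pi.1 hb
  unfold nip
  exact ((((ha' 0).mul (hb' 0)).neg.sub ((ha' 1).mul (hb' 1))).add ((ha' 2).mul (hb' 2))).add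
    ((ha' 3).mul (hb' 3))

namespace IsPatch

theorem contDiffOn_pd (hu : IsPatch u W) (i : Fin 2) : ContDiffOn ℝ ∞ (pd i u) W :=
  NeutralSurface.contDiffOn_pd i hu.smooth hu.isOpen

theorem contDiffOn_metric (hu : IsPatch u W) (i j : Fin 2) :
    ContDiffOn ℝ ∞ (fun x => metric u x i j) W :=
  contDiffOn_nip (hu.contDiffOn_pd i) (hu.contDiffOn_pd j)

theorem contDiffOn_det (hu : IsPatch u W) : ContDiffOn ℝ ∞ (fun x => (metric u x).det) W := by
  simp only [Matrix.det_fin_two]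
  exact ((hu.contDiffOn_metric 0 0).mul (hu.contDiffOn_metric 1 1)).sub
    ((hu.contDiffOn_metric 0 1).mul (hu.contDiffOn_metric 1 0))

theorem contDiffOn_metricInv (hu : IsPatch u W) (i j : Fin 2) :
    ContDiffOn ℝ ∞ (fun x => metricInv u x i j) W := by
  have hd := hu.contDiffOn_det.inv hu.det_ne
  have h : ∀ x, metricInv u x i j = (metric u x).det⁻¹ * (metric u x).adjugate i j := fun x => by
    simp [metricInv, Matrix.inv_def, Ring.inverse_eq_inv']
  simp only [h]
  refine hd.mul ?_
  simp only [Matrix.adjugate_fin_two]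
  fin_cases i <;> fin_cases j
  · exact hu.contDiffOn_metric 1 1
  · exact (hu.contDiffOn_metric 0 1).neg
  · exact (hu.contDiffOn_metric 1 0).neg
  · exact hu.contDiffOn_metric 0 0

theorem contDiffOn_tangentPart (hu : IsPatch u W) {v : ℝ × ℝ → E42} (hv : ContDiffOn ℝ ∞ v W) :
    ContDiffOn ℝ ∞ (fun x => tangentPart u x (v x)) W :=
  ContDiffOn.sum fun i _ => ContDiffOn.sum fun j _ =>
    ((hu.contDiffOn_metricInv i j).mul (contDiffOn_nip hv (hu.contDiffOn_pd i))).smul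
      (hu.contDiffOn_pd j)

theorem contDiffOn_normalPart (hu : IsPatch u W) {v : ℝ × ℝ → E42} (hv : ContDiffOn ℝ ∞ v W) :
    ContDiffOn ℝ ∞ (fun x => normalPart u x (v x)) W :=
  hv.sub (hu.contDiffOn_tangentPart hv)

theorem contDiffOn_secondFund (hu : IsPatch u W) (i j : Fin 2) :
    ContDiffOn ℝ ∞ (secondFund u i j) W :=
  hu.contDiffOn_normalPart (NeutralSurface.contDiffOn_pd i (hu.contDiffOn_pd j) hu.isOpen)

theorem contDiffOn_meanCurv (hu : IsPatch u W) : ContDiffOn ℝ ∞ (meanCurv u) W :=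
  (ContDiffOn.sum fun i _ => ContDiffOn.sum fun j _ =>
    (hu.contDiffOn_metricInv i j).smul (hu.contDiffOn_secondFund i j)).const_smul (1 / 2 : ℝ)

theorem contDiffOn_pd_meanCurv (hu : IsPatch u W) (i : Fin 2) :
    ContDiffOn ℝ ∞ (pd i (meanCurv u)) W :=
  NeutralSurface.contDiffOn_pd i hu.contDiffOn_meanCurv hu.isOpen

theorem contDiffOn_shapeOp (hu : IsPatch u W) (i : Fin 2) :
    ContDiffOn ℝ ∞ (shapeOp u (meanCurv u) i) W :=
  (hu.contDiffOn_tangentPart (hu.contDiffOn_pd_meanCurv i)).neg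

theorem contDiffOn_christoffel (hu : IsPatch u W) (k i j : Fin 2) :
    ContDiffOn ℝ ∞ (christoffel u k i j) W :=
  contDiffOn_const.mul (ContDiffOn.sum fun l _ => (hu.contDiffOn_metricInv k l).mul
    (((NeutralSurface.contDiffOn_pd i (hu.contDiffOn_metric j l) hu.isOpen).add
      (NeutralSurface.contDiffOn_pd j (hu.contDiffOn_metric i l) hu.isOpen)).sub
      (NeutralSurface.contDiffOn_pd l (hu.contDiffOn_metric i j) hu.isOpen)))

theorem contDiffOn_gaussCurv (hu : IsPatch u W) : ContDiffOn ℝ ∞ (gaussCurv u) W := by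
  refine ContDiffOn.div (ContDiffOn.sum fun l _ => ContDiffOn.mul ?_ (hu.contDiffOn_metric l 0))
    hu.contDiffOn_det hu.det_ne
  refine (ContDiffOn.sub ?_ ?_).add (ContDiffOn.sum fun k _ => ContDiffOn.sub ?_ ?_)
  · exact NeutralSurface.contDiffOn_pd 0 (hu.contDiffOn_christoffel l 1 1) hu.isOpen
  · exact NeutralSurface.contDiffOn_pd 1 (hu.contDiffOn_christoffel l 0 1) hu.isOpen
  · exact (hu.contDiffOn_christoffel k 1 1).mul (hu.contDiffOn_christoffel l 0 k)
  · exact (hu.contDiffOn_christoffel k 0 1).mul (hu.contDiffOn_christoffel l 1 k)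

theorem hasPd (hu : IsPatch u W) {x : ℝ × ℝ} (hx : x ∈ W) (i : Fin 2) : HasPd i u (pd i u x) x :=
  hasPd_of_contDiffOn i hu.smooth hu.isOpen hx

theorem hasPd_pd (hu : IsPatch u W) {x : ℝ × ℝ} (hx : x ∈ W) (i j : Fin 2) :
    HasPd i (pd j u) (pd i (pd j u) x) x :=
  hasPd_of_contDiffOn i (hu.contDiffOn_pd j) hu.isOpen hx

theorem hasPd_meanCurv (hu : IsPatch u W) {x : ℝ × ℝ} (hx : x ∈ W) (i : Fin 2) :
    HasPd i (meanCurv u) (pd i (meanCurv u) x) x :=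
  hasPd_of_contDiffOn i hu.contDiffOn_meanCurv hu.isOpen hx

theorem pd_pd_comm (hu : IsPatch u W) {x : ℝ × ℝ} (hx : x ∈ W) (i j : Fin 2) :
    pd i (pd j u) x = pd j (pd i u) x := pd_comm i j hu.smooth hu.isOpen hx

theorem hasPd_metric (hu : IsPatch u W) {x : ℝ × ℝ} (hx : x ∈ W) (l i j : Fin 2) :
    HasPd l (fun q => metric u q i j)
      (nip (pd l (pd i u) x) (pd j u x) + nip (pd i u x) (pd l (pd j u) x)) x :=
  (hu.hasPd_pd hx l i).nip (hu.hasPd_pd hx l j)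

theorem christoffel_eq (hu : IsPatch u W) {x : ℝ × ℝ} (hx : x ∈ W) (k i j : Fin 2) :
    christoffel u k i j x = ∑ l, metricInv u x k l * nip (pd i (pd j u) x) (pd l u x) := by
  rw [christoffel, Finset.mul_sum]
  refine Finset.sum_congr rfl fun l _ => ?_
  rw [(hu.hasPd_metric hx i j l).2, (hu.hasPd_metric hx j i l).2, (hu.hasPd_metric hx l i j).2,
    hu.pd_pd_comm hx j i, hu.pd_pd_comm hx l i, hu.pd_pd_comm hx l j,
    nip_comm (pd j u x), nip_comm (pd i u x)]
  ring

theorem tangentPart_pd_pd (hu : IsPatch u W) {x : ℝ × ℝ} (hx : x ∈ W) (i j : Fin 2) :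
    tangentPart u x (pd i (pd j u) x) = ∑ k, christoffel u k i j x • pd k u x := by
  simp only [hu.christoffel_eq hx, tangentPart, Fin.sum_univ_two, metricInv_symm u x 1 0]
  module

/-- Gauss formula. -/
theorem secondFund_eq (hu : IsPatch u W) {x : ℝ × ℝ} (hx : x ∈ W) (i j : Fin 2) :
    secondFund u i j x = pd i (pd j u) x - ∑ k, christoffel u k i j x • pd k u x := by
  rw [← hu.tangentPart_pd_pd hx]; rfl

theorem secondFund_symm (hu : IsPatch u W) {x : ℝ × ℝ} (hx : x ∈ W) (i j : Fin 2) :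
    secondFund u i j x = secondFund u j i x := by
  rw [secondFund, secondFund, hu.pd_pd_comm hx]

theorem nip_secondFund (hu : IsPatch u W) {x : ℝ × ℝ} (hx : x ∈ W) (i j k : Fin 2) :
    nip (secondFund u i j x) (pd k u x) = 0 := nip_normalPart (hu.det_ne x hx) _ _

theorem nip_meanCurv (hu : IsPatch u W) {x : ℝ × ℝ} (hx : x ∈ W) (k : Fin 2) :
    nip (meanCurv u x) (pd k u x) = 0 := by
  simp [meanCurv, Fin.sum_univ_two, hu.nip_secondFund hx]

theorem tension_eq (hu : IsPatch u W) {x : ℝ × ℝ} (hx : x ∈ W) :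
    tension u x = (-2 : ℝ) • meanCurv u x := by
  simp only [tension, meanCurv, hu.secondFund_eq hx, Fin.sum_univ_two]
  module

theorem nip_pd_meanCurv (hu : IsPatch u W) {x : ℝ × ℝ} (hx : x ∈ W) (j l : Fin 2) :
    nip (pd j (meanCurv u) x) (pd l u x) = -nip (meanCurv u x) (pd j (pd l u) x) := by
  have h := ((hu.hasPd_meanCurv hx j).nip (hu.hasPd_pd hx j l)).eq_of_eqOn (hasPd_const j 0 x)
    hu.isOpen hx fun y hy => hu.nip_meanCurv hy l
  linarith

theorem nip_pd_meanCurv' (hu : IsPatch u W) {x : ℝ × ℝ} (hx : x ∈ W) (j l : Fin 2) :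
    nip (pd j (meanCurv u) x) (pd l u x) = -nip (meanCurv u x) (secondFund u j l x) := by
  rw [hu.nip_pd_meanCurv hx, secondFund, nip_normal_normalPart (hu.nip_meanCurv hx)]

/-- The tangential part of `∂ᵢ∂ⱼu` is the covariant derivative `∇_{∂ᵢ}∂ⱼ`. -/
theorem nip_pd_pd (hu : IsPatch u W) {x : ℝ × ℝ} (hx : x ∈ W) (i j k : Fin 2) :
    nip (pd i (pd j u) x) (pd k u x) = ∑ l, christoffel u l i j x * metric u x l k := by
  rw [← nip_tangentPart (hu.det_ne x hx), hu.tangentPart_pd_pd hx]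
  simp [Fin.sum_univ_two, metric_apply]

/-- Theorema egregium: the Gaussian curvature is the (indefinite) determinant of the second
fundamental form divided by that of the metric. -/
theorem gaussCurv_eq (hu : IsPatch u W) {x : ℝ × ℝ} (hx : x ∈ W) :
    gaussCurv u x = (nip (secondFund u 0 0 x) (secondFund u 1 1 x) -
      nip (secondFund u 0 1 x) (secondFund u 0 1 x)) / (metric u x).det := by
  rw [gaussCurv]
  congr 1
  have gauss : ∀ i j, EqOn (pd i (pd j u)) (fun q => secondFund u i j q +
      (christoffel u 0 i j q • pd 0 u q + christoffel u 1 i j q • pd 1 u q)) W := by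
    intro i j q hq
    simp only [hu.secondFund_eq hq, Fin.sum_univ_two]; module
  have hΓ : ∀ l k i j, HasPd l (christoffel u k i j) (pd l (christoffel u k i j) x) x :=
    fun l k i j => hasPd_of_contDiffOn l (hu.contDiffOn_christoffel k i j) hu.isOpen hx
  have hh : ∀ l i j, HasPd l (secondFund u i j) (pd l (secondFund u i j) x) x :=
    fun l i j => hasPd_of_contDiffOn l (hu.contDiffOn_secondFund i j) hu.isOpen hx
  have third : ∀ l i j, pd l (pd i (pd j u)) x = pd l (secondFund u i j) x +
      ((christoffel u 0 i j x • pd l (pd 0 u) x + pd l (christoffel u 0 i j) x • pd 0 u x) +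
      (christoffel u 1 i j x • pd l (pd 1 u) x + pd l (christoffel u 1 i j) x • pd 1 u x)) := by
    intro l i j
    exact (hasPd_of_contDiffOn l (NeutralSurface.contDiffOn_pd i (hu.contDiffOn_pd j) hu.isOpen)
      hu.isOpen hx).eq_of_eqOn ((hh l i j).add (((hΓ l 0 i j).smul (hu.hasPd_pd hx l 0)).add
        ((hΓ l 1 i j).smul (hu.hasPd_pd hx l 1)))) hu.isOpen hx (gauss i j)
  -- the Gauss equation is the `∂₀u`-component of `∂₀(∂₁∂₁u) = ∂₁(∂₀∂₁u)`
  have hcomm := pd_comm 0 1 (hu.contDiffOn_pd 1) hu.isOpen hx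
  rw [third 0 1 1, third 1 0 1] at hcomm
  have hcomm := congrArg (fun w => nip w (pd 0 u x)) hcomm
  have weingarten : ∀ l i j, nip (pd l (secondFund u i j) x) (pd 0 u x) =
      -nip (secondFund u i j x) (secondFund u l 0 x) := by
    intro l i j
    have h := ((hh l i j).nip (hu.hasPd_pd hx l 0)).eq_of_eqOn (hasPd_const l 0 x)
      hu.isOpen hx fun y hy => hu.nip_secondFund hy i j 0
    rw [show secondFund u l 0 x = normalPart u x (pd l (pd 0 u) x) from rfl,
      nip_normal_normalPart (hu.nip_secondFund hx i j)]
    exact eq_neg_of_add_eq_zero_left h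
  simp only [nip_add_left, nip_smul_left, weingarten, hu.nip_pd_pd hx, Fin.sum_univ_two,
    hu.secondFund_symm hx 1 0] at hcomm
  simp only [Fin.sum_univ_two]
  simp only [← metric_apply] at hcomm
  rw [nip_comm (secondFund u 1 1 x)] at hcomm
  linear_combination hcomm

/-- The inverse metric is parallel for the Levi-Civita connection. -/
theorem hasPd_metricInv (hu : IsPatch u W) {x : ℝ × ℝ} (hx : x ∈ W) (l i j : Fin 2) :
    HasPd l (fun q => metricInv u q i j) (-∑ a, (metricInv u x i a * christoffel u j l a x +
      metricInv u x j a * christoffel u i l a x)) x := by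
  have hD := fun i j => hasPd_of_contDiffOn l (hu.contDiffOn_metricInv i j) hu.isOpen hx
  refine (hD i j).congr_deriv ?_
  set D : Matrix (Fin 2) (Fin 2) ℝ := Matrix.of fun i j => pd l (fun q => metricInv u q i j) x
    with hDdef
  set C : Matrix (Fin 2) (Fin 2) ℝ := Matrix.of fun k a => christoffel u k l a x with hC
  have key : D * metric u x + metricInv u x * (Cᵀ * metric u x + metric u x * C) = 0 := by
    ext a b
    have h := (((hD a 0).mul (hu.hasPd_metric hx l 0 b)).add
      ((hD a 1).mul (hu.hasPd_metric hx l 1 b))).eq_of_eqOn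
        (hasPd_const l (if a = b then 1 else 0) x) hu.isOpen hx fun y hy => by
          have := metricInv_mul_metric (hu.det_ne y hy) a b
          simpa [Fin.sum_univ_two] using this
    rw [hu.nip_pd_pd hx, hu.nip_pd_pd hx, nip_comm (pd 0 u x), nip_comm (pd 1 u x),
      hu.nip_pd_pd hx, hu.nip_pd_pd hx] at h
    simp only [Fin.sum_univ_two, metric_symm u x 1 0] at h
    simp only [Matrix.add_apply, Matrix.mul_apply, Fin.sum_univ_two, hDdef, hC, Matrix.of_apply,
      Matrix.transpose_apply, Matrix.zero_apply, metric_symm u x 1 0]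
    linear_combination h
  have hgg : metric u x * metricInv u x = 1 :=
    Matrix.mul_nonsing_inv _ (isUnit_iff_ne_zero.2 (hu.det_ne x hx))
  have hgg' : metricInv u x * metric u x = 1 :=
    Matrix.nonsing_inv_mul _ (isUnit_iff_ne_zero.2 (hu.det_ne x hx))
  have hfin : D = -(metricInv u x * Cᵀ + C * metricInv u x) := by
    have h1 := congrArg (fun X => X * metricInv u x) key
    simp only [add_mul, mul_add, zero_mul, mul_assoc, hgg, mul_one] at h1
    rw [← mul_assoc (metricInv u x) (metric u x), hgg', one_mul] at h1
    exact eq_neg_of_add_eq_zero_left h1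
  have := congrFun (congrFun hfin i) j
  simp only [Matrix.neg_apply, Matrix.add_apply, Matrix.mul_apply, Fin.sum_univ_two, hDdef, hC,
    Matrix.of_apply, Matrix.transpose_apply] at this
  rw [this, Fin.sum_univ_two, metricInv_symm u x j 0, metricInv_symm u x j 1]
  ring

end IsPatch

/-- The one-form `∑ g^{ij} ⟨∇^⊥_{∂ᵢ} H, h(∂ⱼ, ∂ₗ)⟩`, the metric dual of `trace A_{∇^⊥ H}`. -/
noncomputable def traceShapeNabla (u : ℝ × ℝ → E42) (x : ℝ × ℝ) (l : Fin 2) : ℝ :=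
  ∑ i, ∑ j, metricInv u x i j * nip (normalDeriv u i (meanCurv u) x) (secondFund u j l x)

/-- On a surface with null mean curvature vector the tangential part of the bitension field is
`trace A_{∇^⊥ H}` up to a factor: the other contribution, the differential of `⟨H, H⟩`, vanishes. -/
theorem IsPatch.nip_bitension (hu : IsPatch u W)
    (hH : ∀ x ∈ W, nip (meanCurv u x) (meanCurv u x) = 0) {x : ℝ × ℝ} (hx : x ∈ W) (l : Fin 2) :
    nip (bitension u x) (pd l u x) = 4 * traceShapeNabla u x l := by
  set H := meanCurv u with hHdef
  have hHs : ContDiffOn ℝ ∞ H W := hu.contDiffOn_meanCurv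
  have τ1 : ∀ j, EqOn (pd j (tension u)) (fun q => (-2 : ℝ) • pd j H q) W := by
    intro j q hq
    have h := ((hasPd_const j (-2 : ℝ) q).smul (hu.hasPd_meanCurv hq j)).congr_of_eqOn
      hu.isOpen hq fun y hy => hu.tension_eq hy
    rw [h.2]; simp [hHdef]
  have hHp : ∀ i j, HasPd i (pd j H) (pd i (pd j H) x) x := fun i j =>
    hasPd_of_contDiffOn i (NeutralSurface.contDiffOn_pd j hHs hu.isOpen) hu.isOpen hx
  have τ2 : ∀ i j, pd i (pd j (tension u)) x = (-2 : ℝ) • pd i (pd j H) x := by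
    intro i j
    have h := ((hasPd_const i (-2 : ℝ) x).smul (hHp i j)).congr_of_eqOn hu.isOpen hx (τ1 j)
    rw [h.2]; simp
  have hb : bitension u x = (-2 : ℝ) • ∑ i, ∑ j, metricInv u x i j •
      (pd i (pd j H) x - ∑ k, christoffel u k i j x • pd k H x) := by
    rw [bitension, roughLaplacian, neg_neg]
    simp only [τ2, τ1 _ hx, Fin.sum_univ_two]
    module
  have hh : ∀ l i j, HasPd l (secondFund u i j) (pd l (secondFund u i j) x) x :=
    fun l i j => hasPd_of_contDiffOn l (hu.contDiffOn_secondFund i j) hu.isOpen hx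
  have hΓ : ∀ l k i j, HasPd l (christoffel u k i j) (pd l (christoffel u k i j) x) x :=
    fun l k i j => hasPd_of_contDiffOn l (hu.contDiffOn_christoffel k i j) hu.isOpen hx
  -- second derivative of `⟨H, ∂ₗu⟩ = 0`
  have hA : ∀ i j, nip (pd i (pd j H) x) (pd l u x) = -nip (pd j H x) (pd i (pd l u) x) -
      nip (pd i H x) (pd j (pd l u) x) - nip (H x) (pd l (pd i (pd j u)) x) := by
    intro i j
    have h3 : pd l (pd i (pd j u)) x = pd i (pd j (pd l u)) x := by
      rw [pd_comm l i (hu.contDiffOn_pd j) hu.isOpen hx]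
      exact pd_congr_of_eqOn i hu.isOpen (fun y hy => hu.pd_pd_comm hy l j) hx
    have h := ((hHp i j).nip (hu.hasPd_pd hx i l)).eq_of_eqOn
      ((hu.hasPd_meanCurv hx i).nip (hasPd_of_contDiffOn i
        (NeutralSurface.contDiffOn_pd j (hu.contDiffOn_pd l) hu.isOpen) hu.isOpen hx)).neg
      hu.isOpen hx fun y hy => hu.nip_pd_meanCurv hy j l
    rw [h3]
    simp only [← hHdef] at h
    linear_combination h
  have hB : ∀ i j, nip (H x) (pd l (pd i (pd j u)) x) = nip (H x) (pd l (secondFund u i j) x) +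
      christoffel u 0 i j x * nip (H x) (pd l (pd 0 u) x) +
      christoffel u 1 i j x * nip (H x) (pd l (pd 1 u) x) := by
    intro i j
    have h : pd l (pd i (pd j u)) x = _ :=
      (hasPd_of_contDiffOn l (NeutralSurface.contDiffOn_pd i (hu.contDiffOn_pd j) hu.isOpen)
      hu.isOpen hx).eq_of_eqOn ((hh l i j).add (((hΓ l 0 i j).smul (hu.hasPd_pd hx l 0)).add
        ((hΓ l 1 i j).smul (hu.hasPd_pd hx l 1)))) hu.isOpen hx fun q hq => by
          simp only [hu.secondFund_eq hq, Fin.sum_univ_two]; module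
    rw [h]
    simp only [nip_add_right, nip_smul_right, hHdef, hu.nip_meanCurv hx]
    ring
  -- derivative of `∑ g^{ij} h_{ij} = 2 H`, paired with `H`
  have hC : ∑ i, ∑ j, (metricInv u x i j * nip (H x) (pd l (secondFund u i j) x) -
      (∑ a, (metricInv u x i a * christoffel u j l a x +
        metricInv u x j a * christoffel u i l a x)) * nip (H x) (secondFund u i j x)) = 0 := by
    have hg := fun i j => (hu.hasPd_metricInv hx l i j).smul (hh l i j)
    have h := (((hg 0 0).add (hg 0 1)).add ((hg 1 0).add (hg 1 1))).eq_of_eqOn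
      ((hasPd_const l (2 : ℝ) x).smul (hu.hasPd_meanCurv hx l)) hu.isOpen hx fun q _ => by
        simp only [meanCurv, Fin.sum_univ_two]; module
    have hn := ((hu.hasPd_meanCurv hx l).nip (hu.hasPd_meanCurv hx l)).eq_of_eqOn
      (hasPd_const l 0 x) hu.isOpen hx fun y hy => hH y hy
    rw [nip_comm] at hn
    have hn : nip (H x) (pd l H x) = 0 := by linarith
    have h := congrArg (fun w => nip (H x) w) h
    simp only [← hHdef, nip_add_right, nip_smul_right, zero_smul, hn, mul_zero,
      add_zero] at h
    simp only [Fin.sum_univ_two] at h ⊢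
    linear_combination h
  have hD : ∀ i j, nip (pd j H x) (pd i (pd l u) x) =
      nip (normalDeriv u j H x) (secondFund u i l x) -
        ∑ k, christoffel u k i l x * nip (H x) (secondFund u j k x) := by
    intro i j
    have h1 : pd i (pd l u) x = secondFund u i l x +
        ∑ k, christoffel u k i l x • pd k u x := by rw [hu.secondFund_eq hx]; module
    rw [h1]
    simp only [nip_add_right, Fin.sum_univ_two, nip_smul_right, hHdef, hu.nip_pd_meanCurv' hx]
    rw [normalDeriv, nip_comm (normalPart _ _ _),
      nip_normal_normalPart (hu.nip_secondFund hx i l), nip_comm (secondFund u i l x)]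
    ring
  have hE : ∀ i, nip (H x) (pd l (pd i u) x) = nip (H x) (secondFund u l i x) := fun i => by
    rw [secondFund, nip_normal_normalPart (hu.nip_meanCurv hx)]
  have hF : ∀ k, nip (pd k H x) (pd l u x) = -nip (H x) (secondFund u k l x) :=
    fun k => hu.nip_pd_meanCurv' hx k l
  have hs := hu.secondFund_symm hx
  have hg := metricInv_symm u x 1 0
  have hΓs : ∀ k i j, christoffel u k i j x = christoffel u k j i x := fun k i j => by
    rw [hu.christoffel_eq hx, hu.christoffel_eq hx, hu.pd_pd_comm hx]
  rw [hb, traceShapeNabla]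
  simp only [nip_smul_left, nip_sub_left, nip_add_left, Fin.sum_univ_two, hA, hB, hF, hD, ← hHdef,
    hE] at hC ⊢
  rw [hs l 0, hs l 1, hs 1 0, hg, hΓs 0 1 0, hΓs 1 1 0] at *
  rw [hΓs 0 0 l, hΓs 1 0 l, hΓs 0 1 l, hΓs 1 1 l]
  linear_combination 2 * hC

end Patch

/-! ### Invariance under changes of parameters and congruences -/

section Invariance

/-- The pointwise form of the geometric conditions: the mean curvature vector `H` is light-like,
the tangential part of the bitension field vanishes (in its tensorial form
`trace A_{∇^⊥ H} = 0`), and `∇^⊥ H ≠ 0`. -/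
def IsProperAt (u : ℝ × ℝ → E42) (x : ℝ × ℝ) : Prop :=
  IsLightlike (meanCurv u x) ∧ (∀ l, traceShapeNabla u x l = 0) ∧
    ∃ i, normalDeriv u i (meanCurv u) x ≠ 0

/-- `A_H = 0` at the point `x` of a patch. -/
def ShapeVanishes (u : ℝ × ℝ → E42) (x : ℝ × ℝ) : Prop := ∀ i, shapeOp u (meanCurv u) i x = 0

/-- A smooth change of parameters with invertible differential. -/
structure IsReparam (Ψ : ℝ × ℝ → ℝ × ℝ) (W' W : Set (ℝ × ℝ)) : Prop where
  isOpen : IsOpen W'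
  smooth : ContDiffOn ℝ ∞ Ψ W'
  mapsTo : MapsTo Ψ W' W
  det_ne : ∀ y ∈ W', (jac Ψ y).det ≠ 0

variable {V : Type*} [AddCommGroup V] [Module ℝ V]

theorem sum_smul_eq_zero_iff {J : Matrix (Fin 2) (Fin 2) ℝ} (hJ : J.det ≠ 0) (X : Fin 2 → V) :
    (∀ l, ∑ b, J b l • X b = 0) ↔ ∀ b, X b = 0 := by
  refine ⟨fun h => ?_, fun h l => by simp [h]⟩
  rw [Matrix.det_fin_two] at hJ
  have h0 := h 0
  have h1 := h 1
  simp only [Fin.sum_univ_two] at h0 h1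
  have e0 : (J 0 0 * J 1 1 - J 0 1 * J 1 0) • X 0 = 0 := by
    linear_combination (norm := module) J 1 1 • h0 - J 1 0 • h1
  have e1 : (J 0 0 * J 1 1 - J 0 1 * J 1 0) • X 1 = 0 := by
    linear_combination (norm := module) J 0 0 • h1 - J 0 1 • h0
  rw [Fin.forall_fin_two]
  exact ⟨(smul_eq_zero.1 e0).resolve_left hJ, (smul_eq_zero.1 e1).resolve_left hJ⟩

/-- Invariance of a contraction with the inverse metric under a change of basis `J`. -/
theorem sum_contract {J g g' : Matrix (Fin 2) (Fin 2) ℝ} (h : J * g' * Jᵀ = g)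
    (B : Fin 2 → Fin 2 → V) :
    ∑ i, ∑ j, g' i j • ∑ a, ∑ b, (J a i * J b j) • B a b = ∑ a, ∑ b, g a b • B a b := by
  subst h
  simp only [Matrix.mul_apply, Matrix.transpose_apply, Fin.sum_univ_two]
  module

variable {u : ℝ × ℝ → E42} {Ψ : ℝ × ℝ → ℝ × ℝ} {W W' : Set (ℝ × ℝ)}

theorem IsReparam.contDiffOn_jac (hΨ : IsReparam Ψ W' W) (a i : Fin 2) :
    ContDiffOn ℝ ∞ (fun y => jac Ψ y a i) W' := by
  have h := NeutralSurface.contDiffOn_pd i hΨ.smooth hΨ.isOpen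
  fin_cases a
  · exact contDiff_fst.comp_contDiffOn h
  · exact contDiff_snd.comp_contDiffOn h

/-- Chain rule. -/
theorem IsReparam.hasPd_comp {F : Type*} [NormedAddCommGroup F] [NormedSpace ℝ F]
    (hΨ : IsReparam Ψ W' W) (hW : IsOpen W) {v : ℝ × ℝ → F} (hv : ContDiffOn ℝ ∞ v W)
    {y : ℝ × ℝ} (hy : y ∈ W') (i : Fin 2) :
    HasPd i (v ∘ Ψ) (∑ a, jac Ψ y a i • pd a v (Ψ y)) y :=
  NeutralSurface.hasPd_comp i (differentiableAt_of_contDiffOn hv hW (hΨ.mapsTo hy))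
    (differentiableAt_of_contDiffOn hΨ.smooth hΨ.isOpen hy)

theorem metric_comp (hΨ : IsReparam Ψ W' W) (hW : IsOpen W) (hu : ContDiffOn ℝ ∞ u W)
    {y : ℝ × ℝ} (hy : y ∈ W') :
    metric (u ∘ Ψ) y = (jac Ψ y)ᵀ * metric u (Ψ y) * jac Ψ y := by
  ext i j
  simp only [metric_apply, (hΨ.hasPd_comp hW hu hy _).2, Matrix.mul_apply, Matrix.transpose_apply,
    Fin.sum_univ_two, nip_add_left, nip_add_right, nip_smul_left, nip_smul_right]
  ring

theorem det_metric_comp (hΨ : IsReparam Ψ W' W) (hW : IsOpen W) (hu : ContDiffOn ℝ ∞ u W)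
    {y : ℝ × ℝ} (hy : y ∈ W') :
    (metric (u ∘ Ψ) y).det = (jac Ψ y).det ^ 2 * (metric u (Ψ y)).det := by
  rw [metric_comp hΨ hW hu hy, Matrix.det_mul, Matrix.det_mul, Matrix.det_transpose]; ring

theorem IsPatch.comp (hu : IsPatch u W) (hΨ : IsReparam Ψ W' W) : IsPatch (u ∘ Ψ) W' where
  isOpen := hΨ.isOpen
  smooth := hu.smooth.comp hΨ.smooth hΨ.mapsTo
  det_ne y hy := by
    rw [det_metric_comp hΨ hu.isOpen hu.smooth hy]
    exact mul_ne_zero (pow_ne_zero 2 (hΨ.det_ne y hy)) (hu.det_ne _ (hΨ.mapsTo hy))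

theorem metricInv_comp (hu : IsPatch u W) (hΨ : IsReparam Ψ W' W) {y : ℝ × ℝ} (hy : y ∈ W') :
    jac Ψ y * metricInv (u ∘ Ψ) y * (jac Ψ y)ᵀ = metricInv u (Ψ y) := by
  have hJ : IsUnit (jac Ψ y).det := isUnit_iff_ne_zero.2 (hΨ.det_ne y hy)
  have hJ' : IsUnit (jac Ψ y)ᵀ.det := by rwa [Matrix.det_transpose]
  rw [metricInv, metric_comp hΨ hu.isOpen hu.smooth hy, Matrix.mul_inv_rev, Matrix.mul_inv_rev,
    ← mul_assoc, ← mul_assoc, Matrix.mul_nonsing_inv _ hJ, one_mul, mul_assoc,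
    Matrix.nonsing_inv_mul _ hJ', mul_one, metricInv]

namespace IsPatch

variable (hu : IsPatch u W) (hΨ : IsReparam Ψ W' W)
include hu hΨ

theorem tangentPart_comp {y : ℝ × ℝ} (hy : y ∈ W') (v : E42) :
    tangentPart (u ∘ Ψ) y v = tangentPart u (Ψ y) v := by
  have h := sum_contract (metricInv_comp hu hΨ hy)
    (fun a b => nip v (pd a u (Ψ y)) • pd b u (Ψ y))
  simp only [tangentPart, (hΨ.hasPd_comp hu.isOpen hu.smooth hy _).2]
  simp only [Fin.sum_univ_two, nip_add_right, nip_smul_right] at h ⊢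
  refine Eq.trans ?_ (h.trans ?_) <;> module

theorem normalPart_comp {y : ℝ × ℝ} (hy : y ∈ W') (v : E42) :
    normalPart (u ∘ Ψ) y v = normalPart u (Ψ y) v := by
  rw [normalPart, normalPart, tangentPart_comp hu hΨ hy]

theorem secondFund_comp {y : ℝ × ℝ} (hy : y ∈ W') (i j : Fin 2) :
    secondFund (u ∘ Ψ) i j y =
      ∑ a, ∑ b, (jac Ψ y a i * jac Ψ y b j) • secondFund u a b (Ψ y) := by
  have hJ := fun a => hasPd_of_contDiffOn i (hΨ.contDiffOn_jac a j) hΨ.isOpen hy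
  have hp := fun a => hΨ.hasPd_comp hu.isOpen (hu.contDiffOn_pd a) hy i
  have h2 := ((((hJ 0).smul (hp 0)).add ((hJ 1).smul (hp 1))).congr_of_eqOn
    (v := pd j (u ∘ Ψ)) hΨ.isOpen hy fun q hq => by
      simp [(hΨ.hasPd_comp hu.isOpen hu.smooth hq j).2, Fin.sum_univ_two]).2
  have hn := fun k => normalPart_pd (hu.det_ne _ (hΨ.mapsTo hy)) k
  rw [secondFund, normalPart_comp hu hΨ hy, h2]
  simp only [Fin.sum_univ_two, normalPart_add, normalPart_smul, Function.comp_apply, hn, secondFund]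
  module

theorem meanCurv_comp {y : ℝ × ℝ} (hy : y ∈ W') :
    meanCurv (u ∘ Ψ) y = meanCurv u (Ψ y) := by
  simp only [meanCurv, secondFund_comp hu hΨ hy]
  rw [sum_contract (metricInv_comp hu hΨ hy) fun a b => secondFund u a b (Ψ y)]

theorem pd_meanCurv_comp {y : ℝ × ℝ} (hy : y ∈ W') (i : Fin 2) :
    pd i (meanCurv (u ∘ Ψ)) y = ∑ a, jac Ψ y a i • pd a (meanCurv u) (Ψ y) :=
  ((hΨ.hasPd_comp hu.isOpen hu.contDiffOn_meanCurv hy i).congr_of_eqOn hΨ.isOpen hy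
    fun _ hq => meanCurv_comp hu hΨ hq).2

theorem normalDeriv_comp {y : ℝ × ℝ} (hy : y ∈ W') (i : Fin 2) :
    normalDeriv (u ∘ Ψ) i (meanCurv (u ∘ Ψ)) y =
      ∑ a, jac Ψ y a i • normalDeriv u a (meanCurv u) (Ψ y) := by
  simp only [normalDeriv, pd_meanCurv_comp hu hΨ hy, normalPart_comp hu hΨ hy, Fin.sum_univ_two,
    normalPart_add, normalPart_smul]

theorem shapeVanishes_comp {y : ℝ × ℝ} (hy : y ∈ W') :
    ShapeVanishes (u ∘ Ψ) y ↔ ShapeVanishes u (Ψ y) := by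
  rw [ShapeVanishes, ShapeVanishes, ← sum_smul_eq_zero_iff (hΨ.det_ne y hy)
    (fun b => shapeOp u (meanCurv u) b (Ψ y))]
  refine forall_congr' fun i => ?_
  simp only [shapeOp, pd_meanCurv_comp hu hΨ hy, tangentPart_comp hu hΨ hy, Fin.sum_univ_two,
    tangentPart_add, tangentPart_smul, smul_neg]
  rw [neg_add]

theorem traceShapeNabla_comp {y : ℝ × ℝ} (hy : y ∈ W') (l : Fin 2) :
    traceShapeNabla (u ∘ Ψ) y l = ∑ b, jac Ψ y b l • traceShapeNabla u (Ψ y) b := by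
  have h := fun c => sum_contract (metricInv_comp hu hΨ hy)
    (fun a b => nip (normalDeriv u a (meanCurv u) (Ψ y)) (secondFund u b c (Ψ y)))
  have h0 := h 0
  have h1 := h 1
  simp only [traceShapeNabla, normalDeriv_comp hu hΨ hy, secondFund_comp hu hΨ hy]
  simp only [Fin.sum_univ_two, nip_add_left, nip_smul_left, nip_add_right, nip_smul_right,
    smul_eq_mul] at h0 h1 ⊢
  rw [← h0, ← h1]; ring

theorem isProperAt_comp {y : ℝ × ℝ} (hy : y ∈ W') :
    IsProperAt (u ∘ Ψ) y ↔ IsProperAt u (Ψ y) := by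
  have hJ := hΨ.det_ne y hy
  have h2 := sum_smul_eq_zero_iff hJ (fun b => traceShapeNabla u (Ψ y) b)
  have h3 := sum_smul_eq_zero_iff hJ (fun b => normalDeriv u b (meanCurv u) (Ψ y))
  simp only [← traceShapeNabla_comp hu hΨ hy] at h2
  simp only [← normalDeriv_comp hu hΨ hy] at h3
  rw [IsProperAt, IsProperAt, meanCurv_comp hu hΨ hy, h2, ← not_forall_not, ← not_forall_not]
  simp only [ne_eq, not_not, h3]

theorem gaussCurv_comp {y : ℝ × ℝ} (hy : y ∈ W') :
    gaussCurv (u ∘ Ψ) y = gaussCurv u (Ψ y) := by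
  rw [(hu.comp hΨ).gaussCurv_eq hy, hu.gaussCurv_eq (hΨ.mapsTo hy),
    det_metric_comp hΨ hu.isOpen hu.smooth hy]
  have hJ := hΨ.det_ne y hy
  have hd := hu.det_ne _ (hΨ.mapsTo hy)
  rw [div_eq_div_iff (mul_ne_zero (pow_ne_zero 2 hJ) hd) hd]
  simp only [secondFund_comp hu hΨ hy, Fin.sum_univ_two, nip_add_left, nip_add_right,
    nip_smul_left, nip_smul_right, Matrix.det_fin_two (jac Ψ y),
    hu.secondFund_symm (hΨ.mapsTo hy) 1 0]
  rw [nip_comm (secondFund u 1 1 (Ψ y)) (secondFund u 0 0 (Ψ y)),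
    nip_comm (secondFund u 1 1 (Ψ y)) (secondFund u 0 1 (Ψ y)),
    nip_comm (secondFund u 0 1 (Ψ y)) (secondFund u 0 0 (Ψ y))]
  ring

end IsPatch

theorem injective_of_nip_preserving {A : E42 →ₗ[ℝ] E42} (hA : ∀ x y, nip (A x) (A y) = nip x y)
    {x : E42} (h : A x = 0) : x = 0 :=
  eq_zero_of_nip_eq_zero fun y => by rw [← hA, h, nip_zero_left]

section Congruence

variable {A : E42 →ₗ[ℝ] E42} {b : E42} {v : ℝ × ℝ → E42}

/-- A congruence maps patches to patches and preserves the geometric conditions. -/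
theorem isProperAt_congruence (hA : ∀ x y, nip (A x) (A y) = nip x y)
    (hu : IsPatch u W) (hv : ∀ x ∈ W, v x = A (u x) + b) :
    IsPatch v W ∧ ∀ x ∈ W, (IsProperAt v x ↔ IsProperAt u x) := by
  have hlin : ∀ (w : ℝ × ℝ → E42) (x : ℝ × ℝ) (i : Fin 2) (d : E42),
      HasPd i w d x → HasPd i (fun q => A (w q)) (A d) x := fun w x i d h =>
    h.comp_clm (LinearMap.toContinuousLinearMap A)
  have h1 : ∀ i, EqOn (pd i v) (fun q => A (pd i u q)) W := fun i x hx => by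
    have := ((hlin u x i _ (hu.hasPd hx i)).add (hasPd_const i b x)).congr_of_eqOn hu.isOpen hx
      fun q hq => hv q hq
    rw [this.2, add_zero]
  have h2 : ∀ i j, ∀ x ∈ W, pd i (pd j v) x = A (pd i (pd j u) x) := fun i j x hx =>
    ((hlin _ x i _ (hu.hasPd_pd hx i j)).congr_of_eqOn hu.isOpen hx (h1 j)).2
  have hm : ∀ x ∈ W, metric v x = metric u x := fun x hx => by
    ext i j; simp only [metric_apply, h1 _ hx, hA]
  have hmi : ∀ x ∈ W, metricInv v x = metricInv u x := fun x hx => by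
    rw [metricInv, metricInv, hm x hx]
  have hn : ∀ x ∈ W, ∀ w, normalPart v x (A w) = A (normalPart u x w) := fun x hx w => by
    simp [normalPart, tangentPart, hmi x hx, h1 _ hx, hA, Fin.sum_univ_two]
  have hh : ∀ i j, ∀ x ∈ W, secondFund v i j x = A (secondFund u i j x) := fun i j x hx => by
    rw [secondFund, h2 i j x hx, hn x hx, secondFund]
  have hH : EqOn (meanCurv v) (fun q => A (meanCurv u q)) W := fun x hx => by
    simp [meanCurv, hh _ _ x hx, hmi x hx, Fin.sum_univ_two]
  have hD : ∀ i, ∀ x ∈ W, normalDeriv v i (meanCurv v) x = A (normalDeriv u i (meanCurv u) x) :=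
    fun i x hx => by
      have := ((hlin _ x i _ (hu.hasPd_meanCurv hx i)).congr_of_eqOn hu.isOpen hx hH).2
      rw [normalDeriv, this, hn x hx, normalDeriv]
  have h0 : ∀ w, A w = 0 ↔ w = 0 :=
    fun w => ⟨injective_of_nip_preserving hA, fun h => by rw [h, map_zero]⟩
  refine ⟨⟨hu.isOpen, ?_, fun x hx => by rw [hm x hx]; exact hu.det_ne x hx⟩, fun x hx => ?_⟩
  · refine ContDiffOn.congr ?_ hv
    exact ((LinearMap.toContinuousLinearMap A).contDiff.comp_contDiffOn hu.smooth).add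
      contDiffOn_const
  · simp only [IsProperAt, IsLightlike, traceShapeNabla, hH hx, hD _ x hx, hh _ _ x hx, hA,
      hmi x hx, ne_eq, h0]

end Congruence

end Invariance

/-! ### Charts of the surface -/

section Locality

variable {u v : ℝ × ℝ → E42} {W : Set (ℝ × ℝ)}

theorem metric_congr (hW : IsOpen W) (h : EqOn u v W) : EqOn (metric u) (metric v) W :=
  fun x hx => by ext i j; simp only [metric_apply, pd_congr_of_eqOn _ hW h hx]

theorem metricInv_congr (hW : IsOpen W) (h : EqOn u v W) : EqOn (metricInv u) (metricInv v) W :=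
  fun x hx => by rw [metricInv, metricInv, metric_congr hW h hx]

theorem tangentPart_congr (hW : IsOpen W) (h : EqOn u v W) :
    EqOn (tangentPart u) (tangentPart v) W := fun x hx => by
  ext1 w; simp only [tangentPart, metricInv_congr hW h hx, pd_congr_of_eqOn _ hW h hx]

theorem normalPart_congr (hW : IsOpen W) (h : EqOn u v W) :
    EqOn (normalPart u) (normalPart v) W := fun x hx => by
  ext1 w; simp only [normalPart, tangentPart_congr hW h hx]

theorem secondFund_congr (hW : IsOpen W) (h : EqOn u v W) (i j : Fin 2) :
    EqOn (secondFund u i j) (secondFund v i j) W := fun x hx => by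
  rw [secondFund, secondFund, normalPart_congr hW h hx,
    pd_congr_of_eqOn i hW (pd_congr_of_eqOn j hW h) hx]

theorem meanCurv_congr (hW : IsOpen W) (h : EqOn u v W) : EqOn (meanCurv u) (meanCurv v) W :=
  fun x hx => by simp only [meanCurv, metricInv_congr hW h hx, secondFund_congr hW h _ _ hx]

theorem christoffel_congr (hW : IsOpen W) (h : EqOn u v W) (k i j : Fin 2) :
    EqOn (christoffel u k i j) (christoffel v k i j) W := fun x hx => by
  have hm : ∀ a b c, pd c (fun q => metric u q a b) x = pd c (fun q => metric v q a b) x :=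
    fun a b c => pd_congr_of_eqOn c hW (fun q hq => by simp only [metric_congr hW h hq]) hx
  simp only [christoffel, metricInv_congr hW h hx, hm]

theorem gaussCurv_congr (hW : IsOpen W) (h : EqOn u v W) :
    EqOn (gaussCurv u) (gaussCurv v) W := fun x hx => by
  simp only [gaussCurv, metric_congr hW h hx, christoffel_congr hW h _ _ _ hx,
    pd_congr_of_eqOn _ hW (christoffel_congr hW h _ _ _) hx]

theorem shapeVanishes_congr (hW : IsOpen W) (h : EqOn u v W) {x : ℝ × ℝ} (hx : x ∈ W) :
    ShapeVanishes u x ↔ ShapeVanishes v x := by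
  simp only [ShapeVanishes, shapeOp, tangentPart_congr hW h hx,
    pd_congr_of_eqOn _ hW (meanCurv_congr hW h) hx]

theorem isProperAt_congr (hW : IsOpen W) (h : EqOn u v W) {x : ℝ × ℝ} (hx : x ∈ W) :
    IsProperAt u x ↔ IsProperAt v x := by
  simp only [IsProperAt, traceShapeNabla, normalDeriv, meanCurv_congr hW h hx,
    normalPart_congr hW h hx, metricInv_congr hW h hx, secondFund_congr hW h _ _ hx,
    pd_congr_of_eqOn _ hW (meanCurv_congr hW h) hx]

end Locality

section Charts

variable {M : Type*} [TopologicalSpace M] [ChartedSpace (ℝ × ℝ) M]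

theorem mem_contDiffGroupoid_iff {h : OpenPartialHomeomorph (ℝ × ℝ) (ℝ × ℝ)} :
    h ∈ contDiffGroupoid ∞ 𝓘(ℝ, ℝ × ℝ) ↔
      ContDiffOn ℝ ∞ h h.source ∧ ContDiffOn ℝ ∞ h.symm h.target := by
  rw [contDiffGroupoid, mem_groupoid_of_pregroupoid]
  simp [contDiffPregroupoid]

/-- A map with a differentiable left inverse has invertible differential. -/
theorem det_jac_ne_zero {Ψ Ψ' : ℝ × ℝ → ℝ × ℝ} {y : ℝ × ℝ} {W : Set (ℝ × ℝ)} (hW : IsOpen W)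
    (hy : y ∈ W) (hΨ : DifferentiableAt ℝ Ψ y) (hΨ' : DifferentiableAt ℝ Ψ' (Ψ y))
    (h : EqOn (Ψ' ∘ Ψ) id W) : (jac Ψ y).det ≠ 0 := by
  have hmul : jac Ψ' (Ψ y) * jac Ψ y = 1 := by
    have hc : ∀ i, ∑ a, jac Ψ y a i • pd a Ψ' (Ψ y) = dir i := fun i =>
      (hasPd_comp i hΨ' hΨ).eq_of_eqOn ((hasPd_of_hasFDerivAt (hasFDerivAt_id y) i).congr_deriv
        (by simp)) hW hy h
    ext a i
    have := hc i
    simp only [Fin.sum_univ_two] at this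
    rw [Matrix.mul_apply, Fin.sum_univ_two]
    fin_cases a
    · have := congrArg Prod.fst this
      fin_cases i <;> simp [jac, dir] at this ⊢ <;> linarith
    · have := congrArg Prod.snd this
      fin_cases i <;> simp [jac, dir] at this ⊢ <;> linarith
  intro h0
  have := congrArg Matrix.det hmul
  rw [Matrix.det_mul, h0] at this
  simp at this

theorem isReparam_transition {φ φ' : OpenPartialHomeomorph M (ℝ × ℝ)}
    (hφ : φ ∈ IsManifold.maximalAtlas 𝓘(ℝ, ℝ × ℝ) ∞ M)
    (hφ' : φ' ∈ IsManifold.maximalAtlas 𝓘(ℝ, ℝ × ℝ) ∞ M) :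
    IsReparam (φ ∘ φ'.symm) (φ'.symm.trans φ).source φ.target := by
  have h := (mem_contDiffGroupoid_iff.1
    ((contDiffGroupoid ∞ 𝓘(ℝ, ℝ × ℝ)).compatible_of_mem_maximalAtlas hφ' hφ))
  refine ⟨(φ'.symm.trans φ).open_source, h.1, fun y hy => ?_, fun y hy => ?_⟩
  · exact φ.map_source (by simpa using hy.2)
  · refine det_jac_ne_zero (Ψ' := φ' ∘ φ.symm) (φ'.symm.trans φ).open_source hy
      (differentiableAt_of_contDiffOn h.1 (φ'.symm.trans φ).open_source hy)
      (differentiableAt_of_contDiffOn h.2 (φ'.symm.trans φ).open_target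
        ((φ'.symm.trans φ).map_source hy)) fun z hz => ?_
    have := (φ'.symm.trans φ).left_inv hz
    simpa using this

variable {f : M → E42}

theorem contDiffOn_comp_symm (hf : ContMDiff 𝓘(ℝ, ℝ × ℝ) 𝓘(ℝ, E42) ∞ f)
    {φ : OpenPartialHomeomorph M (ℝ × ℝ)}
    (hφ : φ ∈ IsManifold.maximalAtlas 𝓘(ℝ, ℝ × ℝ) ∞ M) :
    ContDiffOn ℝ ∞ (f ∘ φ.symm) φ.target :=
  contMDiffOn_iff_contDiffOn.1 (hf.comp_contMDiffOn (contMDiffOn_symm_of_mem_maximalAtlas hφ))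

/-- The preferred parametrization factors through any other one by the transition map. -/
theorem rep_eqOn {φ : OpenPartialHomeomorph M (ℝ × ℝ)} (p : M) :
    EqOn (rep f p) ((f ∘ φ.symm) ∘ (φ ∘ (chartAt (ℝ × ℝ) p).symm))
      ((chartAt (ℝ × ℝ) p).symm.trans φ).source := fun y hy => by
  have : (chartAt (ℝ × ℝ) p).symm y ∈ φ.source := by simpa using hy.2
  simp [rep, φ.left_inv this]

theorem coord_mem {φ : OpenPartialHomeomorph M (ℝ × ℝ)} {p : M} (hp : p ∈ φ.source) :
    coord p ∈ ((chartAt (ℝ × ℝ) p).symm.trans φ).source := by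
  simp [coord, hp]

theorem transition_coord {φ : OpenPartialHomeomorph M (ℝ × ℝ)} (p : M) :
    (φ ∘ (chartAt (ℝ × ℝ) p).symm) (coord p) = φ p := by
  simp [coord]

theorem coord_mem_target (p : M) : coord p ∈ (chartAt (ℝ × ℝ) p).target :=
  (chartAt (ℝ × ℝ) p).map_source (mem_chart_source _ p)

/-- New coordinates from functions with independent differentials (inverse function theorem); the
coordinate domain may be taken to be a box, inside any prescribed neighbourhood. Here `O` is the new
coordinate domain expressed in the old coordinates, and `Φ` is the coordinate change on it. -/
theorem exists_chart {φ : OpenPartialHomeomorph M (ℝ × ℝ)}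
    (hφ : φ ∈ IsManifold.maximalAtlas 𝓘(ℝ, ℝ × ℝ) ∞ M) {p : M} (hp : p ∈ φ.source)
    {Φ : ℝ × ℝ → ℝ × ℝ} {W : Set (ℝ × ℝ)} (hW : IsOpen W) (hWφ : W ⊆ φ.target) (hpW : φ p ∈ W)
    (hΦ : ContDiffOn ℝ ∞ Φ W) (hdet : (jac Φ (φ p)).det ≠ 0) :
    ∃ φ' ∈ IsManifold.maximalAtlas 𝓘(ℝ, ℝ × ℝ) ∞ M, p ∈ φ'.source ∧ φ' p = Φ (φ p) ∧
      (∃ I J : Set ℝ, IsOpenInterval I ∧ IsOpenInterval J ∧ φ'.target = I ×ˢ J) ∧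
      ∃ O ⊆ W, IsReparam Φ O φ'.target ∧ (∀ y ∈ φ'.target, ∃ x ∈ O, Φ x = y) ∧
        ∀ x ∈ O, φ'.symm (Φ x) = φ.symm x := by
  set x₀ := φ p with hx₀
  have hc : ContDiffAt ℝ ∞ Φ x₀ := hΦ.contDiffAt (hW.mem_nhds hpW)
  have inj : ∀ x, (jac Φ x).det ≠ 0 → ∀ w, fderiv ℝ Φ x w = 0 → w = 0 := by
    intro x hx w hw
    rw [fderiv_eq_pd] at hw
    rw [← Matrix.det_transpose] at hx
    have := (sum_smul_eq_zero_iff hx (![w.1, w.2])).1 (fun l => by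
      fin_cases l
      · simpa [jac, Fin.sum_univ_two, mul_comm] using congrArg Prod.fst hw
      · simpa [jac, Fin.sum_univ_two, mul_comm] using congrArg Prod.snd hw)
    ext
    · exact this 0
    · exact this 1
  have equiv : ∀ x, (jac Φ x).det ≠ 0 →
      ∃ L : (ℝ × ℝ) ≃L[ℝ] (ℝ × ℝ), (L : ℝ × ℝ →L[ℝ] ℝ × ℝ) = fderiv ℝ Φ x := by
    intro x hx
    have hi : Function.Injective (fderiv ℝ Φ x : ℝ × ℝ →ₗ[ℝ] ℝ × ℝ) :=
      (injective_iff_map_eq_zero _).2 (inj x hx)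
    refine ⟨(LinearEquiv.ofInjectiveEndo _ hi).toContinuousLinearEquiv, ?_⟩
    exact ContinuousLinearMap.ext fun w => rfl
  have hdetc : ContinuousOn (fun x => (jac Φ x).det) W := by
    have h0 := (contDiffOn_pd 0 hΦ hW).continuousOn
    have h1 := (contDiffOn_pd 1 hΦ hW).continuousOn
    simp only [Matrix.det_fin_two, jac, Matrix.of_apply, Matrix.cons_val_zero, Matrix.cons_val_one]
    fun_prop
  -- on `W₁` the inverse of `Φ` is smooth at every point, not only at the image of `x₀`
  set W₁ := W ∩ (fun x => (jac Φ x).det) ⁻¹' {0}ᶜ with hW₁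
  have hW₁o : IsOpen W₁ := hdetc.isOpen_inter_preimage hW isOpen_compl_singleton
  obtain ⟨L, hL⟩ := equiv x₀ hdet
  have hfd : HasFDerivAt Φ (L : ℝ × ℝ →L[ℝ] ℝ × ℝ) x₀ := by
    rw [hL]; exact (hc.differentiableAt (by simp)).hasFDerivAt
  set h₀ := hc.toOpenPartialHomeomorph Φ hfd (by simp) with hh₀
  have hx₀s : x₀ ∈ h₀.source := hc.mem_toOpenPartialHomeomorph_source hfd (by simp)
  set h₁ := h₀.restrOpen W₁ hW₁o with hh₁
  have hx₁s : x₀ ∈ h₁.source := ⟨hx₀s, hpW, hdet⟩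
  have h₁coe : ∀ x, h₁ x = Φ x := fun x => rfl
  obtain ⟨⟨A, B⟩, ⟨hA, hB⟩, hAB⟩ : ∃ AB : Set ℝ × Set ℝ,
      ((IsOpenInterval AB.1 ∧ (Φ x₀).1 ∈ AB.1) ∧ (IsOpenInterval AB.2 ∧ (Φ x₀).2 ∈ AB.2)) ∧
        AB.1 ×ˢ AB.2 ⊆ h₁.target := by
    have hn : h₁.target ∈ 𝓝 (Φ x₀) := h₁.open_target.mem_nhds (h₁.map_source hx₁s)
    obtain ⟨ε, hε, hb⟩ := Metric.mem_nhds_iff.1 hn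
    refine ⟨(Metric.ball (Φ x₀).1 ε, Metric.ball (Φ x₀).2 ε), ⟨⟨⟨Metric.isOpen_ball, ?_⟩, ?_⟩,
      ⟨Metric.isOpen_ball, ?_⟩, ?_⟩, ?_⟩
    · exact (convex_ball _ _).ordConnected
    · exact Metric.mem_ball_self hε
    · exact (convex_ball _ _).ordConnected
    · exact Metric.mem_ball_self hε
    · rwa [ball_prod_same]
  have hABo : IsOpen (A ×ˢ B) := hA.1.1.prod hB.1.1
  set h := (h₁.symm.restrOpen (A ×ˢ B) hABo).symm with hh
  have hcoe : ∀ x, h x = Φ x := fun x => rfl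
  have htarget : h.target = A ×ˢ B := by
    show h₁.target ∩ A ×ˢ B = _
    exact inter_eq_right.2 hAB
  have hsource : h.source ⊆ W₁ := by
    intro x hx
    have h2 := h.map_source hx
    have h3 : h.symm (h x) ∈ h₁.source := h₁.map_target (hAB (htarget ▸ h2))
    rw [h.left_inv hx] at h3
    exact h3.2
  have hx₀h : x₀ ∈ h.source := by
    have h2 : Φ x₀ ∈ h.target := by rw [htarget]; exact ⟨hA.2, hB.2⟩
    have h3 := h.map_target h2
    have h4 : h.symm (Φ x₀) = x₀ := h₁.left_inv hx₁s
    rwa [h4] at h3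
  have hmem : h ∈ contDiffGroupoid ∞ 𝓘(ℝ, ℝ × ℝ) := by
    rw [mem_contDiffGroupoid_iff]
    refine ⟨(hΦ.mono fun x hx => (hsource hx).1).congr fun x _ => hcoe x, fun y hy => ?_⟩
    have hs := hsource (h.map_target hy)
    obtain ⟨L', hL'⟩ := equiv _ hs.2
    have hcd := hΦ.contDiffAt (hW.mem_nhds hs.1)
    refine (h.contDiffAt_symm (f₀' := L') hy ?_ ?_).contDiffWithinAt
    · rw [hL']; exact (hcd.differentiableAt (by simp)).hasFDerivAt
    · exact hcd
  have hφ'm : φ.trans h ∈ IsManifold.maximalAtlas 𝓘(ℝ, ℝ × ℝ) ∞ M := by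
    intro e he
    obtain ⟨h1, h2⟩ := hφ e he
    refine ⟨?_, ?_⟩
    · rw [OpenPartialHomeomorph.trans_symm_eq_symm_trans_symm, OpenPartialHomeomorph.trans_assoc]
      exact (contDiffGroupoid ∞ 𝓘(ℝ, ℝ × ℝ)).trans
        ((contDiffGroupoid ∞ 𝓘(ℝ, ℝ × ℝ)).symm hmem) h1
    · rw [← OpenPartialHomeomorph.trans_assoc]
      exact (contDiffGroupoid ∞ 𝓘(ℝ, ℝ × ℝ)).trans h2 hmem
  have htarget' : (φ.trans h).target = A ×ˢ B := by
    rw [OpenPartialHomeomorph.trans_target, htarget]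
    exact inter_eq_left.2 fun y hy => hWφ (hsource (h.map_target (htarget ▸ hy))).1
  refine ⟨φ.trans h, hφ'm, ⟨hp, hx₀h⟩, rfl, ⟨A, B, hA.1, hB.1, htarget'⟩, h.source,
    fun x hx => (hsource hx).1, ⟨h.open_source, hΦ.mono fun x hx => (hsource hx).1, fun x hx => ?_,
      fun x hx => (hsource hx).2⟩, fun y hy => ?_, fun x hx => ?_⟩
  · rw [htarget', ← htarget]; exact h.map_source hx
  · rw [htarget', ← htarget] at hy
    exact ⟨h.symm y, h.map_target hy, h.right_inv hy⟩
  · show φ.symm (h.symm (h x)) = _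
    rw [h.left_inv hx]

variable [IsManifold 𝓘(ℝ, ℝ × ℝ) ∞ M]

/-- In any chart of the maximal atlas the surface is a patch, although non-degeneracy of the metric
is only assumed in the preferred charts. -/
theorem isPatch_of_isSurface (hf : IsSurface f) {φ : OpenPartialHomeomorph M (ℝ × ℝ)}
    (hφ : φ ∈ IsManifold.maximalAtlas 𝓘(ℝ, ℝ × ℝ) ∞ M) : IsPatch (f ∘ φ.symm) φ.target := by
  refine ⟨φ.open_target, contDiffOn_comp_symm hf.1 hφ, fun x hx => ?_⟩
  obtain ⟨p, hp, rfl⟩ : ∃ p ∈ φ.source, φ p = x := ⟨φ.symm x, φ.map_target hx, φ.right_inv hx⟩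
  have h := hf.2 p
  have hr := isReparam_transition hφ
    (IsManifold.chart_mem_maximalAtlas (I := 𝓘(ℝ, ℝ × ℝ)) (n := ∞) p)
  rw [metric_congr hr.isOpen (rep_eqOn (φ := φ) p) (coord_mem hp),
    det_metric_comp hr φ.open_target (contDiffOn_comp_symm hf.1 hφ) (coord_mem hp),
    transition_coord] at h
  exact right_ne_zero_of_mul h

section Transfer

variable (hf : IsSurface f) {φ : OpenPartialHomeomorph M (ℝ × ℝ)}
  (hφ : φ ∈ IsManifold.maximalAtlas 𝓘(ℝ, ℝ × ℝ) ∞ M) {p : M} (hp : p ∈ φ.source)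
include hf hφ hp

theorem meanCurv_rep :
    meanCurv (rep f p) (coord p) = meanCurv (f ∘ φ.symm) (φ p) := by
  have hr := isReparam_transition hφ
    (IsManifold.chart_mem_maximalAtlas (I := 𝓘(ℝ, ℝ × ℝ)) (n := ∞) p)
  rw [meanCurv_congr hr.isOpen (rep_eqOn (φ := φ) p) (coord_mem hp),
    (isPatch_of_isSurface hf hφ).meanCurv_comp hr (coord_mem hp), transition_coord]

theorem isProperAt_rep :
    IsProperAt (rep f p) (coord p) ↔ IsProperAt (f ∘ φ.symm) (φ p) := by
  have hr := isReparam_transition hφ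
    (IsManifold.chart_mem_maximalAtlas (I := 𝓘(ℝ, ℝ × ℝ)) (n := ∞) p)
  rw [isProperAt_congr hr.isOpen (rep_eqOn (φ := φ) p) (coord_mem hp),
    (isPatch_of_isSurface hf hφ).isProperAt_comp hr (coord_mem hp), transition_coord]

theorem curvAt_eq : curvAt f p = gaussCurv (f ∘ φ.symm) (φ p) := by
  have hr := isReparam_transition hφ
    (IsManifold.chart_mem_maximalAtlas (I := 𝓘(ℝ, ℝ × ℝ)) (n := ∞) p)
  rw [curvAt, gaussCurv_congr hr.isOpen (rep_eqOn (φ := φ) p) (coord_mem hp),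
    (isPatch_of_isSurface hf hφ).gaussCurv_comp hr (coord_mem hp), transition_coord]

theorem shapeHVanishesAt_iff :
    ShapeHVanishesAt f p ↔ ShapeVanishes (f ∘ φ.symm) (φ p) := by
  have hr := isReparam_transition hφ
    (IsManifold.chart_mem_maximalAtlas (I := 𝓘(ℝ, ℝ × ℝ)) (n := ∞) p)
  rw [← transition_coord (φ := φ) p,
    ← (isPatch_of_isSurface hf hφ).shapeVanishes_comp hr (coord_mem hp),
    ← shapeVanishes_congr hr.isOpen (rep_eqOn (φ := φ) p) (coord_mem hp)]
  rfl

end Transfer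

/-- The pointwise conditions, assumed in the preferred charts, hold in every chart. -/
theorem isProperAt_of_mem_atlas (hf : IsSurface f) (h : ∀ p, IsProperAt (rep f p) (coord p))
    {φ : OpenPartialHomeomorph M (ℝ × ℝ)}
    (hφ : φ ∈ IsManifold.maximalAtlas 𝓘(ℝ, ℝ × ℝ) ∞ M) :
    ∀ x ∈ φ.target, IsProperAt (f ∘ φ.symm) x := fun x hx => by
  have := (isProperAt_rep hf hφ (φ.map_target hx)).1 (h _)
  rwa [φ.right_inv hx] at this

/-- The two global conditions amount to the pointwise condition `IsProperAt`. -/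
theorem quasiMinimal_and_proper_iff (hf : IsSurface f) :
    IsQuasiMinimal f ∧ IsProperBiconservative f ↔ ∀ p, IsProperAt (rep f p) (coord p) := by
  have key : IsQuasiMinimal f → ∀ p l,
      nip (bitension (rep f p) (coord p)) (pd l (rep f p) (coord p)) =
        4 * traceShapeNabla (rep f p) (coord p) l := by
    intro hq p l
    have hφ := IsManifold.chart_mem_maximalAtlas (I := 𝓘(ℝ, ℝ × ℝ)) (n := ∞) p
    refine (isPatch_of_isSurface hf hφ).nip_bitension (fun x hx => ?_) (coord_mem_target p) l
    have := (hq ((chartAt (ℝ × ℝ) p).symm x)).2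
    rwa [meanCurv_rep hf hφ ((chartAt (ℝ × ℝ) p).map_target hx),
      (chartAt (ℝ × ℝ) p).right_inv hx] at this
  constructor
  · rintro ⟨hq, hb, hn⟩ p
    refine ⟨hq p, fun l => ?_, hn p⟩
    have := hb p l
    rw [key hq] at this
    linarith
  · intro h
    have hq : IsQuasiMinimal f := fun p => (h p).1
    exact ⟨hq, fun p l => by rw [key hq, (h p).2.1, mul_zero], fun p => (h p).2.2⟩

end Charts

/-! ### Regular points -/

section Regular

variable {M : Type*} [TopologicalSpace M] [ChartedSpace (ℝ × ℝ) M]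

/-- An open set on which no point satisfies the first two conditions of regularity lies in the
locus `A_H = 0`. -/
theorem dense_regular (f : M → E42) : Dense {p | IsRegularPoint f p} := by
  rw [dense_iff_inter_open]
  rintro U hU ⟨p, hp⟩
  by_cases h1 : ∃ q ∈ U, curvAt f q ≠ 0
  · obtain ⟨q, hq, h⟩ := h1
    exact ⟨q, hq, Or.inl h⟩
  push Not at h1
  by_cases h2 : ∃ q ∈ U, ¬ ShapeHVanishesAt f q
  · obtain ⟨q, hq, h⟩ := h2
    exact ⟨q, hq, Or.inr (Or.inl ⟨eventually_of_mem (hU.mem_nhds hq) h1, h⟩)⟩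
  push Not at h2
  exact ⟨p, hp, Or.inr (Or.inr (eventually_of_mem (hU.mem_nhds hp) h2))⟩

variable [IsManifold 𝓘(ℝ, ℝ × ℝ) ∞ M] {f : M → E42}

theorem exists_mem_maximalAtlas (p : M) :
    ∃ φ ∈ IsManifold.maximalAtlas 𝓘(ℝ, ℝ × ℝ) ∞ M, p ∈ φ.source :=
  ⟨_, IsManifold.chart_mem_maximalAtlas p, mem_chart_source _ p⟩

theorem isOpen_curvAt_ne_zero (hf : IsSurface f) : IsOpen {p | curvAt f p ≠ 0} := by
  rw [isOpen_iff_mem_nhds]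
  intro p hp
  obtain ⟨φ, hφ, hps⟩ := exists_mem_maximalAtlas p
  have ho := (isPatch_of_isSurface hf hφ).contDiffOn_gaussCurv.continuousOn.isOpen_inter_preimage
    φ.open_target isOpen_compl_singleton (t := {(0 : ℝ)}ᶜ)
  refine mem_of_superset ((φ.isOpen_inter_preimage ho).mem_nhds ⟨hps, φ.map_source hps, ?_⟩) ?_
  · simpa [← curvAt_eq hf hφ hps] using hp
  · rintro q ⟨hq, -, hq'⟩
    simpa [curvAt_eq hf hφ hq] using hq'

theorem isOpen_not_shapeHVanishesAt (hf : IsSurface f) :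
    IsOpen {p | ¬ ShapeHVanishesAt f p} := by
  rw [isOpen_iff_mem_nhds]
  intro p hp
  obtain ⟨φ, hφ, hps⟩ := exists_mem_maximalAtlas p
  have hp : ¬ ShapeVanishes (f ∘ φ.symm) (φ p) := by
    rwa [mem_ofPred, shapeHVanishesAt_iff hf hφ hps] at hp
  rw [ShapeVanishes, not_forall] at hp
  obtain ⟨i, hi⟩ := hp
  have ho := ((isPatch_of_isSurface hf hφ).contDiffOn_shapeOp i).continuousOn.isOpen_inter_preimage
    φ.open_target isOpen_compl_singleton (t := {(0 : E42)}ᶜ)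
  refine mem_of_superset ((φ.isOpen_inter_preimage ho).mem_nhds ⟨hps, φ.map_source hps, hi⟩) ?_
  rintro q ⟨hq, -, hq'⟩
  rw [mem_ofPred, shapeHVanishesAt_iff hf hφ hq]
  exact fun h => hq' (h i)

theorem isOpen_regular (hf : IsSurface f) : IsOpen {p | IsRegularPoint f p} := by
  rw [isOpen_iff_mem_nhds]
  rintro p (h | ⟨h, h'⟩ | h)
  · filter_upwards [(isOpen_curvAt_ne_zero hf).mem_nhds h] with q hq using Or.inl hq
  · filter_upwards [h.eventually_nhds, (isOpen_not_shapeHVanishesAt hf).mem_nhds h'] with q hq hq'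
      using Or.inr (Or.inl ⟨hq, hq'⟩)
  · filter_upwards [h.eventually_nhds] with q hq using Or.inr (Or.inr hq)

end Regular

/-! ### Semi-null coordinates -/

section SemiNull

/-- Coordinates in which the metric is `-(ds dt + dt ds) + 2 m dt dt`; their first coordinate lines
are null. -/
structure IsSemiNull (m : ℝ × ℝ → ℝ) (u : ℝ × ℝ → E42) (W : Set (ℝ × ℝ)) : Prop where
  isOpen : IsOpen W
  smooth : ContDiffOn ℝ ∞ u W
  m00 : ∀ x ∈ W, nip (pd 0 u x) (pd 0 u x) = 0
  m01 : ∀ x ∈ W, nip (pd 0 u x) (pd 1 u x) = -1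
  m11 : ∀ x ∈ W, nip (pd 1 u x) (pd 1 u x) = 2 * m x

variable {m : ℝ × ℝ → ℝ} {u : ℝ × ℝ → E42} {W : Set (ℝ × ℝ)}

/-- As `⟨H, H⟩ = 0` the normal field `∇^⊥ H` is orthogonal to `H`, and the normal plane is
non-degenerate. -/
theorem IsPatch.exists_normalDeriv_eq_smul (hu : IsPatch u W)
    (hH : ∀ x ∈ W, nip (meanCurv u x) (meanCurv u x) = 0) {x : ℝ × ℝ} (hx : x ∈ W)
    (h0 : meanCurv u x ≠ 0) (i : Fin 2) :
    ∃ c : ℝ, normalDeriv u i (meanCurv u) x = c • meanCurv u x := by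
  have hd := hu.det_ne x hx
  rw [metric_det] at hd
  refine exists_smul_of_orthogonal_null hd h0 (hH x hx) (hu.nip_meanCurv hx 0)
    (hu.nip_meanCurv hx 1) (nip_normalPart (hu.det_ne x hx) _ 0)
    (nip_normalPart (hu.det_ne x hx) _ 1) ?_
  rw [normalDeriv, nip_comm, nip_normal_normalPart (hu.nip_meanCurv hx)]
  have hn := ((hu.hasPd_meanCurv hx i).nip (hu.hasPd_meanCurv hx i)).eq_of_eqOn
    (hasPd_const i 0 x) hu.isOpen hx fun y hy => hH y hy
  rw [nip_comm (pd i _ x)] at hn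
  linarith

namespace IsSemiNull

variable (h : IsSemiNull m u W)
include h

theorem det_eq {x : ℝ × ℝ} (hx : x ∈ W) : (metric u x).det = -1 := by
  rw [metric_det, h.m00 x hx, h.m01 x hx]; ring

theorem isPatch : IsPatch u W :=
  ⟨h.isOpen, h.smooth, fun x hx => by rw [h.det_eq hx]; norm_num⟩

theorem contDiffOn_m : ContDiffOn ℝ ∞ m W :=
  (contDiffOn_const.mul (contDiffOn_nip (h.isPatch.contDiffOn_pd 1)
    (h.isPatch.contDiffOn_pd 1)) : ContDiffOn ℝ ∞ (fun x => (1 / 2 : ℝ) * nip _ _) W).congr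
    fun x hx => by rw [h.m11 x hx]; ring

theorem metricInv_eq {x : ℝ × ℝ} (hx : x ∈ W) :
    metricInv u x = !![-2 * m x, -1; -1, 0] := by
  refine Matrix.inv_eq_left_inv ?_
  have : metric u x = !![0, -1; -1, 2 * m x] := by
    ext i j
    fin_cases i <;> fin_cases j <;>
      simp [metric_apply, h.m00 x hx, h.m01 x hx, h.m11 x hx, nip_comm (pd 1 u x) (pd 0 u x)]
  rw [this]
  ext i j
  fin_cases i <;> fin_cases j <;> simp [Matrix.mul_apply, Fin.sum_univ_two]

theorem tangentPart_eq {x : ℝ × ℝ} (hx : x ∈ W) (w : E42) :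
    tangentPart u x w = (-2 * m x * nip w (pd 0 u x) - nip w (pd 1 u x)) • pd 0 u x -
      nip w (pd 0 u x) • pd 1 u x := by
  simp only [tangentPart, h.metricInv_eq hx, Fin.sum_univ_two, Matrix.of_apply, Matrix.cons_val',
    Matrix.cons_val_zero, Matrix.cons_val_one, Matrix.cons_val_fin_one]
  module

theorem nip_pd00 {x : ℝ × ℝ} (hx : x ∈ W) : nip (pd 0 (pd 0 u) x) (pd 0 u x) = 0 := by
  have := ((h.isPatch.hasPd_pd hx 0 0).nip (h.isPatch.hasPd_pd hx 0 0)).eq_of_eqOn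
    (hasPd_const 0 0 x) h.isOpen hx h.m00
  rw [nip_comm (pd 0 u x)] at this
  linarith

theorem nip_pd01 {x : ℝ × ℝ} (hx : x ∈ W) : nip (pd 0 (pd 1 u) x) (pd 0 u x) = 0 := by
  have := ((h.isPatch.hasPd_pd hx 1 0).nip (h.isPatch.hasPd_pd hx 1 0)).eq_of_eqOn
    (hasPd_const 1 0 x) h.isOpen hx h.m00
  rw [nip_comm (pd 0 u x)] at this
  rw [h.isPatch.pd_pd_comm hx]
  linarith

theorem nip_pd00' {x : ℝ × ℝ} (hx : x ∈ W) : nip (pd 0 (pd 0 u) x) (pd 1 u x) = 0 := by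
  have := ((h.isPatch.hasPd_pd hx 0 0).nip (h.isPatch.hasPd_pd hx 0 1)).eq_of_eqOn
    (hasPd_const 0 (-1) x) h.isOpen hx h.m01
  rw [nip_comm (pd 0 u x), h.nip_pd01 hx] at this
  linarith

theorem nip_pd01' {x : ℝ × ℝ} (hx : x ∈ W) : nip (pd 0 (pd 1 u) x) (pd 1 u x) = pd 0 m x := by
  have := ((h.isPatch.hasPd_pd hx 0 1).nip (h.isPatch.hasPd_pd hx 0 1)).eq_of_eqOn
    ((hasPd_of_contDiffOn 0 h.contDiffOn_m h.isOpen hx).const_mul 2) h.isOpen hx h.m11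
  rw [nip_comm (pd 1 u x)] at this
  linarith

theorem secondFund_00 {x : ℝ × ℝ} (hx : x ∈ W) : secondFund u 0 0 x = pd 0 (pd 0 u) x :=
  normalPart_eq_self (Fin.forall_fin_two.2 ⟨h.nip_pd00 hx, h.nip_pd00' hx⟩)

theorem secondFund_01 {x : ℝ × ℝ} (hx : x ∈ W) :
    secondFund u 0 1 x = pd 0 (pd 1 u) x + pd 0 m x • pd 0 u x := by
  rw [secondFund, normalPart, h.tangentPart_eq hx, h.nip_pd01 hx, h.nip_pd01' hx]; module

theorem meanCurv_eq {x : ℝ × ℝ} (hx : x ∈ W) : meanCurv u x = -vecN m u x := by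
  simp only [meanCurv, h.metricInv_eq hx, Fin.sum_univ_two, Matrix.of_apply, Matrix.cons_val',
    Matrix.cons_val_zero, Matrix.cons_val_one, Matrix.cons_val_fin_one, vecN,
    h.isPatch.secondFund_symm hx 1 0, h.secondFund_00 hx, h.secondFund_01 hx]
  module

theorem gaussCurv_eq {x : ℝ × ℝ} (hx : x ∈ W) :
    gaussCurv u x = nip (secondFund u 0 1 x) (secondFund u 0 1 x) -
      nip (pd 0 (pd 0 u) x) (pd 1 (pd 1 u) x) := by
  have h1 : nip (secondFund u 0 0 x) (secondFund u 1 1 x) =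
      nip (pd 0 (pd 0 u) x) (pd 1 (pd 1 u) x) := by
    rw [show secondFund u 1 1 x = normalPart u x (pd 1 (pd 1 u) x) from rfl,
      nip_normal_normalPart (h.isPatch.nip_secondFund hx 0 0), h.secondFund_00 hx]
  rw [h.isPatch.gaussCurv_eq hx, h.det_eq hx, h1]; ring

variable (hs : ∀ x ∈ W, pd 0 (meanCurv u) x = 0)
include hs

theorem nip_pd_meanCurv_zero {x : ℝ × ℝ} (hx : x ∈ W) :
    nip (pd 1 (meanCurv u) x) (pd 0 u x) = 0 := by
  rw [h.isPatch.nip_pd_meanCurv' hx, h.isPatch.secondFund_symm hx, ← h.isPatch.nip_pd_meanCurv' hx,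
    hs x hx, nip_zero_left]

/-- If the mean curvature vector is null and constant along the null coordinate lines, the
remaining conditions hold as soon as it is not parallel in the normal bundle. -/
theorem isProperAt (hH : ∀ x ∈ W, nip (meanCurv u x) (meanCurv u x) = 0) {x : ℝ × ℝ}
    (hx : x ∈ W) (h0 : meanCurv u x ≠ 0)
    (hli : LinearIndependent ℝ ![pd 0 u x, pd 1 (meanCurv u) x]) : IsProperAt u x := by
  refine ⟨⟨h0, hH x hx⟩, fun l => ?_, 1, fun hn => ?_⟩
  · have e0 : normalDeriv u 0 (meanCurv u) x = 0 := by
      rw [normalDeriv, hs x hx, normalPart_eq_self (by simp)]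
    obtain ⟨c, hc⟩ := h.isPatch.exists_normalDeriv_eq_smul hH hx h0 1
    have e1 : nip (meanCurv u x) (secondFund u 0 l x) = 0 := by
      have := h.isPatch.nip_pd_meanCurv' hx 0 l
      rw [hs x hx, nip_zero_left] at this
      linarith
    simp [traceShapeNabla, Fin.sum_univ_two, e0, hc, e1, h.metricInv_eq hx]
  · rw [normalDeriv, normalPart, h.tangentPart_eq hx, h.nip_pd_meanCurv_zero hs hx] at hn
    have := LinearIndependent.pair_iff.1 hli (nip (pd 1 (meanCurv u) x) (pd 1 u x)) 1 (by
      rw [← hn]; module)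
    exact one_ne_zero this.2

theorem linearIndependent_of_isProperAt {x : ℝ × ℝ} (hx : x ∈ W) (hp : IsProperAt u x) :
    LinearIndependent ℝ ![pd 0 u x, pd 1 (meanCurv u) x] := by
  have hn : normalDeriv u 1 (meanCurv u) x ≠ 0 := by
    obtain ⟨i, hi⟩ := hp.2.2
    fin_cases i
    · exact absurd (by simp [normalDeriv, hs x hx, normalPart_eq_self]) hi
    · exact hi
  have h0 : pd 0 u x ≠ 0 := fun h0 => by
    have := h.m01 x hx
    rw [h0, nip_zero_left] at this
    norm_num at this
  rw [LinearIndependent.pair_iff]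
  intro a b hab
  have hb := congrArg (normalPart u x) hab
  rw [normalPart_add, normalPart_smul, normalPart_smul, normalPart_pd (h.isPatch.det_ne x hx),
    smul_zero, zero_add, normalPart_eq_self (v := (0 : E42)) (by simp)] at hb
  have hb := (smul_eq_zero.1 hb).resolve_right hn
  rw [hb, zero_smul, add_zero] at hab
  exact ⟨(smul_eq_zero.1 hab).resolve_right h0, hb⟩

end IsSemiNull

end SemiNull

/-! ### The families consist of quasi-minimal proper biconservative surfaces -/

section Families

variable {u : ℝ × ℝ → E42} {W : Set (ℝ × ℝ)}

/-- If `H` has a fixed null direction, the shape operator `A_H` vanishes and only the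
non-vanishing of `H` and of its differential matters. -/
theorem IsPatch.isProperAt_of_fixed_direction (hu : IsPatch u W) {c₀ : E42} {h : ℝ × ℝ → ℝ}
    (hc : nip c₀ c₀ = 0) (hh : ContDiffOn ℝ ∞ h W) (hH : ∀ x ∈ W, meanCurv u x = h x • c₀)
    {x : ℝ × ℝ} (hx : x ∈ W) (h0 : meanCurv u x ≠ 0) {i : Fin 2} (hi : pd i h x ≠ 0) :
    IsProperAt u x := by
  have hhx : h x ≠ 0 := fun hz => h0 (by rw [hH x hx, hz, zero_smul])
  have hc0 : c₀ ≠ 0 := fun hz => h0 (by rw [hH x hx, hz, smul_zero])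
  have hd : ∀ j, pd j (meanCurv u) x = pd j h x • c₀ := fun j => by
    have := (((hasPd_of_contDiffOn j hh hu.isOpen hx).smul (hasPd_const j c₀ x)).congr_of_eqOn
      hu.isOpen hx fun q hq => hH q hq).2
    rw [this, smul_zero, zero_add]
  have horth : ∀ k, nip c₀ (pd k u x) = 0 := fun k => by
    have := hu.nip_meanCurv hx k
    rw [hH x hx, nip_smul_left] at this
    exact (mul_eq_zero.1 this).resolve_left hhx
  have hn : ∀ j, normalDeriv u j (meanCurv u) x = pd j h x • c₀ := fun j => by
    rw [normalDeriv, hd, normalPart_smul, normalPart_eq_self horth]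
  have hb : ∀ j l, nip c₀ (secondFund u j l x) = 0 := fun j l => by
    have := hu.nip_pd_meanCurv' hx j l
    rw [hd, hH x hx, nip_smul_left, nip_smul_left, horth, mul_zero] at this
    exact (mul_eq_zero.1 (neg_eq_zero.1 this.symm)).resolve_left hhx
  refine ⟨⟨h0, by rw [hH x hx]; simp [hc]⟩, fun l => ?_, i, ?_⟩
  · simp [traceShapeNabla, hn, hb]
  · rw [hn]; exact smul_ne_zero hi hc0

/-- In null coordinates with `⟨∂₀u, ∂₁u⟩ = 1` the mean curvature vector is `∂₀∂₁u`. -/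
theorem IsPatch.meanCurv_eq_of_null (hu : IsPatch u W)
    (h00 : ∀ x ∈ W, nip (pd 0 u x) (pd 0 u x) = 0) (h01 : ∀ x ∈ W, nip (pd 0 u x) (pd 1 u x) = 1)
    (h11 : ∀ x ∈ W, nip (pd 1 u x) (pd 1 u x) = 0) {x : ℝ × ℝ} (hx : x ∈ W) :
    meanCurv u x = pd 0 (pd 1 u) x := by
  have hinv : metricInv u x = !![0, 1; 1, 0] := by
    refine Matrix.inv_eq_left_inv ?_
    have : metric u x = !![0, 1; 1, 0] := by
      ext i j
      fin_cases i <;> fin_cases j <;>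
        simp [metric_apply, h00 x hx, h01 x hx, h11 x hx, nip_comm (pd 1 u x) (pd 0 u x)]
    rw [this]
    ext i j
    fin_cases i <;> fin_cases j <;> simp [Matrix.mul_apply, Fin.sum_univ_two]
  have e0 : nip (pd 0 (pd 1 u) x) (pd 0 u x) = 0 := by
    have := ((hu.hasPd_pd hx 1 0).nip (hu.hasPd_pd hx 1 0)).eq_of_eqOn
      (hasPd_const 1 0 x) hu.isOpen hx h00
    rw [nip_comm (pd 0 u x)] at this
    rw [hu.pd_pd_comm hx]
    linarith
  have e1 : nip (pd 0 (pd 1 u) x) (pd 1 u x) = 0 := by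
    have := ((hu.hasPd_pd hx 0 1).nip (hu.hasPd_pd hx 0 1)).eq_of_eqOn
      (hasPd_const 0 0 x) hu.isOpen hx h11
    rw [nip_comm (pd 1 u x)] at this
    linarith
  have hs : secondFund u 0 1 x = pd 0 (pd 1 u) x :=
    normalPart_eq_self (Fin.forall_fin_two.2 ⟨e0, e1⟩)
  simp only [meanCurv, hinv, Fin.sum_univ_two, Matrix.of_apply, Matrix.cons_val',
    Matrix.cons_val_zero, Matrix.cons_val_one, Matrix.cons_val_fin_one,
    hu.secondFund_symm hx 1 0, hs]
  module

/-- The surface of the first family attached to the function `ψ`. -/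
noncomputable def graphSurface (ψ : ℝ × ℝ → ℝ) (p : ℝ × ℝ) : E42 :=
  ![ψ p, (p.1 - p.2) / √2, (p.1 + p.2) / √2, ψ p]

theorem hasPd_graphSurface {ψ : ℝ × ℝ → ℝ} {x : ℝ × ℝ} {d : ℝ} {i : Fin 2} (h : HasPd i ψ d x) :
    HasPd i (graphSurface ψ) (![![d, 1 / √2, 1 / √2, d], ![d, -1 / √2, 1 / √2, d]] i) x := by
  have c2 := fun i => hasPd_const i (√2) x
  have h2 : √2 ≠ 0 := by positivity
  refine hasPd_pi fun k => ?_
  fin_cases i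
  · fin_cases k
    · exact h
    · exact (((hasPd_fst_zero x).sub (hasPd_snd_zero x)).div (c2 0) h2).congr_deriv (by
        simp; field_simp; norm_num)
    · exact (((hasPd_fst_zero x).add (hasPd_snd_zero x)).div (c2 0) h2).congr_deriv (by
        simp; field_simp; norm_num)
    · exact h
  · fin_cases k
    · exact h
    · exact (((hasPd_fst_one x).sub (hasPd_snd_one x)).div (c2 1) h2).congr_deriv (by
        simp; field_simp; norm_num)
    · exact (((hasPd_fst_one x).add (hasPd_snd_one x)).div (c2 1) h2).congr_deriv (by
        simp; field_simp; norm_num)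
    · exact h

/-- A member of the first family has mean curvature vector `ψ_{st} (1, 0, 0, 1)`. -/
theorem meanCurv_graph {ψ : ℝ × ℝ → ℝ} (hu : IsPatch u W) (hψ : ContDiffOn ℝ ∞ ψ W)
    (h : EqOn u (graphSurface ψ) W) :
    ∀ x ∈ W, meanCurv u x = pd 0 (pd 1 ψ) x • ![1, 0, 0, 1] := by
  have h2 : √2 ≠ 0 := by positivity
  have h22 : √2 ^ 2 = 2 := by norm_num
  have hp : ∀ i, ∀ x ∈ W, pd i u x =
      ![![pd i ψ x, 1 / √2, 1 / √2, pd i ψ x], ![pd i ψ x, -1 / √2, 1 / √2, pd i ψ x]] i :=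
    fun i x hx => ((hasPd_graphSurface (hasPd_of_contDiffOn i hψ hu.isOpen hx)).congr_of_eqOn
      hu.isOpen hx h).2
  intro x hx
  rw [hu.meanCurv_eq_of_null _ _ _ hx]
  · have hψ1 := hasPd_of_contDiffOn 0 (contDiffOn_pd 1 hψ hu.isOpen) hu.isOpen hx
    have : HasPd 0 (pd 1 u) (![pd 0 (pd 1 ψ) x, 0, 0, pd 0 (pd 1 ψ) x]) x := by
      refine hasPd_pi fun k => ?_
      fin_cases k
      · exact hψ1.congr_of_eqOn hu.isOpen hx fun q hq => by simp [hp 1 q hq]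
      · exact (hasPd_const 0 (-1 / √2) x).congr_of_eqOn hu.isOpen hx fun q hq => by
          simp [hp 1 q hq]
      · exact (hasPd_const 0 (1 / √2) x).congr_of_eqOn hu.isOpen hx fun q hq => by
          simp [hp 1 q hq]
      · exact hψ1.congr_of_eqOn hu.isOpen hx fun q hq => by simp [hp 1 q hq]
    rw [this.2]; ext k; fin_cases k <;> simp
  · intro y hy; rw [hp 0 y hy]; simp [nip]
  · intro y hy; rw [hp 0 y hy, hp 1 y hy]; simp [nip]; field_simp; rw [h22]; ring
  · intro y hy; rw [hp 1 y hy]; simp [nip]; field_simp; ring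

theorem FamilyI.isProperAt (hu : IsPatch u W) (h : FamilyI u W) : ∀ x ∈ W, IsProperAt u x := by
  obtain ⟨ψ, hψ, h1, h2, h3⟩ := h
  intro x hx
  have hH := meanCurv_graph hu hψ h3
  have hsm := contDiffOn_pd 0 (contDiffOn_pd 1 hψ hu.isOpen) hu.isOpen
  have h0 : meanCurv u x ≠ 0 := fun h0 => by
    rw [hH x hx] at h0
    exact h1 x hx (by simpa using congrFun h0 0)
  rcases h2 x hx with h | h
  · exact hu.isProperAt_of_fixed_direction (by simp [nip]) hsm hH hx h0 h
  · exact hu.isProperAt_of_fixed_direction (by simp [nip]) hsm hH hx h0 h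

theorem isReparam_swap (hW : IsOpen W) :
    IsReparam Prod.swap (Prod.swap ⁻¹' W) W where
  isOpen := hW.preimage continuous_swap
  smooth := (contDiff_snd.prodMk contDiff_fst).contDiffOn
  mapsTo := fun _ h => h
  det_ne y _ := by
    have h : HasFDerivAt (Prod.swap : ℝ × ℝ → ℝ × ℝ)
        ((ContinuousLinearMap.snd ℝ ℝ ℝ).prod (ContinuousLinearMap.fst ℝ ℝ ℝ)) y :=
      hasFDerivAt_snd.prodMk hasFDerivAt_fst
    have h0 := (hasPd_of_hasFDerivAt h 0).2
    have h1 := (hasPd_of_hasFDerivAt h 1).2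
    rw [Matrix.det_fin_two]
    simp [jac, h0, h1, dir]

theorem contDiffOn_comp_snd {F : Type*} [NormedAddCommGroup F] [NormedSpace ℝ F] {a : ℝ → F}
    {I J : Set ℝ} (ha : ContDiffOn ℝ ∞ a J) : ContDiffOn ℝ ∞ (fun q : ℝ × ℝ => a q.2) (I ×ˢ J) :=
  ha.comp contDiff_snd.contDiffOn fun _ hx => hx.2

theorem ContDiffOn.deriv_isOpen {F : Type*} [NormedAddCommGroup F] [NormedSpace ℝ F] {a : ℝ → F}
    {J : Set ℝ} (ha : ContDiffOn ℝ ∞ a J) (hJ : IsOpen J) : ContDiffOn ℝ ∞ (deriv a) J :=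
  ha.deriv_of_isOpen hJ (by simp)

theorem differentiableAt_of_contDiffOn_real {F : Type*} [NormedAddCommGroup F] [NormedSpace ℝ F]
    {a : ℝ → F} {J : Set ℝ} (ha : ContDiffOn ℝ ∞ a J) (hJ : IsOpen J) {t : ℝ} (ht : t ∈ J) :
    DifferentiableAt ℝ a t := (ha.contDiffAt (hJ.mem_nhds ht)).differentiableAt (by simp)

/-- Derivative of an inner product of curves whose value is constant on an open set. -/
theorem nip_deriv_add_eq_zero {a b : ℝ → E42} {J : Set ℝ} (hJ : IsOpen J) {c : ℝ}
    (ha : ContDiffOn ℝ ∞ a J) (hb : ContDiffOn ℝ ∞ b J) (h : ∀ t ∈ J, nip (a t) (b t) = c)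
    {t : ℝ} (ht : t ∈ J) : nip (deriv a t) (b t) + nip (a t) (deriv b t) = 0 := by
  have hx : ((0 : ℝ), t) ∈ (univ : Set ℝ) ×ˢ J := ⟨mem_univ _, ht⟩
  exact ((hasPd_one_comp_snd (x := (0, t)) (differentiableAt_of_contDiffOn_real ha hJ ht)).nip
    (hasPd_one_comp_snd (x := (0, t)) (differentiableAt_of_contDiffOn_real hb hJ ht))).eq_of_eqOn
    (hasPd_const 1 c (0, t)) (isOpen_univ.prod hJ) hx fun q hq => h q.2 hq.2

/-- In these surfaces `H = -z'`. -/
theorem FamilyII.isProperAt (hu : IsPatch u W) (h : FamilyII u W) :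
    ∀ x ∈ W, IsProperAt u x := by
  obtain ⟨I, J, z, w, hI, hJ, rfl, hz, hw, hz0, hz1, hw1, hzw1, hzw, hli, hf⟩ := h
  -- exchanging the coordinates makes them semi-null with `m = 0`
  set y := u ∘ Prod.swap with hy
  have hΨ := isReparam_swap hu.isOpen
  rw [show (Prod.swap ⁻¹' (I ×ˢ J) : Set (ℝ × ℝ)) = J ×ˢ I by ext; simp [and_comm]] at hΨ
  have hyP := hu.comp hΨ
  have dz := fun t (ht : t ∈ I) => differentiableAt_of_contDiffOn_real hz hI.1 ht
  have dw := fun t (ht : t ∈ I) => differentiableAt_of_contDiffOn_real hw hI.1 ht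
  have hz' := ContDiffOn.deriv_isOpen hz hI.1
  have dz' := fun t (ht : t ∈ I) => differentiableAt_of_contDiffOn_real hz' hI.1 ht
  have hyeq : EqOn y (fun q => q.1 • z q.2 + w q.2) (J ×ˢ I) := fun q hq => by
    show u (q.2, q.1) = _
    rw [hf (q.2, q.1) ⟨hq.2, hq.1⟩]
  have hy0 : ∀ q ∈ J ×ˢ I, pd 0 y q = z q.2 := fun q hq => by
    have := (((hasPd_fst_zero q).smul (hasPd_zero_comp_snd (dz _ hq.2))).add
      (hasPd_zero_comp_snd (dw _ hq.2))).congr_of_eqOn hΨ.isOpen hq hyeq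
    rw [this.2]; simp
  have hy1 : ∀ q ∈ J ×ˢ I, pd 1 y q = q.1 • deriv z q.2 + deriv w q.2 := fun q hq => by
    have := (((hasPd_fst_one q).smul (hasPd_one_comp_snd (dz _ hq.2))).add
      (hasPd_one_comp_snd (dw _ hq.2))).congr_of_eqOn hΨ.isOpen hq hyeq
    rw [this.2]; simp
  have hzz' : ∀ t ∈ I, nip (z t) (deriv z t) = 0 := fun t ht => by
    have := nip_deriv_add_eq_zero hI.1 hz hz hz0 ht
    rw [nip_comm (deriv z t)] at this; linarith
  have hs : IsSemiNull (fun _ => 0) y (J ×ˢ I) := by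
    refine ⟨hΨ.isOpen, hyP.smooth, fun q hq => ?_, fun q hq => ?_, fun q hq => ?_⟩
    · rw [hy0 q hq, hz0 _ hq.2]
    · simp [hy0 q hq, hy1 q hq, hzz' _ hq.2, hzw _ hq.2]
    · simp [hy1 q hq, (hz1 _ hq.2).2, (hw1 _ hq.2).2, hzw1 _ hq.2,
        nip_comm (deriv w q.2) (deriv z q.2)]
  have hH : EqOn (meanCurv y) (fun q => -deriv z q.2) (J ×ˢ I) := fun q hq => by
    have : pd 0 (pd 1 y) q = deriv z q.2 := by
      rw [hyP.pd_pd_comm hq]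
      exact ((hasPd_one_comp_snd (dz _ hq.2)).congr_of_eqOn hΨ.isOpen hq hy0).2
    have c0 : pd 0 (fun _ : ℝ × ℝ => (0 : ℝ)) q = 0 := (hasPd_const 0 0 q).2
    rw [hs.meanCurv_eq hq, vecN, this, c0]; simp
  have hH0 : ∀ q ∈ J ×ˢ I, pd 0 (meanCurv y) q = 0 := fun q hq => by
    rw [((hasPd_zero_comp_snd (dz' _ hq.2)).neg.congr_of_eqOn hΨ.isOpen hq hH).2, neg_zero]
  have hH1 : ∀ q ∈ J ×ˢ I, pd 1 (meanCurv y) q = -deriv (deriv z) q.2 := fun q hq =>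
    ((hasPd_one_comp_snd (dz' _ hq.2)).neg.congr_of_eqOn hΨ.isOpen hq hH).2
  intro x hx
  have hx' : x.swap ∈ J ×ˢ I := ⟨hx.2, hx.1⟩
  refine (hu.isProperAt_comp hΨ hx').1 (hs.isProperAt hH0 (fun q hq => ?_) hx' ?_ ?_)
  · rw [hH hq]; simp [(hz1 _ hq.2).2]
  · rw [hH hx']; exact neg_ne_zero.2 (hz1 _ hx.1).1
  · rw [hy0 _ hx', hH1 _ hx']
    have := hli _ hx.1
    rw [LinearIndependent.pair_iff] at this ⊢
    intro a b hab
    have := this a (-b) (by rw [← hab]; simp)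
    exact ⟨this.1, by linarith [this.2]⟩

/-- The coordinates `(s, t)` are semi-null for the function `m`; the vector `N = -H` lies in the
totally null plane spanned by `α` and `α'`, and does not depend on `s` because `L` does not. -/
theorem FamilyIII.isProperAt (hu : IsPatch u W) (h : FamilyIII u W) :
    ∀ x ∈ W, IsProperAt u x := by
  obtain ⟨I, J, m, L, a, α, η, hI, hJ, rfl, hm, hκ0, hfunL, ha, ha0, hα, hη, hαα, hα1, hαli, hηη,
    hαη, hηα1, hηα2, hf, hN0, hNli⟩ := h
  have hW := hu.isOpen
  intro x hx
  have hκ : ContDiffOn ℝ ∞ (curvM m) (I ×ˢ J) := contDiffOn_pd 0 (contDiffOn_pd 0 hm hW) hW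
  have hL : ContDiffOn ℝ ∞ L J := by
    have hl : ContDiffOn ℝ ∞ (funL m) (I ×ˢ J) :=
      (((contDiffOn_pd 1 hκ hW).add (hm.mul (contDiffOn_pd 0 hκ hW))).add
        ((contDiffOn_const.mul (contDiffOn_pd 0 hm hW)).mul hκ)).div hκ hκ0 |>.neg
    exact (contDiffOn_slice hl hx.1).congr fun t ht => (hfunL (x.1, t) ⟨hx.1, ht⟩).symm
  have ha' := ContDiffOn.deriv_isOpen ha hJ.1
  have hα' := ContDiffOn.deriv_isOpen hα hJ.1
  have hα'' := ContDiffOn.deriv_isOpen hα' hJ.1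
  have i01 : ∀ t ∈ J, nip (α t) (deriv α t) = 0 := fun t ht => by
    have := nip_deriv_add_eq_zero hJ.1 hα hα hαα ht
    rw [nip_comm (deriv α t)] at this; linarith
  have i12 : ∀ t ∈ J, nip (deriv α t) (deriv (deriv α) t) = 0 := fun t ht => by
    have := nip_deriv_add_eq_zero hJ.1 hα' hα' (fun t ht => (hα1 t ht).2) ht
    rw [nip_comm (deriv (deriv α) t)] at this; linarith
  have i02 : ∀ t ∈ J, nip (α t) (deriv (deriv α) t) = 0 := fun t ht => by
    have := nip_deriv_add_eq_zero hJ.1 hα hα' i01 ht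
    rw [(hα1 t ht).2] at this; linarith
  -- the plane spanned by `α` and `α'` is totally null, so it contains `α''`
  have i22 : ∀ t ∈ J, nip (deriv (deriv α) t) (deriv (deriv α) t) = 0 := fun t ht => by
    obtain ⟨c, d, hcd⟩ := exists_combination_of_orthogonal_null_plane (hαli t ht) (hαα t ht)
      (i01 t ht) (hα1 t ht).2 (by rw [nip_comm]; exact i02 t ht)
      (by rw [nip_comm]; exact i12 t ht)
    conv_lhs => rw [hcd]
    simp [hαα t ht, i01 t ht, (hα1 t ht).2, nip_comm (deriv α t) (α t)]
  have d0 {F : Type} [NormedAddCommGroup F] [NormedSpace ℝ F] {b : ℝ → F}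
      (hb : ContDiffOn ℝ ∞ b J) {q : ℝ × ℝ} (hq : q ∈ I ×ˢ J) : HasPd 0 (fun q => b q.2) 0 q :=
    hasPd_zero_comp_snd (differentiableAt_of_contDiffOn_real hb hJ.1 hq.2)
  have d1 {F : Type} [NormedAddCommGroup F] [NormedSpace ℝ F] {b : ℝ → F}
      (hb : ContDiffOn ℝ ∞ b J) {q : ℝ × ℝ} (hq : q ∈ I ×ˢ J) :
      HasPd 1 (fun q => b q.2) (deriv b q.2) q :=
    hasPd_one_comp_snd (differentiableAt_of_contDiffOn_real hb hJ.1 hq.2)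
  have dm := fun i q (hq : q ∈ I ×ˢ J) => hasPd_of_contDiffOn i hm hW hq
  have dms := fun i q (hq : q ∈ I ×ˢ J) => hasPd_of_contDiffOn i (contDiffOn_pd 0 hm hW) hW hq
  -- `∂₀u = R α + a α'`
  set R : ℝ × ℝ → ℝ := fun q => deriv a q.2 - a q.2 * (pd 0 m q + L q.2) with hR
  have hRs : ContDiffOn ℝ ∞ R (I ×ˢ J) :=
    (contDiffOn_comp_snd ha').sub ((contDiffOn_comp_snd ha).mul
      ((contDiffOn_pd 0 hm hW).add (contDiffOn_comp_snd hL)))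
  have u0 : ∀ q ∈ I ×ˢ J, pd 0 u q = R q • α q.2 + a q.2 • deriv α q.2 := fun q hq => by
    have hP := ((hasPd_fst_zero q).mul (d0 ha' hq)).sub ((d0 ha hq).mul
      ((dm 0 q hq).add ((hasPd_fst_zero q).mul (d0 hL hq))))
    have := (((d0 hη hq).add (hP.smul (d0 hα hq))).add
      (((hasPd_fst_zero q).mul (d0 ha hq)).smul (d0 hα' hq))).congr_of_eqOn hW hq hf
    rw [this.2, hR]
    module
  obtain ⟨X, hX⟩ : ∃ X : ℝ × ℝ → ℝ, ∀ q ∈ I ×ˢ J, pd 1 u q = deriv η q.2 + X q • α q.2 +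
      (2 * q.1 * deriv a q.2 - a q.2 * (m q + q.1 * L q.2)) • deriv α q.2 +
        (q.1 * a q.2) • deriv (deriv α) q.2 := by
    refine ⟨fun q => q.1 * deriv (deriv a) q.2 - (a q.2 * (pd 1 m q + q.1 * deriv L q.2) +
      deriv a q.2 * (m q + q.1 * L q.2)), fun q hq => ?_⟩
    have hP := ((hasPd_fst_one q).mul (d1 ha' hq)).sub ((d1 ha hq).mul
      ((dm 1 q hq).add ((hasPd_fst_one q).mul (d1 hL hq))))
    have := (((d1 hη hq).add (hP.smul (d1 hα hq))).add
      (((hasPd_fst_one q).mul (d1 ha hq)).smul (d1 hα' hq))).congr_of_eqOn hW hq hf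
    rw [this.2]
    module
  have hs : IsSemiNull m u (I ×ˢ J) := by
    refine ⟨hW, hu.smooth, fun q hq => ?_, fun q hq => ?_, fun q hq => ?_⟩
    · simp [u0 q hq, hαα _ hq.2, i01 _ hq.2, (hα1 _ hq.2).2, nip_comm (deriv α q.2) (α q.2)]
    · simp [u0 q hq, hX q hq, hαα _ hq.2, i01 _ hq.2, (hα1 _ hq.2).2, i02 _ hq.2, i12 _ hq.2,
        hαη _ hq.2, nip_comm (deriv α q.2) (α q.2), nip_comm (deriv α q.2) (deriv η q.2),
        hηα1 _ hq.2, ha0 _ hq.2]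
    · simp only [hX q hq, nip_add_left, nip_add_right, nip_smul_left, nip_smul_right,
        nip_comm (deriv α q.2) (α q.2), nip_comm (deriv α q.2) (deriv η q.2),
        nip_comm (deriv (deriv α) q.2) (deriv η q.2), nip_comm (deriv (deriv α) q.2) (deriv α q.2),
        nip_comm (deriv (deriv α) q.2) (α q.2), nip_comm (deriv η q.2) (α q.2),
        hαα _ hq.2, i01 _ hq.2, (hα1 _ hq.2).2, i02 _ hq.2, i12 _ hq.2, i22 _ hq.2,
        hαη _ hq.2, hηα1 _ hq.2, hηη _ hq.2, hηα2 _ hq.2]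
      have := ha0 _ hq.2
      field_simp
      ring
  have R0 : ∀ q ∈ I ×ˢ J, pd 0 R q = -(a q.2 * curvM m q) := fun q hq => by
    have := (d0 ha' hq).sub ((d0 ha hq).mul ((dms 0 q hq).add (d0 hL hq)))
    rw [this.2, curvM]; ring
  have u00 : ∀ q ∈ I ×ˢ J, pd 0 (pd 0 u) q = -(a q.2 * curvM m q) • α q.2 := fun q hq => by
    have := (((hasPd_of_contDiffOn 0 hRs hW hq).smul (d0 hα hq)).add
      ((d0 ha hq).smul (d0 hα' hq))).congr_of_eqOn hW hq u0
    rw [this.2, R0 q hq]; module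
  have u01 : ∀ q ∈ I ×ˢ J, pd 0 (pd 1 u) q = pd 1 R q • α q.2 + (R q + deriv a q.2) • deriv α q.2 +
      a q.2 • deriv (deriv α) q.2 := fun q hq => by
    have := (((hasPd_of_contDiffOn 1 hRs hW hq).smul (d1 hα hq)).add
      ((d1 ha hq).smul (d1 hα' hq))).congr_of_eqOn hW hq u0
    rw [hu.pd_pd_comm hq, this.2]; module
  set Y : ℝ × ℝ → ℝ := fun q => pd 1 R q - m q * (a q.2 * curvM m q) + pd 0 m q * R q with hY
  have hN : EqOn (vecN m u) (fun q => Y q • α q.2 +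
      (2 * deriv a q.2 - a q.2 * L q.2) • deriv α q.2 + a q.2 • deriv (deriv α) q.2)
        (I ×ˢ J) := fun q hq => by
    simp only [vecN, u00 q hq, u01 q hq, u0 q hq, hY, hR]
    module
  have hYs : ContDiffOn ℝ ∞ Y (I ×ˢ J) :=
    ((contDiffOn_pd 1 hRs hW).sub (hm.mul ((contDiffOn_comp_snd ha).mul hκ))).add
      ((contDiffOn_pd 0 hm hW).mul hRs)
  -- the definition of `L` says that `vecN` is constant along the coordinate lines `t = const`
  have hY0 : ∀ q ∈ I ×ˢ J, pd 0 Y q = 0 := fun q hq => by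
    have dκ := fun i => hasPd_of_contDiffOn i hκ hW hq
    have h10 : pd 0 (pd 1 R) q = -(a q.2 * pd 1 (curvM m) q + deriv a q.2 * curvM m q) := by
      rw [pd_comm 0 1 hRs hW hq]
      exact (((d1 ha hq).mul (dκ 1)).neg.congr_of_eqOn hW hq R0).2
    have := ((hasPd_of_contDiffOn 0 (contDiffOn_pd 1 hRs hW) hW hq).sub ((dm 0 q hq).mul
      ((d0 ha hq).mul (dκ 0)))).add ((dms 0 q hq).mul (hasPd_of_contDiffOn 0 hRs hW hq))
    rw [this.2, h10, R0 q hq]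
    have hl := hfunL q hq
    rw [funL, neg_eq_iff_eq_neg, div_eq_iff (hκ0 q hq)] at hl
    have e : pd 0 (pd 0 m) q = curvM m q := rfl
    rw [e, hR]
    linear_combination (-a q.2) * hl
  have hHN : EqOn (meanCurv u) (fun q => -vecN m u q) (I ×ˢ J) := fun q hq => hs.meanCurv_eq hq
  have dN0 : ∀ q ∈ I ×ˢ J, HasPd 0 (vecN m u) 0 q := fun q hq => by
    have hc : ContDiffOn ℝ ∞ (fun t => 2 * deriv a t - a t * L t) J :=
      (contDiffOn_const.mul ha').sub (ha.mul hL)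
    refine (((((hasPd_of_contDiffOn 0 hYs hW hq).smul (d0 hα hq)).add
      ((d0 hc hq).smul (d0 hα' hq))).add ((d0 ha hq).smul (d0 hα'' hq))).congr_of_eqOn hW hq
        hN).congr_deriv ?_
    rw [hY0 q hq]; simp
  have dN : HasPd 1 (vecN m u) (pd 1 (vecN m u) x) x := by
    have hd : DifferentiableAt ℝ (vecN m u) x := (dN0 x hx).1
    exact ⟨hd, rfl⟩
  refine hs.isProperAt (fun q hq => ?_) (fun q hq => ?_) hx ?_ ?_
  · rw [((dN0 q hq).neg.congr_of_eqOn hW hq hHN).2, neg_zero]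
  · rw [hHN hq]
    simp only [hN hq, nip_neg_left, nip_neg_right, nip_add_left, nip_add_right, nip_smul_left,
      nip_smul_right, nip_comm (deriv α q.2) (α q.2),
      nip_comm (deriv (deriv α) q.2) (deriv α q.2), nip_comm (deriv (deriv α) q.2) (α q.2),
      hαα _ hq.2, i01 _ hq.2, (hα1 _ hq.2).2, i02 _ hq.2, i12 _ hq.2, i22 _ hq.2]
    ring
  · rw [hHN hx]; exact neg_ne_zero.2 (hN0 x hx)
  · rw [(dN.neg.congr_of_eqOn hW hx hHN).2]
    have := hNli x hx
    rw [LinearIndependent.pair_iff] at this ⊢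
    intro a b hab
    have := this a (-b) (by rw [← hab]; simp)
    exact ⟨this.1, by linarith [this.2]⟩

theorem Families.isProperAt (hu : IsPatch u W) (h : Families u W) : ∀ x ∈ W, IsProperAt u x := by
  rcases h with h | h | h
  · exact FamilyI.isProperAt hu h
  · exact FamilyII.isProperAt hu h
  · exact FamilyIII.isProperAt hu h

end Families

section Manifold

variable {M : Type*} [TopologicalSpace M] [ChartedSpace (ℝ × ℝ) M]
  [IsManifold 𝓘(ℝ, ℝ × ℝ) ∞ M] {f : M → E42}

theorem isProperAt_of_locallyCongruentTo (hf : IsSurface f) {p : M}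
    (h : LocallyCongruentTo Families f p) : IsProperAt (rep f p) (coord p) := by
  obtain ⟨φ, hφ, hp, T, ⟨A, b, hA, hT⟩, g, hg, hTg⟩ := h
  have hu := isPatch_of_isSurface hf hφ
  obtain ⟨hgP, hiff⟩ := isProperAt_congruence hA hu (v := g) (b := b) fun x hx => by
    have := hTg _ (φ.map_target hx)
    rw [φ.right_inv hx, hT] at this
    exact this.symm
  rw [isProperAt_rep hf hφ hp, ← hiff _ (φ.map_source hp)]
  exact Families.isProperAt hgP hg _ (φ.map_source hp)

end Manifold

/-! ### The kernel of the shape operator along the mean curvature vector -/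

section Kernel

variable {u : ℝ × ℝ → E42} {W : Set (ℝ × ℝ)}

theorem metricInv_mul_det {x : ℝ × ℝ} (h : (metric u x).det ≠ 0) :
    metricInv u x 0 0 * (metric u x).det = metric u x 1 1 ∧
    metricInv u x 0 1 * (metric u x).det = -metric u x 0 1 ∧
    metricInv u x 1 1 * (metric u x).det = metric u x 0 0 := by
  have e : ∀ i j, metricInv u x i j = (metric u x).det⁻¹ * (metric u x).adjugate i j :=
    fun i j => by simp [metricInv, Matrix.inv_def, Ring.inverse_eq_inv']
  simp only [e, Matrix.adjugate_fin_two, Matrix.of_apply, Matrix.cons_val', Matrix.cons_val_zero,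
    Matrix.cons_val_one, Matrix.cons_val_fin_one]
  refine ⟨?_, ?_, ?_⟩ <;> field_simp

/-- A kernel vector `e` of a non-zero trace-free symmetric bilinear form `b` on a plane with metric
`g` is null. -/
theorem null_of_kernel {g00 g01 g11 b00 b01 b11 e0 e1 : ℝ}
    (htr : g11 * b00 - 2 * (g01 * b01) + g00 * b11 = 0)
    (h0 : e0 * b00 + e1 * b01 = 0) (h1 : e0 * b01 + e1 * b11 = 0)
    (hb : b00 ≠ 0 ∨ b01 ≠ 0 ∨ b11 ≠ 0) :
    e0 * e0 * g00 + 2 * (e0 * e1 * g01) + e1 * e1 * g11 = 0 := by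
  rcases hb with hb | hb | hb <;> refine (mul_eq_zero.1 ?_).resolve_left hb
  · linear_combination e1 ^ 2 * htr + (2 * g01 * e1 + g00 * e0) * h0 - g00 * e1 * h1
  · linear_combination (-e0 * e1) * htr + g11 * e1 * h0 + g00 * e0 * h1
  · linear_combination e0 ^ 2 * htr - g11 * e0 * h0 + (g11 * e1 + 2 * g01 * e0) * h1

theorem IsPatch.shapeVanishes_iff (hu : IsPatch u W) {x : ℝ × ℝ} (hx : x ∈ W) :
    ShapeVanishes u x ↔ ∀ j l, nip (meanCurv u x) (secondFund u j l x) = 0 := by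
  have key : ∀ j l, nip (pd j (meanCurv u) x) (pd l u x) = 0 ↔
      nip (meanCurv u x) (secondFund u j l x) = 0 := fun j l => by
    rw [hu.nip_pd_meanCurv' hx, neg_eq_zero]
  simp only [← key]
  constructor
  · intro h j l
    rw [← nip_tangentPart (hu.det_ne x hx), ← neg_eq_zero, ← nip_neg_left]
    have := h j
    rw [shapeOp] at this
    rw [this, nip_zero_left]
  · intro h i
    rw [shapeOp, tangentPart_eq_zero (h i), neg_zero]

/-- The vector metrically dual to the connection form of `∇^⊥ H` lies in the kernel of `A_H` by
the biconservative equation. As `A_H` is trace-free, it is null if `A_H ≠ 0`, and then `H` is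
constant in its direction. -/
theorem IsPatch.exists_null_direction (hu : IsPatch u W) (hp : ∀ x ∈ W, IsProperAt u x)
    {x : ℝ × ℝ} (hx : x ∈ W) (hA : ¬ ShapeVanishes u x) :
    ∃ e : Fin 2 → ℝ, e ≠ 0 ∧ e 0 • pd 0 (meanCurv u) x + e 1 • pd 1 (meanCurv u) x = 0 ∧
      e 0 * e 0 * metric u x 0 0 + 2 * (e 0 * e 1 * metric u x 0 1) +
        e 1 * e 1 * metric u x 1 1 = 0 := by
  have hd := hu.det_ne x hx
  have hH : ∀ x ∈ W, nip (meanCurv u x) (meanCurv u x) = 0 := fun x hx => (hp x hx).1.2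
  choose w hw using fun i => hu.exists_normalDeriv_eq_smul hH hx (hp x hx).1.1 i
  set b : Fin 2 → Fin 2 → ℝ := fun j l => nip (meanCurv u x) (secondFund u j l x) with hb
  have hbs : b 1 0 = b 0 1 := by simp only [hb, hu.secondFund_symm hx 1 0]
  set e : Fin 2 → ℝ := fun j => ∑ i, metricInv u x i j * w i with he
  have hge : ∀ k, metric u x 0 k * e 0 + metric u x 1 k * e 1 = w k := fun k => by
    have h0 := metricInv_mul_metric hd 0 k
    have h1 := metricInv_mul_metric hd 1 k
    have : w k = (if (0 : Fin 2) = k then 1 else 0) * w 0 +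
      (if (1 : Fin 2) = k then 1 else 0) * w 1 := by fin_cases k <;> simp
    rw [this, ← h0, ← h1]
    simp only [he, Fin.sum_univ_two]; ring
  have heb : ∀ l, e 0 * b 0 l + e 1 * b 1 l = 0 := fun l => by
    have h := (hp x hx).2.1 l
    simp only [traceShapeNabla, hw, nip_smul_left, Fin.sum_univ_two] at h
    simp only [he, hb, Fin.sum_univ_two]
    linear_combination h
  have htr :
      metric u x 1 1 * b 0 0 - 2 * (metric u x 0 1 * b 0 1) + metric u x 0 0 * b 1 1 = 0 := by
    obtain ⟨h00, h01, h11⟩ := metricInv_mul_det hd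
    have h := (hp x hx).1.2
    nth_rewrite 2 [meanCurv] at h
    simp only [nip_smul_right, Fin.sum_univ_two, nip_add_right, metricInv_symm u x 1 0,
      hu.secondFund_symm hx 1 0] at h
    simp only [hb]
    linear_combination 2 * (metric u x).det * h - nip (meanCurv u x) (secondFund u 0 0 x) * h00 -
      2 * nip (meanCurv u x) (secondFund u 0 1 x) * h01 -
      nip (meanCurv u x) (secondFund u 1 1 x) * h11
  have hbne : b 0 0 ≠ 0 ∨ b 0 1 ≠ 0 ∨ b 1 1 ≠ 0 := by
    by_contra! hcon
    refine hA ((hu.shapeVanishes_iff hx).2 ?_)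
    rw [Fin.forall_fin_two, Fin.forall_fin_two, Fin.forall_fin_two]
    exact ⟨⟨hcon.1, hcon.2.1⟩, hbs.trans hcon.2.1, hcon.2.2⟩
  have hnull := null_of_kernel htr (by rw [← hbs]; exact heb 0) (heb 1) hbne
  refine ⟨e, fun h0 => ?_, ?_, hnull⟩
  · obtain ⟨i, hi⟩ := (hp x hx).2.2
    refine hi ?_
    rw [hw, ← hge i, h0]; simp
  · set X := e 0 • pd 0 (meanCurv u) x + e 1 • pd 1 (meanCurv u) x with hX
    have ht : tangentPart u x X = 0 := tangentPart_eq_zero fun l => by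
      rw [hX, nip_add_left, nip_smul_left, nip_smul_left, hu.nip_pd_meanCurv' hx,
        hu.nip_pd_meanCurv' hx]
      have := heb l
      simp only [hb] at this
      linear_combination -this
    have hn : normalPart u x X = 0 := by
      have h0 := hw 0
      have h1 := hw 1
      rw [normalDeriv] at h0 h1
      rw [hX, normalPart_add, normalPart_smul, normalPart_smul, h0, h1, smul_smul, smul_smul,
        ← add_smul, ← hge 0, ← hge 1, metric_symm u x 1 0]
      have : e 0 * (metric u x 0 0 * e 0 + metric u x 0 1 * e 1) +
        e 1 * (metric u x 0 1 * e 0 + metric u x 1 1 * e 1) = 0 := by linear_combination hnull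
      rw [this, zero_smul]
    rw [normalPart, ht, sub_zero] at hn
    exact hn

/-- If `A_H = 0` the second fundamental form takes values in the null line of `H`, so the surface is
flat by the Gauss equation. -/
theorem IsPatch.not_shapeVanishes_of_gaussCurv_ne_zero (hu : IsPatch u W)
    (hp : ∀ x ∈ W, IsProperAt u x) {x : ℝ × ℝ} (hx : x ∈ W) (hK : gaussCurv u x ≠ 0) :
    ¬ ShapeVanishes u x := by
  intro hA
  rw [hu.shapeVanishes_iff hx] at hA
  have hd := hu.det_ne x hx
  rw [metric_det] at hd
  have hc : ∀ i j, ∃ c : ℝ, secondFund u i j x = c • meanCurv u x := fun i j =>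
    exists_smul_of_orthogonal_null hd (hp x hx).1.1 (hp x hx).1.2 (hu.nip_meanCurv hx 0)
      (hu.nip_meanCurv hx 1) (hu.nip_secondFund hx i j 0) (hu.nip_secondFund hx i j 1)
      (by rw [nip_comm]; exact hA i j)
  choose c hc using hc
  refine hK ?_
  rw [hu.gaussCurv_eq hx]
  simp [hc, (hp x hx).1.2]

/-- If a quotient of two components of `H` is the second coordinate, then the first coordinate
lines are null and `H` is constant along them. -/
theorem IsPatch.pd_zero_meanCurv_of_quotient (hu : IsPatch u W) (hp : ∀ x ∈ W, IsProperAt u x)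
    (hA : ∀ x ∈ W, ¬ ShapeVanishes u x) {i j : Fin 4} (hi : ∀ x ∈ W, meanCurv u x i ≠ 0)
    (hj : ∀ x ∈ W, meanCurv u x j = x.2 * meanCurv u x i) {x : ℝ × ℝ} (hx : x ∈ W) :
    pd 0 (meanCurv u) x = 0 ∧ nip (pd 0 u x) (pd 0 u x) = 0 := by
  obtain ⟨e, he, hH, hg⟩ := hu.exists_null_direction hp hx (hA x hx)
  have h0 := ((hu.hasPd_meanCurv hx 0).apply j).eq_of_eqOn
    ((hasPd_snd_zero x).mul ((hu.hasPd_meanCurv hx 0).apply i)) hu.isOpen hx hj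
  have h1 := ((hu.hasPd_meanCurv hx 1).apply j).eq_of_eqOn
    ((hasPd_snd_one x).mul ((hu.hasPd_meanCurv hx 1).apply i)) hu.isOpen hx hj
  have hHi := congrFun hH i
  have hHj := congrFun hH j
  simp only [Pi.add_apply, Pi.smul_apply, smul_eq_mul, Pi.zero_apply] at hHi hHj
  have e1 : e 1 = 0 := by
    have : e 1 * meanCurv u x i = 0 := by
      rw [h0, h1] at hHj
      linear_combination hHj - x.2 * hHi
    exact (mul_eq_zero.1 this).resolve_right (hi x hx)
  have e0 : e 0 ≠ 0 := fun e0 => he (by ext k; fin_cases k <;> assumption)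
  rw [e1] at hH hg
  constructor
  · rw [zero_smul, add_zero] at hH
    exact (smul_eq_zero.1 hH).resolve_left e0
  · have : e 0 * e 0 * metric u x 0 0 = 0 := by linear_combination hg
    exact (mul_eq_zero.1 this).resolve_left (mul_ne_zero e0 e0)

end Kernel

/-! ### Coordinates adapted to the direction of the mean curvature vector -/

section Adapted

/-- The first coordinate lines are null, and `α` is a null normal field, constant along these
lines, which is never parallel in their direction; it is normalized by `αᵢ = 1`, `αⱼ = t`. -/
structure IsAdapted (α u : ℝ × ℝ → E42) (i j : Fin 4) (W : Set (ℝ × ℝ)) : Prop where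
  patch : IsPatch u W
  smooth : ContDiffOn ℝ ∞ α W
  pd_zero : ∀ x ∈ W, pd 0 α x = 0
  null : ∀ x ∈ W, nip (α x) (α x) = 0
  normal : ∀ x ∈ W, ∀ k, nip (α x) (pd k u x) = 0
  coord_i : ∀ x ∈ W, α x i = 1
  coord_j : ∀ x ∈ W, α x j = x.2
  m00 : ∀ x ∈ W, nip (pd 0 u x) (pd 0 u x) = 0
  ne_zero : ∀ x ∈ W, nip (pd 1 α x) (pd 1 u x) ≠ 0

variable {α u : ℝ × ℝ → E42} {i j : Fin 4} {W : Set (ℝ × ℝ)}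

/-- Dividing `H` by one of its components gives the field `α`. -/
theorem IsPatch.isAdapted (hu : IsPatch u W) (hp : ∀ x ∈ W, IsProperAt u x)
    (hA : ∀ x ∈ W, ¬ ShapeVanishes u x) (hi : ∀ x ∈ W, meanCurv u x i ≠ 0)
    (hj : ∀ x ∈ W, meanCurv u x j = x.2 * meanCurv u x i) :
    IsAdapted (fun x => (meanCurv u x i)⁻¹ • meanCurv u x) u i j W := by
  have hH := fun x hx => hu.pd_zero_meanCurv_of_quotient hp hA hi hj (x := x) hx
  have his : ContDiffOn ℝ ∞ (fun x => (meanCurv u x i)⁻¹) W :=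
    (contDiffOn_pi.1 hu.contDiffOn_meanCurv i).inv hi
  have hs := his.smul hu.contDiffOn_meanCurv
  have hn : ∀ x ∈ W, ∀ k, nip ((meanCurv u x i)⁻¹ • meanCurv u x) (pd k u x) = 0 :=
    fun x hx k => by rw [nip_smul_left, hu.nip_meanCurv hx, mul_zero]
  have h0 : ∀ x ∈ W, pd 0 (fun x => (meanCurv u x i)⁻¹ • meanCurv u x) x = 0 := fun x hx => by
    have hd := hu.hasPd_meanCurv hx 0
    rw [(hH x hx).1] at hd
    have h1 := ((hasPd_const 0 (1 : ℝ) x).div (hd.apply i) (hi x hx)).smul hd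
    simp only [one_div] at h1
    rw [h1.2]; simp
  refine ⟨hu, hs, h0, fun x hx => ?_, hn, fun x hx => ?_, fun x hx => ?_, fun x hx => (hH x hx).2,
    fun x hx hz => hA x hx ?_⟩
  · simp [(hp x hx).1.2]
  · simp [hi x hx]
  · simp only [Pi.smul_apply, smul_eq_mul, hj x hx]
    have := hi x hx
    field_simp
  · -- otherwise `∂₁H` would be normal
    have d1 := hasPd_of_contDiffOn 1 his hu.isOpen hx
    have h1 := (d1.smul (hu.hasPd_meanCurv hx 1)).2
    rw [h1, nip_add_left, nip_smul_left, nip_smul_left, hu.nip_meanCurv hx, mul_zero,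
      add_zero] at hz
    have hz := (mul_eq_zero.1 hz).resolve_left (inv_ne_zero (hi x hx))
    rw [hu.nip_pd_meanCurv' hx, neg_eq_zero] at hz
    have hb0 : ∀ l, nip (meanCurv u x) (secondFund u 0 l x) = 0 := fun l => by
      have := hu.nip_pd_meanCurv' hx 0 l
      rw [(hH x hx).1, nip_zero_left] at this
      linarith
    rw [hu.shapeVanishes_iff hx, Fin.forall_fin_two, Fin.forall_fin_two, Fin.forall_fin_two,
      hu.secondFund_symm hx 1 0]
    exact ⟨⟨hb0 0, hb0 1⟩, hb0 1, hz⟩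

namespace IsAdapted

variable (h : IsAdapted α u i j W)
include h

theorem isOpen : IsOpen W := h.patch.isOpen

theorem hasPd {x : ℝ × ℝ} (hx : x ∈ W) (k : Fin 2) : HasPd k α (pd k α x) x :=
  hasPd_of_contDiffOn k h.smooth h.isOpen hx

theorem smooth_pd : ContDiffOn ℝ ∞ (pd 1 α) W := contDiffOn_pd 1 h.smooth h.isOpen

theorem hasPd_pd {x : ℝ × ℝ} (hx : x ∈ W) (k : Fin 2) : HasPd k (pd 1 α) (pd k (pd 1 α) x) x :=
  hasPd_of_contDiffOn k h.smooth_pd h.isOpen hx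

theorem ne {x : ℝ × ℝ} (hx : x ∈ W) : α x ≠ 0 := fun h0 => by
  have := h.coord_i x hx
  rw [h0] at this
  simp at this

theorem pd_zero_one {x : ℝ × ℝ} (hx : x ∈ W) : pd 0 (pd 1 α) x = 0 := by
  rw [pd_comm 0 1 h.smooth h.isOpen hx]
  exact ((hasPd_const 1 (0 : E42) x).congr_of_eqOn h.isOpen hx fun y hy => h.pd_zero y hy).2

theorem pd_one_i {x : ℝ × ℝ} (hx : x ∈ W) : pd 1 α x i = 0 :=
  ((h.hasPd hx 1).apply i).eq_of_eqOn (hasPd_const 1 1 x) h.isOpen hx h.coord_i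

theorem pd_one_j {x : ℝ × ℝ} (hx : x ∈ W) : pd 1 α x j = 1 :=
  ((h.hasPd hx 1).apply j).eq_of_eqOn (hasPd_snd_one x) h.isOpen hx h.coord_j

theorem nip_pd_zero {x : ℝ × ℝ} (hx : x ∈ W) : nip (pd 1 α x) (pd 0 u x) = 0 := by
  have h1 := ((h.hasPd hx 1).nip (h.patch.hasPd_pd hx 1 0)).eq_of_eqOn (hasPd_const 1 0 x)
    h.isOpen hx fun y hy => h.normal y hy 0
  have h2 := ((h.hasPd hx 0).nip (h.patch.hasPd_pd hx 0 1)).eq_of_eqOn (hasPd_const 0 0 x)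
    h.isOpen hx fun y hy => h.normal y hy 1
  rw [h.pd_zero x hx, nip_zero_left, zero_add, h.patch.pd_pd_comm hx] at h2
  linarith

theorem nip_pd_self {x : ℝ × ℝ} (hx : x ∈ W) : nip (pd 1 α x) (α x) = 0 := by
  have h1 := ((h.hasPd hx 1).nip (h.hasPd hx 1)).eq_of_eqOn (hasPd_const 1 0 x)
    h.isOpen hx h.null
  rw [nip_comm (α x)] at h1
  linarith

/-- `∂₁α` lies in the totally null plane spanned by `∂₀u` and `α`. -/
theorem exists_pd_one_eq {x : ℝ × ℝ} (hx : x ∈ W) : ∃ c : ℝ,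
    nip (pd 0 u x) (pd 1 u x) • pd 1 α x = nip (pd 1 α x) (pd 1 u x) • pd 0 u x + c • α x := by
  have hd := h.patch.det_ne x hx
  rw [metric_det] at hd
  obtain ⟨c, hc⟩ := exists_smul_of_orthogonal_null (v := nip (pd 0 u x) (pd 1 u x) • pd 1 α x -
    nip (pd 1 α x) (pd 1 u x) • pd 0 u x) hd (h.ne hx) (h.null x hx) (h.normal x hx 0)
    (h.normal x hx 1) (by simp [h.nip_pd_zero hx, h.m00 x hx]) (by simp; ring)
    (by simp [h.nip_pd_self hx, nip_comm (pd 0 u x), h.normal x hx])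
  exact ⟨c, by rw [← hc]; module⟩

theorem nip_pd_zero_one_ne {x : ℝ × ℝ} (hx : x ∈ W) : nip (pd 0 u x) (pd 1 u x) ≠ 0 := by
  have hd := h.patch.det_ne x hx
  rw [metric_det, h.m00 x hx] at hd
  intro h0
  rw [h0] at hd
  simp at hd

theorem nip_pd_one_pd_one {x : ℝ × ℝ} (hx : x ∈ W) : nip (pd 1 α x) (pd 1 α x) = 0 := by
  obtain ⟨c, hc⟩ := h.exists_pd_one_eq hx
  have h1 := congrArg (fun v => nip (pd 1 α x) v) hc
  simp only [nip_smul_right, nip_add_right, h.nip_pd_zero hx, h.nip_pd_self hx, mul_zero,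
    add_zero] at h1
  exact (mul_eq_zero.1 h1).resolve_left (h.nip_pd_zero_one_ne hx)

theorem nip_pd_pd_self {x : ℝ × ℝ} (hx : x ∈ W) : nip (pd 1 (pd 1 α) x) (α x) = 0 := by
  have h1 := ((h.hasPd_pd hx 1).nip (h.hasPd hx 1)).eq_of_eqOn (hasPd_const 1 0 x)
    h.isOpen hx fun y hy => h.nip_pd_self hy
  rw [h.nip_pd_one_pd_one hx] at h1
  linarith

theorem nip_pd_pd_pd {x : ℝ × ℝ} (hx : x ∈ W) : nip (pd 1 (pd 1 α) x) (pd 1 α x) = 0 := by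
  have h1 := ((h.hasPd_pd hx 1).nip (h.hasPd_pd hx 1)).eq_of_eqOn (hasPd_const 1 0 x)
    h.isOpen hx fun y hy => h.nip_pd_one_pd_one hy
  rw [nip_comm (pd 1 α x)] at h1
  linarith

/-- `⟨∂₁α, ∂₁u⟩` is constant along the first coordinate lines. -/
theorem hasPd_nip {x : ℝ × ℝ} (hx : x ∈ W) :
    HasPd 0 (fun y => nip (pd 1 α y) (pd 1 u y)) 0 x := by
  refine ((h.hasPd_pd hx 0).nip (h.patch.hasPd_pd hx 0 1)).congr_deriv ?_
  have h1 := ((h.hasPd_pd hx 1).nip (h.patch.hasPd_pd hx 1 0)).eq_of_eqOn (hasPd_const 1 0 x)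
    h.isOpen hx fun y hy => h.nip_pd_zero hy
  have h2 : nip (pd 1 (pd 1 α) x) (pd 0 u x) = 0 := by
    obtain ⟨c, hc⟩ := h.exists_pd_one_eq hx
    have h3 := congrArg (fun v => nip (pd 1 (pd 1 α) x) v) hc
    simp only [nip_smul_right, nip_add_right, h.nip_pd_pd_self hx, h.nip_pd_pd_pd hx, mul_zero,
      add_zero] at h3
    exact (mul_eq_zero.1 h3.symm).resolve_left (h.ne_zero x hx)
  rw [h.pd_zero_one hx, nip_zero_left, zero_add, h.patch.pd_pd_comm hx]
  linarith

theorem nip_eq {x : ℝ × ℝ} (hx : x ∈ W) : nip (pd 1 α x) (pd 1 u x) *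
    (pd 0 u x j - x.2 * pd 0 u x i) = nip (pd 0 u x) (pd 1 u x) := by
  obtain ⟨c, hc⟩ := h.exists_pd_one_eq hx
  have hi := congrFun hc i
  have hj := congrFun hc j
  simp only [Pi.add_apply, Pi.smul_apply, smul_eq_mul, h.pd_one_i hx, h.pd_one_j hx,
    h.coord_i x hx, h.coord_j x hx] at hi hj
  linear_combination x.2 * hi - hj

/-- The function `-⟨∂₁α, ∂₁u⟩ (uⱼ - t uᵢ)` has first partial derivative `-⟨∂₀u, ∂₁u⟩`. Taking it as
new first coordinate normalizes this product to `-1`. -/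
theorem hasPd_normalizer {x : ℝ × ℝ} (hx : x ∈ W) (c : ℝ) :
    HasPd 0 (fun y => -(nip (pd 1 α y) (pd 1 u y) * (u y j - y.2 * u y i)) - c)
      (-nip (pd 0 u x) (pd 1 u x)) x := by
  have hu := h.patch.hasPd hx 0
  refine (((h.hasPd_nip hx).mul ((hu.apply j).sub ((hasPd_snd_zero x).mul
    (hu.apply i)))).neg.sub (hasPd_const 0 c x)).congr_deriv ?_
  rw [← h.nip_eq hx]; ring

end IsAdapted

/-- A smooth function on a box, constant in the first coordinate, is a smooth function of the
second one. -/
theorem exists_eq_comp_snd {F : Type*} [NormedAddCommGroup F] [NormedSpace ℝ F]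
    {U : ℝ × ℝ → F} {I J : Set ℝ} (hI : IsOpenInterval I) (hJ : IsOpenInterval J)
    (hU : ContDiffOn ℝ ∞ U (I ×ˢ J)) (h0 : ∀ x ∈ I ×ˢ J, pd 0 U x = 0) (hI0 : (0 : ℝ) ∈ I) :
    ∃ a : ℝ → F, ContDiffOn ℝ ∞ a J ∧ (∀ x ∈ I ×ˢ J, U x = a x.2) ∧
      ∀ x ∈ I ×ˢ J, pd 1 U x = deriv a x.2 := by
  have hs := contDiffOn_slice hU hI0
  have he : ∀ x ∈ I ×ˢ J, U x = U (0, x.2) := fun x hx =>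
    eq_of_pd_zero_eq_zero hI.1 hI.2 hJ.1 hU h0 hx.1 hI0 hx.2
  refine ⟨fun t => U (0, t), hs, he, fun x hx => ?_⟩
  exact ((hasPd_one_comp_snd (x := x) (differentiableAt_of_contDiffOn_real hs hJ.1
    hx.2)).congr_of_eqOn (hI.1.prod hJ.1) hx he).2

end Adapted

/-! ### Explicit form of the surfaces with `A_H ≠ 0` -/

section Integration

variable {α u : ℝ × ℝ → E42} {i j : Fin 4} {W : Set (ℝ × ℝ)} {m : ℝ × ℝ → ℝ}

namespace IsAdapted

variable (h : IsAdapted α u i j W) (hs : IsSemiNull m u W)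
include h hs

theorem pd_zero_eq {x : ℝ × ℝ} (hx : x ∈ W) :
    pd 0 u x = (-1 / nip (pd 1 α x) (pd 1 u x)) • pd 1 α x + pd 0 u x i • α x := by
  obtain ⟨c, hc⟩ := h.exists_pd_one_eq hx
  rw [hs.m01 x hx] at hc
  have hB := h.ne_zero x hx
  have hi := congrFun hc i
  simp only [Pi.add_apply, Pi.smul_apply, smul_eq_mul, h.pd_one_i hx, h.coord_i x hx] at hi
  have hc' : c = -(nip (pd 1 α x) (pd 1 u x) * pd 0 u x i) := by linarith
  rw [hc'] at hc
  have h2 := congrArg (fun v => (nip (pd 1 α x) (pd 1 u x))⁻¹ • v) hc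
  simp only [smul_add, smul_smul, inv_mul_cancel₀ hB, one_smul] at h2
  have h3 : (nip (pd 1 α x) (pd 1 u x))⁻¹ * -(nip (pd 1 α x) (pd 1 u x) * pd 0 u x i) =
    -pd 0 u x i := by field_simp
  rw [h3] at h2
  rw [neg_div, one_div]
  linear_combination (norm := module) (-1 : ℝ) • h2

omit hs in
theorem hasPd_coef {x : ℝ × ℝ} (hx : x ∈ W) :
    HasPd 0 (fun y => -1 / nip (pd 1 α y) (pd 1 u y)) 0 x :=
  ((hasPd_const 0 (-1) x).div (h.hasPd_nip hx) (h.ne_zero x hx)).congr_deriv (by simp)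

theorem pd_zero_zero_eq {x : ℝ × ℝ} (hx : x ∈ W) :
    pd 0 (pd 0 u) x = pd 0 (pd 0 u) x i • α x := by
  have hi := (h.patch.hasPd_pd hx 0 0).apply i
  have hα := h.hasPd hx 0
  have hα1 := h.hasPd_pd hx 0
  rw [h.pd_zero x hx] at hα
  rw [h.pd_zero_one hx] at hα1
  have := (((h.hasPd_coef hx).smul hα1).add (hi.smul hα)).congr_of_eqOn h.isOpen hx
    fun y hy => h.pd_zero_eq hs hy
  conv_lhs => rw [this.2]
  simp

theorem secondFund_zero_one_null (hH : ∀ x ∈ W, meanCurv u x = meanCurv u x i • α x)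
    {x : ℝ × ℝ} (hx : x ∈ W) : nip (secondFund u 0 1 x) (secondFund u 0 1 x) = 0 := by
  have hv : secondFund u 0 1 x =
      (-meanCurv u x i - m x * pd 0 (pd 0 u) x i) • α x := by
    have h1 := hs.meanCurv_eq hx
    rw [vecN, hH x hx, h.pd_zero_zero_eq hs hx] at h1
    rw [hs.secondFund_01 hx]
    linear_combination (norm := module) h1
  rw [hv]; simp [h.null x hx]

/-- Both the Gaussian curvature and `m_{ss}` equal `⟨∂₁α, ∂₁u⟩` times the coefficient of `α` in
`∂₀∂₀u`. -/
theorem gaussCurv_eq (hH : ∀ x ∈ W, meanCurv u x = meanCurv u x i • α x) {x : ℝ × ℝ}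
    (hx : x ∈ W) : gaussCurv u x = pd 0 (pd 0 u) x i * nip (pd 1 α x) (pd 1 u x) := by
  rw [hs.gaussCurv_eq hx, h.secondFund_zero_one_null hs hH hx]
  conv_lhs => rw [h.pd_zero_zero_eq hs hx]
  have h1 := ((h.hasPd hx 1).nip (h.patch.hasPd_pd hx 1 1)).eq_of_eqOn (hasPd_const 1 0 x)
    h.isOpen hx fun y hy => h.normal y hy 1
  rw [nip_smul_left]
  linear_combination (-pd 0 (pd 0 u) x i) * h1

theorem curvM_eq (hH : ∀ x ∈ W, meanCurv u x = meanCurv u x i • α x) {x : ℝ × ℝ}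
    (hx : x ∈ W) : curvM m x = pd 0 (pd 0 u) x i * nip (pd 1 α x) (pd 1 u x) := by
  have d01 : HasPd 0 (pd 0 (pd 1 u)) (pd 0 (pd 0 (pd 1 u)) x) x :=
    hasPd_of_contDiffOn 0 (contDiffOn_pd 0 (h.patch.contDiffOn_pd 1) h.isOpen) h.isOpen hx
  have h1 := (hasPd_of_contDiffOn 0 (contDiffOn_pd 0 hs.contDiffOn_m h.isOpen) h.isOpen
    hx).eq_of_eqOn (d01.nip (h.patch.hasPd_pd hx 0 1)) h.isOpen hx
      fun y hy => (hs.nip_pd01' hy).symm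
  have h2 : nip (pd 0 (pd 1 u) x) (pd 0 (pd 1 u) x) = 0 := by
    have e : pd 0 (pd 1 u) x = secondFund u 0 1 x - pd 0 m x • pd 0 u x := by
      rw [hs.secondFund_01 hx]; module
    rw [e]
    simp [h.secondFund_zero_one_null hs hH hx, hs.m00 x hx, h.patch.nip_secondFund hx,
      nip_comm (pd 0 u x)]
  have h3 : pd 0 (pd 0 (pd 1 u)) x = pd 0 (pd 0 u) x i • pd 1 α x +
      pd 1 (fun y => pd 0 (pd 0 u) y i) x • α x := by
    have d00 := hasPd_of_contDiffOn 1 (contDiffOn_pd 0 (h.patch.contDiffOn_pd 0) h.isOpen)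
      h.isOpen hx
    rw [pd_congr_of_eqOn 0 h.isOpen (fun y hy => h.patch.pd_pd_comm hy 0 1) hx,
      pd_comm 0 1 (h.patch.contDiffOn_pd 0) h.isOpen hx]
    exact (((DifferentiableAt.hasPd (d00.apply i).1 1).smul (h.hasPd hx 1)).congr_of_eqOn
      h.isOpen hx fun y hy => h.pd_zero_zero_eq hs hy).2
  rw [curvM, h1, h2, h3]
  simp [h.normal x hx]

end IsAdapted

/-- A non-flat surface in adapted semi-null coordinates belongs to the third family: with
`A = -1 / ⟨∂₁α, ∂₁u⟩` and `β = (∂₀u)ᵢ` one has `∂₀u = A ∂₁α + β α`, where `A` depends on `t`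
only and `∂₀β = -A ∂₀∂₀m`. Integrating in `s` gives `u`, and `∂₀N = 0` identifies `L`. -/
theorem IsAdapted.familyIII {I J : Set ℝ} (h : IsAdapted α u i j (I ×ˢ J))
    (hs : IsSemiNull m u (I ×ˢ J)) (hI : IsOpenInterval I) (hJ : IsOpenInterval J)
    (hI0 : (0 : ℝ) ∈ I) (hp : ∀ x ∈ I ×ˢ J, IsProperAt u x)
    (hH : ∀ x ∈ I ×ˢ J, meanCurv u x = meanCurv u x i • α x)
    (hH0 : ∀ x ∈ I ×ˢ J, pd 0 (meanCurv u) x = 0) (hK : ∀ x ∈ I ×ˢ J, gaussCurv u x ≠ 0) :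
    FamilyIII u (I ×ˢ J) := by
  have hW := h.isOpen
  have hm := hs.contDiffOn_m
  have hκ : ContDiffOn ℝ ∞ (curvM m) (I ×ˢ J) := contDiffOn_pd 0 (contDiffOn_pd 0 hm hW) hW
  have hκ0 : ∀ x ∈ I ×ˢ J, curvM m x ≠ 0 := fun x hx => by
    rw [h.curvM_eq hs hH hx, ← h.gaussCurv_eq hs hH hx]; exact hK x hx
  set A : ℝ × ℝ → ℝ := fun y => -1 / nip (pd 1 α y) (pd 1 u y) with hA
  have hAs : ContDiffOn ℝ ∞ A (I ×ˢ J) :=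
    contDiffOn_const.div (contDiffOn_nip h.smooth_pd (h.patch.contDiffOn_pd 1)) h.ne_zero
  have hA0 : ∀ x ∈ I ×ˢ J, pd 0 A x = 0 := fun x hx => (h.hasPd_coef hx).2
  have hAB : ∀ x ∈ I ×ˢ J, A x * nip (pd 1 α x) (pd 1 u x) = -1 := fun x hx => by
    have := h.ne_zero x hx
    simp only [hA]; field_simp
  have hAne : ∀ x ∈ I ×ˢ J, A x ≠ 0 := fun x hx h0 => by
    have := hAB x hx
    rw [h0] at this; norm_num at this
  set β : ℝ × ℝ → ℝ := fun y => pd 0 u y i with hβ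
  have hβs : ContDiffOn ℝ ∞ β (I ×ˢ J) := contDiffOn_pi.1 (h.patch.contDiffOn_pd 0) i
  have dA := fun k x (hx : x ∈ I ×ˢ J) => hasPd_of_contDiffOn k hAs hW hx
  have dβ := fun k x (hx : x ∈ I ×ˢ J) => hasPd_of_contDiffOn k hβs hW hx
  have dm := fun k x (hx : x ∈ I ×ˢ J) => hasPd_of_contDiffOn k hm hW hx
  have dms := fun k x (hx : x ∈ I ×ˢ J) => hasPd_of_contDiffOn k (contDiffOn_pd 0 hm hW) hW hx
  have dα := fun k x (hx : x ∈ I ×ˢ J) => h.hasPd hx k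
  have dα1 := fun k x (hx : x ∈ I ×ˢ J) => h.hasPd_pd hx k
  have hβ0 : ∀ x ∈ I ×ˢ J, pd 0 β x = -(A x * curvM m x) := fun x hx => by
    have e : pd 0 β x = pd 0 (pd 0 u) x i := ((h.patch.hasPd_pd hx 0 0).apply i).2
    rw [e, h.curvM_eq hs hH hx]
    linear_combination (pd 0 (pd 0 u) x i) * hAB x hx
  have hu0 : ∀ x ∈ I ×ˢ J, pd 0 u x = A x • pd 1 α x + β x • α x :=
    fun x hx => h.pd_zero_eq hs hx
  -- `c = A' - A L`, and `E` will be the curve `η`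
  set c : ℝ × ℝ → ℝ := fun y => β y + A y * pd 0 m y with hc
  have hcs : ContDiffOn ℝ ∞ c (I ×ˢ J) := hβs.add (hAs.mul (contDiffOn_pd 0 hm hW))
  have hc0 : ∀ x ∈ I ×ˢ J, pd 0 c x = 0 := fun x hx => by
    rw [((dβ 0 x hx).add ((dA 0 x hx).mul (dms 0 x hx))).2, hA0 x hx, hβ0 x hx, curvM]; ring
  set E : ℝ × ℝ → E42 := fun y =>
    u y + (A y * m y) • α y - (y.1 * A y) • pd 1 α y - (y.1 * c y) • α y with hE
  have dc := fun k x (hx : x ∈ I ×ˢ J) => hasPd_of_contDiffOn k hcs hW hx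
  have hEs : ContDiffOn ℝ ∞ E (I ×ˢ J) :=
    ((h.patch.smooth.add ((hAs.mul hm).smul h.smooth)).sub
      ((contDiff_fst.contDiffOn.mul hAs).smul h.smooth_pd)).sub
      ((contDiff_fst.contDiffOn.mul hcs).smul h.smooth)
  have hE0 : ∀ x ∈ I ×ˢ J, pd 0 E x = 0 := fun x hx => by
    have := (((h.patch.hasPd hx 0).add (((dA 0 x hx).mul (dm 0 x hx)).smul (dα 0 x hx))).sub
      (((hasPd_fst_zero x).mul (dA 0 x hx)).smul (dα1 0 x hx))).sub
      (((hasPd_fst_zero x).mul (dc 0 x hx)).smul (dα 0 x hx))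
    rw [this.2, hA0 x hx, hc0 x hx, h.pd_zero x hx, h.pd_zero_one hx, hu0 x hx, hc]
    module
  have hE1 : ∀ x ∈ I ×ˢ J, x.1 = 0 → pd 1 E x = pd 1 u x +
      (A x * pd 1 m x + pd 1 A x * m x) • α x + (A x * m x) • pd 1 α x := fun x hx hx0 => by
    have := (((h.patch.hasPd hx 1).add (((dA 1 x hx).mul (dm 1 x hx)).smul (dα 1 x hx))).sub
      (((hasPd_fst_one x).mul (dA 1 x hx)).smul (dα1 1 x hx))).sub
      (((hasPd_fst_one x).mul (dc 1 x hx)).smul (dα 1 x hx))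
    rw [this.2, hx0]
    module
  obtain ⟨a, has, hAa, hAa'⟩ := exists_eq_comp_snd hI hJ hAs hA0 hI0
  obtain ⟨l, hls, hcl, -⟩ := exists_eq_comp_snd hI hJ hcs hc0 hI0
  obtain ⟨γ, hγs, hαγ, hαγ'⟩ := exists_eq_comp_snd hI hJ h.smooth h.pd_zero hI0
  obtain ⟨η, hηs, hEη, hEη'⟩ := exists_eq_comp_snd hI hJ hEs hE0 hI0
  have hγ' := ContDiffOn.deriv_isOpen hγs hJ.1
  have hαγ'' : ∀ x ∈ I ×ˢ J, pd 1 (pd 1 α) x = deriv (deriv γ) x.2 := fun x hx =>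
    ((hasPd_one_comp_snd (x := x) (differentiableAt_of_contDiffOn_real hγ' hJ.1
      hx.2)).congr_of_eqOn hW hx hαγ').2
  have hmem : ∀ t ∈ J, ((0 : ℝ), t) ∈ I ×ˢ J := fun t ht => ⟨hI0, ht⟩
  have ha0 : ∀ t ∈ J, a t ≠ 0 := fun t ht => by
    rw [← hAa _ (hmem t ht)]; exact hAne _ (hmem t ht)
  have hmu : ∀ x ∈ I ×ˢ J, A x * nip (pd 1 (pd 1 α) x) (pd 1 u x) =
      pd 0 m x - (pd 1 A x + β x) * nip (pd 1 α x) (pd 1 u x) := fun x hx => by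
    have h1 := ((((dA 1 x hx).smul (dα1 1 x hx)).add ((dβ 1 x hx).smul (dα 1 x hx))).congr_of_eqOn
      hW hx hu0).2
    rw [← h.patch.pd_pd_comm hx] at h1
    rw [← hs.nip_pd01' hx, h1]
    simp only [nip_add_left, nip_smul_left, h.normal x hx]
    ring
  have hN : EqOn (vecN m u) (fun q => -meanCurv u q) (I ×ˢ J) := fun q hq => by
    show _ = -meanCurv u q
    rw [hs.meanCurv_eq hq, neg_neg]
  have hL : ∀ x ∈ I ×ˢ J, funL m x = (pd 1 A x - c x) / A x := fun x hx => by
    -- the `i`-th component of `∂₀ vecN = 0`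
    have hNi : EqOn (fun q => -meanCurv u q i)
        (fun q => pd 1 β q + m q * pd 0 β q + pd 0 m q * β q) (I ×ˢ J) := fun q hq => by
      have e0 : pd 0 β q = pd 0 (pd 0 u) q i := ((h.patch.hasPd_pd hq 0 0).apply i).2
      have e1 : pd 1 β q = pd 0 (pd 1 u) q i := by
        rw [h.patch.pd_pd_comm hq]; exact ((h.patch.hasPd_pd hq 1 0).apply i).2
      have := congrFun (hN hq) i
      simp only [Pi.neg_apply] at this
      show -meanCurv u q i = pd 1 β q + m q * pd 0 β q + pd 0 m q * β q
      rw [← this, e0, e1]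
      simp only [vecN, Pi.add_apply, Pi.smul_apply, smul_eq_mul, hβ]
    have dκ := fun k => hasPd_of_contDiffOn k hκ hW hx
    have hβ0s := hasPd_of_contDiffOn 0 (contDiffOn_pd 0 hβs hW) hW hx
    have hβ1s := hasPd_of_contDiffOn 0 (contDiffOn_pd 1 hβs hW) hW hx
    have h1 := ((h.patch.hasPd_meanCurv hx 0).apply i).neg.eq_of_eqOn
      ((hβ1s.add ((dm 0 x hx).mul hβ0s)).add ((dms 0 x hx).mul (dβ 0 x hx))) hW hx hNi
    have h2 : pd 0 (pd 1 β) x = -(A x * pd 1 (curvM m) x + pd 1 A x * curvM m x) := by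
      rw [pd_comm 0 1 hβs hW hx]
      exact (((dA 1 x hx).mul (dκ 1)).neg.congr_of_eqOn hW hx hβ0).2
    have h3 : pd 0 (pd 0 β) x = -(A x * pd 0 (curvM m) x + pd 0 A x * curvM m x) :=
      (((dA 0 x hx).mul (dκ 0)).neg.congr_of_eqOn hW hx hβ0).2
    rw [hH0 x hx, h2, h3, hA0 x hx, hβ0 x hx] at h1
    have e : pd 0 (pd 0 m) x = curvM m x := rfl
    rw [e] at h1
    simp only [Pi.zero_apply] at h1
    rw [funL, neg_eq_iff_eq_neg, div_eq_iff (hκ0 x hx), hc]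
    have := hAne x hx
    field_simp
    linear_combination h1
  refine ⟨I, J, m, fun t => (deriv a t - l t) / a t, a, γ, η, hI, hJ, rfl, hm, hκ0,
    fun x hx => by rw [hL x hx, hAa' x hx, hAa x hx, hcl x hx], has, ha0, hγs, hηs,
    fun t ht => ?_, fun t ht => ⟨fun h0 => ?_, ?_⟩, fun t ht => ?_, fun t ht => ?_, fun t ht => ?_,
    fun t ht => ?_, fun t ht => ?_, fun x hx => ?_, fun x hx => ?_, fun x hx => ?_⟩
  · rw [← hαγ _ (hmem t ht)]; exact h.null _ (hmem t ht)
  · have := h.pd_one_j (hmem t ht)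
    rw [hαγ' _ (hmem t ht), h0] at this
    simp at this
  · rw [← hαγ' _ (hmem t ht)]; exact h.nip_pd_one_pd_one (hmem t ht)
  · rw [← hαγ _ (hmem t ht), ← hαγ' _ (hmem t ht), LinearIndependent.pair_iff]
    intro r r' hr
    have hi := congrFun hr i
    have hj := congrFun hr j
    simp only [Pi.add_apply, Pi.smul_apply, smul_eq_mul, Pi.zero_apply, h.coord_i _ (hmem t ht),
      h.coord_j _ (hmem t ht), h.pd_one_i (hmem t ht), h.pd_one_j (hmem t ht)] at hi hj
    have hr0 : r = 0 := by linarith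
    refine ⟨hr0, ?_⟩
    rw [hr0] at hj; linarith
  · rw [← hEη' _ (hmem t ht), hE1 _ (hmem t ht) rfl]
    simp only [nip_add_left, nip_add_right, nip_smul_left, nip_smul_right, h.null _ (hmem t ht),
      h.normal _ (hmem t ht), nip_comm (pd 1 u _) (α _), nip_comm (pd 1 u _) (pd 1 α _),
      h.nip_pd_self (hmem t ht), nip_comm (α _) (pd 1 α _), h.nip_pd_one_pd_one (hmem t ht),
      hs.m11 _ (hmem t ht)]
    linear_combination 2 * m (0, t) * hAB _ (hmem t ht)
  · rw [← hEη' _ (hmem t ht), ← hαγ _ (hmem t ht), hE1 _ (hmem t ht) rfl]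
    simp [h.null _ (hmem t ht), h.normal _ (hmem t ht), h.nip_pd_self (hmem t ht),
      nip_comm (α _) (pd 1 α _)]
  · rw [← hEη' _ (hmem t ht), ← hαγ' _ (hmem t ht), ← hAa _ (hmem t ht), hE1 _ (hmem t ht) rfl]
    simp only [nip_add_left, nip_smul_left, nip_comm (pd 1 u _) (pd 1 α _),
      h.nip_pd_self (hmem t ht), nip_comm (α _) (pd 1 α _), h.nip_pd_one_pd_one (hmem t ht)]
    have h1 := hAB _ (hmem t ht)
    have h2 := hAne _ (hmem t ht)
    field_simp
    linear_combination h1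
  · have h1 := hmu _ (hmem t ht)
    have h2 := hAB _ (hmem t ht)
    have h3 := ha0 t ht
    rw [← hEη' _ (hmem t ht), ← hαγ'' _ (hmem t ht), hE1 _ (hmem t ht) rfl]
    simp only [nip_add_left, nip_smul_left, nip_comm (pd 1 u _) (pd 1 (pd 1 α) _),
      h.nip_pd_pd_self (hmem t ht), nip_comm (α _) (pd 1 (pd 1 α) _),
      h.nip_pd_pd_pd (hmem t ht), nip_comm (pd 1 α _) (pd 1 (pd 1 α) _)]
    rw [hAa' _ (hmem t ht), hAa _ (hmem t ht)] at h1
    rw [hAa _ (hmem t ht)] at h2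
    have h4 : l t = β (0, t) + a t * pd 0 m (0, t) := by
      rw [← hcl _ (hmem t ht), ← hAa _ (hmem t ht)]
    rw [h4]
    field_simp
    linear_combination a t * h1 - (deriv a t + β (0, t)) * h2
  · have h3 := ha0 _ hx.2
    rw [← hEη _ hx, ← hαγ _ hx, ← hαγ' _ hx, hE]
    simp only [hAa x hx, hcl x hx]
    have : x.1 * deriv a x.2 - a x.2 * (m x + x.1 * ((deriv a x.2 - l x.2) / a x.2)) =
      x.1 * l x.2 - a x.2 * m x := by field_simp; ring
    rw [this]
    module
  · rw [hN hx]; exact neg_ne_zero.2 (hp x hx).1.1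
  · have h1 := hs.linearIndependent_of_isProperAt hH0 hx (hp x hx)
    have h2 := ((h.patch.hasPd_meanCurv hx 1).neg.congr_of_eqOn hW hx hN).2
    rw [h2]
    rw [LinearIndependent.pair_iff] at h1 ⊢
    intro r r' hr
    have := h1 r (-r') (by rw [← hr]; simp)
    exact ⟨this.1, by linarith [this.2]⟩

/-- A surface which is null ruled along the first of two null coordinates, with mean curvature
vector constant along the rulings, belongs to the second family, up to exchanging the
coordinates. -/
theorem IsSemiNull.familyII {v : ℝ × ℝ → E42} {I J : Set ℝ}
    (hs : IsSemiNull (fun _ => 0) v (I ×ˢ J)) (hI : IsOpenInterval I) (hJ : IsOpenInterval J)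
    (hI0 : (0 : ℝ) ∈ I) (hp : ∀ x ∈ I ×ˢ J, IsProperAt v x)
    (hv : ∀ x ∈ I ×ˢ J, pd 0 (pd 0 v) x = 0)
    (hH0 : ∀ x ∈ I ×ˢ J, pd 0 (meanCurv v) x = 0) : FamilyII (v ∘ Prod.swap) (J ×ˢ I) := by
  have hW := hs.isOpen
  have hv0s := hs.isPatch.contDiffOn_pd 0
  have hws : ContDiffOn ℝ ∞ (fun q => v q - q.1 • pd 0 v q) (I ×ˢ J) :=
    hs.smooth.sub (contDiff_fst.contDiffOn.smul hv0s)
  obtain ⟨z, hzs, hz, hz'⟩ := exists_eq_comp_snd hI hJ hv0s hv hI0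
  obtain ⟨w, hws', hw, hw'⟩ := exists_eq_comp_snd hI hJ hws (fun x hx => by
    rw [((hs.isPatch.hasPd hx 0).sub ((hasPd_fst_zero x).smul (hs.isPatch.hasPd_pd hx 0 0))).2,
      hv x hx]
    simp) hI0
  have hzs' := ContDiffOn.deriv_isOpen hzs hJ.1
  have hz'' : ∀ x ∈ I ×ˢ J, pd 1 (pd 1 (pd 0 v)) x = deriv (deriv z) x.2 := fun x hx =>
    ((hasPd_one_comp_snd (x := x) (differentiableAt_of_contDiffOn_real hzs' hJ.1
      hx.2)).congr_of_eqOn hW hx hz').2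
  have hw1 : ∀ x ∈ I ×ˢ J, x.1 = 0 → pd 1 v x = deriv w x.2 := fun x hx hx0 => by
    rw [← hw' x hx, ((hs.isPatch.hasPd hx 1).sub ((hasPd_fst_one x).smul
      (hs.isPatch.hasPd_pd hx 1 0))).2, hx0]
    simp
  have c0 : ∀ x, pd 0 (fun _ : ℝ × ℝ => (0 : ℝ)) x = 0 := fun x => (hasPd_const 0 0 x).2
  have hHz : EqOn (meanCurv v) (fun q => -pd 1 (pd 0 v) q) (I ×ˢ J) := fun q hq => by
    rw [hs.meanCurv_eq hq, vecN, c0, hs.isPatch.pd_pd_comm hq]; simp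
  have hmem : ∀ t ∈ J, ((0 : ℝ), t) ∈ I ×ˢ J := fun t ht => ⟨hI0, ht⟩
  refine ⟨J, I, z, w, hJ, hI, rfl, hzs, hws', fun t ht => ?_, fun t ht => ⟨fun h0 => ?_, ?_⟩,
    fun t ht => ⟨fun h0 => ?_, ?_⟩, fun t ht => ?_, fun t ht => ?_, fun t ht => ?_, fun x hx => ?_⟩
  · rw [← hz _ (hmem t ht)]; exact hs.m00 _ (hmem t ht)
  · refine (hp _ (hmem t ht)).1.1 ?_
    rw [hHz (hmem t ht)]
    simp only
    rw [hz' _ (hmem t ht), h0, neg_zero]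
  · have := (hp _ (hmem t ht)).1.2
    rw [hHz (hmem t ht)] at this
    simp only [nip_neg_left, nip_neg_right, neg_neg] at this
    rwa [hz' _ (hmem t ht)] at this
  · have := hs.m01 _ (hmem t ht)
    rw [hw1 _ (hmem t ht) rfl, h0, nip_zero_right] at this
    norm_num at this
  · have := hs.m11 _ (hmem t ht)
    rwa [hw1 _ (hmem t ht) rfl, mul_zero] at this
  · have := hs.nip_pd01' (hmem t ht)
    rwa [c0, hs.isPatch.pd_pd_comm (hmem t ht), hz' _ (hmem t ht), hw1 _ (hmem t ht) rfl] at this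
  · have := hs.m01 _ (hmem t ht)
    rwa [hw1 _ (hmem t ht) rfl, hz _ (hmem t ht)] at this
  · have h1 := hs.linearIndependent_of_isProperAt hH0 (hmem t ht) (hp _ (hmem t ht))
    have d := hasPd_of_contDiffOn 1 (contDiffOn_pd 1 hv0s hW) hW (hmem t ht)
    rw [(d.neg.congr_of_eqOn hW (hmem t ht) hHz).2, hz'' _ (hmem t ht), hz _ (hmem t ht)] at h1
    rw [LinearIndependent.pair_iff] at h1 ⊢
    intro r r' hr
    have := h1 r (-r') (by rw [← hr]; simp)
    exact ⟨this.1, by linarith [this.2]⟩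
  · have hx' : (x.2, x.1) ∈ I ×ˢ J := ⟨hx.2, hx.1⟩
    show v (x.2, x.1) = _
    have h1 := hw _ hx'
    have h2 := hz _ hx'
    simp only at h1 h2
    rw [← h1, ← h2]
    simp

end Integration

/-! ### Local classification where `A_H ≠ 0` -/

section Classification

theorem hasPd_prodMk {σ τ : ℝ × ℝ → ℝ} {x : ℝ × ℝ} {k : Fin 2} {a b : ℝ} (hσ : HasPd k σ a x)
    (hτ : HasPd k τ b x) : HasPd k (fun y => (σ y, τ y)) (a, b) x :=
  (hasPd_of_hasFDerivAt (hσ.hasFDerivAt.prodMk hτ.hasFDerivAt) k).congr_deriv (by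
    rw [← hσ.2, ← hτ.2]; rfl)

theorem jac_prodMk {σ τ : ℝ × ℝ → ℝ} {x : ℝ × ℝ} {a₀ a₁ b₀ b₁ : ℝ} (h0 : HasPd 0 σ a₀ x)
    (h1 : HasPd 1 σ a₁ x) (k0 : HasPd 0 τ b₀ x) (k1 : HasPd 1 τ b₁ x) :
    jac (fun y => (σ y, τ y)) x = !![a₀, a₁; b₀, b₁] := by
  ext a i
  fin_cases a <;> fin_cases i <;>
    simp [jac, (hasPd_prodMk h0 k0).2, (hasPd_prodMk h1 k1).2]

theorem jac_swap (x : ℝ × ℝ) : jac Prod.swap x = !![0, 1; 1, 0] :=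
  jac_prodMk (hasPd_snd_zero x) (hasPd_snd_one x) (hasPd_fst_zero x) (hasPd_fst_one x)

theorem exists_antideriv {J : Set ℝ} (hJ : IsOpenInterval J) {t₀ : ℝ} (ht₀ : t₀ ∈ J) {h : ℝ → ℝ}
    (hh : ContDiffOn ℝ ∞ h J) :
    ∃ G : ℝ → ℝ, ContDiffOn ℝ ∞ G J ∧ G t₀ = 0 ∧ ∀ t ∈ J, HasDerivAt G (h t) t := by
  have hd : ∀ t ∈ J, HasDerivAt (fun t => ∫ r in t₀..t, h r) (h t) t := fun t ht => by
    refine intervalIntegral.integral_hasDerivAt_right ?_ ?_ (hh.continuousOn.continuousAt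
      (hJ.1.mem_nhds ht))
    · exact (hh.continuousOn.mono (hJ.2.uIcc_subset ht₀ ht)).intervalIntegrable
    · exact hh.continuousOn.stronglyMeasurableAtFilter hJ.1 t ht
  refine ⟨fun t => ∫ r in t₀..t, h r, ?_, intervalIntegral.integral_same, hd⟩
  rw [contDiffOn_infty_iff_deriv_of_isOpen hJ.1]
  exact ⟨fun t ht => (hd t ht).differentiableAt.differentiableWithinAt,
    hh.congr fun t ht => (hd t ht).deriv⟩

variable {M : Type*} [TopologicalSpace M] [ChartedSpace (ℝ × ℝ) M] {f : M → E42} {p : M}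

theorem locallyCongruentTo_of_chart {Fam : (ℝ × ℝ → E42) → Set (ℝ × ℝ) → Prop}
    {φ : OpenPartialHomeomorph M (ℝ × ℝ)} (hφ : φ ∈ IsManifold.maximalAtlas 𝓘(ℝ, ℝ × ℝ) ∞ M)
    (hp : p ∈ φ.source) (h : Fam (f ∘ φ.symm) φ.target) : LocallyCongruentTo Fam f p :=
  ⟨φ, hφ, hp, id, ⟨LinearMap.id, 0, fun _ _ => rfl, fun x => by simp⟩, f ∘ φ.symm, h,
    fun q hq => by simp [φ.left_inv hq]⟩

variable [IsManifold 𝓘(ℝ, ℝ × ℝ) ∞ M]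

/-- Where `A_H ≠ 0` a quotient of components of `H` may be taken as a coordinate. -/
theorem exists_quotient_chart (hf : IsSurface f) (hp : ∀ p, IsProperAt (rep f p) (coord p))
    {O : Set M} (hO : IsOpen O) (hpO : p ∈ O) (hA : ∀ q ∈ O, ¬ ShapeHVanishesAt f q) :
    ∃ φ ∈ IsManifold.maximalAtlas 𝓘(ℝ, ℝ × ℝ) ∞ M, p ∈ φ.source ∧ ∃ i j : Fin 4,
      ∀ x ∈ φ.target, φ.symm x ∈ O ∧ meanCurv (f ∘ φ.symm) x i ≠ 0 ∧
        meanCurv (f ∘ φ.symm) x j = x.2 * meanCurv (f ∘ φ.symm) x i := by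
  obtain ⟨φ, hφ, hps⟩ := exists_mem_maximalAtlas p
  have hu := isPatch_of_isSurface hf hφ
  have hpu := isProperAt_of_mem_atlas hf hp hφ
  set u := f ∘ φ.symm with hudef
  have hx₀ := φ.map_source hps
  obtain ⟨i, hi⟩ : ∃ i, meanCurv u (φ p) i ≠ 0 := by
    by_contra! hcon
    exact (hpu _ hx₀).1.1 (by ext k; exact hcon k)
  have hsh : ¬ ShapeVanishes u (φ p) := by
    rw [← shapeHVanishesAt_iff hf hφ hps]; exact hA p hpO
  obtain ⟨l, hl⟩ : ∃ l, tangentPart u (φ p) (pd l (meanCurv u) (φ p)) ≠ 0 := by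
    by_contra! hcon
    exact hsh fun l => by rw [shapeOp, hcon, neg_zero]
  -- since `∂ₗH` is not normal it is not proportional to `H`
  obtain ⟨j, hj⟩ : ∃ j, pd l (meanCurv u) (φ p) j * meanCurv u (φ p) i -
      meanCurv u (φ p) j * pd l (meanCurv u) (φ p) i ≠ 0 := by
    by_contra! hcon
    refine hl ?_
    have : pd l (meanCurv u) (φ p) =
        (pd l (meanCurv u) (φ p) i / meanCurv u (φ p) i) • meanCurv u (φ p) := by
      ext k
      rw [Pi.smul_apply, smul_eq_mul]
      field_simp
      linear_combination hcon k
    rw [this]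
    exact tangentPart_eq_zero fun k => by rw [nip_smul_left, hu.nip_meanCurv hx₀, mul_zero]
  have hHs := contDiffOn_pi.1 hu.contDiffOn_meanCurv
  set W := (φ.target ∩ φ.symm ⁻¹' O) ∩ (φ.target ∩ (fun x => meanCurv u x i) ⁻¹' {0}ᶜ) with hW
  have hWo : IsOpen W := (φ.isOpen_inter_preimage_symm hO).inter
    ((hHs i).continuousOn.isOpen_inter_preimage φ.open_target isOpen_compl_singleton)
  have hWφ : W ⊆ φ.target := fun x hx => hx.1.1
  have hpW : φ p ∈ W := ⟨⟨hx₀, by simpa [φ.left_inv hps] using hpO⟩, hx₀, hi⟩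
  set τ : ℝ × ℝ → ℝ := fun x => meanCurv u x j / meanCurv u x i with hτ
  have hτs : ContDiffOn ℝ ∞ τ W := ((hHs j).mono hWφ).div ((hHs i).mono hWφ) fun x hx => hx.2.2
  have hτl : HasPd l τ _ (φ p) :=
    ((hu.hasPd_meanCurv hx₀ l).apply j).div ((hu.hasPd_meanCurv hx₀ l).apply i) hi
  have hτl0 := div_ne_zero hj (pow_ne_zero 2 hi)
  have dτ := fun k => hasPd_of_contDiffOn k hτs hWo hpW
  rw [← hτl.2] at hτl0
  obtain ⟨σ, hσs, hdet⟩ : ∃ σ : ℝ × ℝ → ℝ, ContDiffOn ℝ ∞ σ W ∧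
      (jac (fun y => (σ y, τ y)) (φ p)).det ≠ 0 := by
    fin_cases l
    · refine ⟨fun x => x.2, contDiff_snd.contDiffOn, ?_⟩
      rw [jac_prodMk (hasPd_snd_zero _) (hasPd_snd_one _) (dτ 0) (dτ 1), Matrix.det_fin_two_of]
      simpa using hτl0
    · refine ⟨fun x => x.1, contDiff_fst.contDiffOn, ?_⟩
      rw [jac_prodMk (hasPd_fst_zero _) (hasPd_fst_one _) (dτ 0) (dτ 1), Matrix.det_fin_two_of]
      simpa using hτl0
  obtain ⟨φ', hφ', hps', -, -, O', hO'W, hr, hsurj, hsymm⟩ :=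
    exists_chart hφ hps hWo hWφ hpW (hσs.prodMk hτs) hdet
  refine ⟨φ', hφ', hps', i, j, fun y hy => ?_⟩
  obtain ⟨x, hx, rfl⟩ := hsurj y hy
  have hxW := hO'W hx
  have hH : meanCurv u x = meanCurv (f ∘ φ'.symm) (σ x, τ x) := by
    rw [meanCurv_congr hr.isOpen (v := (f ∘ φ'.symm) ∘ fun y => (σ y, τ y))
      (fun q hq => by simp [hudef, hsymm q hq]) hx,
      (isPatch_of_isSurface hf hφ').meanCurv_comp hr hx]
  have hi' : meanCurv u x i ≠ 0 := hxW.2.2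
  rw [← hH, hsymm x hx]
  refine ⟨hxW.1.2, hi', ?_⟩
  simp only [hτ]; field_simp

/-- Semi-null coordinates adapted to `H`, around a point where `A_H ≠ 0`. -/
theorem exists_adapted_chart (hf : IsSurface f) (hp : ∀ p, IsProperAt (rep f p) (coord p))
    {O : Set M} (hO : IsOpen O) (hpO : p ∈ O) (hA : ∀ q ∈ O, ¬ ShapeHVanishesAt f q) :
    ∃ φ ∈ IsManifold.maximalAtlas 𝓘(ℝ, ℝ × ℝ) ∞ M, p ∈ φ.source ∧ (φ p).1 = 0 ∧
      (∃ I J : Set ℝ, IsOpenInterval I ∧ IsOpenInterval J ∧ φ.target = I ×ˢ J) ∧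
      (∀ x ∈ φ.target, φ.symm x ∈ O) ∧ ∃ (α : ℝ × ℝ → E42) (m : ℝ × ℝ → ℝ) (i j : Fin 4),
        IsAdapted α (f ∘ φ.symm) i j φ.target ∧ IsSemiNull m (f ∘ φ.symm) φ.target ∧
        (∀ x ∈ φ.target,
          meanCurv (f ∘ φ.symm) x = meanCurv (f ∘ φ.symm) x i • α x) ∧
        ∀ x ∈ φ.target, pd 0 (meanCurv (f ∘ φ.symm)) x = 0 := by
  obtain ⟨φ, hφ, hps, i, j, hφt⟩ := exists_quotient_chart hf hp hO hpO hA
  have hshape : ∀ φ ∈ IsManifold.maximalAtlas 𝓘(ℝ, ℝ × ℝ) ∞ M, ∀ x ∈ φ.target, φ.symm x ∈ O →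
      ¬ ShapeVanishes (f ∘ φ.symm) x := fun φ hφ x hx hxO h => by
    refine hA _ hxO ((shapeHVanishesAt_iff hf hφ (φ.map_target hx)).2 ?_)
    rwa [φ.right_inv hx]
  have hu := isPatch_of_isSurface hf hφ
  have had := hu.isAdapted (isProperAt_of_mem_atlas hf hp hφ)
    (fun x hx => hshape φ hφ x hx (hφt x hx).1) (fun x hx => (hφt x hx).2.1)
    (fun x hx => (hφt x hx).2.2)
  set u := f ∘ φ.symm with hudef
  set α := fun x => (meanCurv u x i)⁻¹ • meanCurv u x with hα
  have hx₀ := φ.map_source hps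
  obtain ⟨σ, hσ⟩ : ∃ σ : ℝ × ℝ → ℝ, σ = fun y =>
      -(nip (pd 1 α y) (pd 1 u y) * (u y j - y.2 * u y i)) -
      -(nip (pd 1 α (φ p)) (pd 1 u (φ p)) * (u (φ p) j - (φ p).2 * u (φ p) i)) := ⟨_, rfl⟩
  have hσs : ContDiffOn ℝ ∞ σ φ.target := by
    rw [hσ]
    have hc := contDiffOn_pi.1 hu.smooth
    exact ((contDiffOn_nip had.smooth_pd (hu.contDiffOn_pd 1)).mul
      ((hc j).sub (contDiff_snd.contDiffOn.mul (hc i)))).neg.sub contDiffOn_const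
  have dσ0 : ∀ x ∈ φ.target, HasPd 0 σ (-nip (pd 0 u x) (pd 1 u x)) x := fun x hx => by
    rw [hσ]; exact had.hasPd_normalizer hx _
  have hjac : ∀ x ∈ φ.target, jac (fun y => (σ y, y.2)) x =
      !![-nip (pd 0 u x) (pd 1 u x), pd 1 σ x; 0, 1] := fun x hx =>
    jac_prodMk (dσ0 x hx) (hasPd_of_contDiffOn 1 hσs φ.open_target hx) (hasPd_snd_zero x)
      (hasPd_snd_one x)
  have hdet : (jac (fun y => (σ y, y.2)) (φ p)).det ≠ 0 := by
    rw [hjac _ hx₀, Matrix.det_fin_two_of]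
    simpa using had.nip_pd_zero_one_ne hx₀
  obtain ⟨φ', hφ', hps', hφp, hbox, O', hO'W, hr, hsurj, hsymm⟩ :=
    exists_chart hφ hps φ.open_target subset_rfl hx₀ (hσs.prodMk contDiff_snd.contDiffOn) hdet
  have hu' := isPatch_of_isSurface hf hφ'
  have heq : EqOn u ((f ∘ φ'.symm) ∘ fun y => (σ y, y.2)) O' :=
    fun q hq => by simp [hudef, hsymm q hq]
  have hH : ∀ x ∈ O', meanCurv u x = meanCurv (f ∘ φ'.symm) (σ x, x.2) := fun x hx => by
    rw [meanCurv_congr hr.isOpen heq hx, hu'.meanCurv_comp hr hx]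
  have hO' : ∀ y ∈ φ'.target, φ'.symm y ∈ O := fun y hy => by
    obtain ⟨x, hx, rfl⟩ := hsurj y hy
    rw [hsymm x hx]; exact (hφt x (hO'W hx)).1
  have hsh' : ∀ y ∈ φ'.target, ¬ ShapeVanishes (f ∘ φ'.symm) y :=
    fun y hy => hshape φ' hφ' y hy (hO' y hy)
  have hi' : ∀ y ∈ φ'.target, meanCurv (f ∘ φ'.symm) y i ≠ 0 := fun y hy => by
    obtain ⟨x, hx, rfl⟩ := hsurj y hy
    rw [← hH x hx]; exact (hφt x (hO'W hx)).2.1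
  have hj' : ∀ y ∈ φ'.target,
      meanCurv (f ∘ φ'.symm) y j = y.2 * meanCurv (f ∘ φ'.symm) y i := fun y hy => by
    obtain ⟨x, hx, rfl⟩ := hsurj y hy
    rw [← hH x hx]; exact (hφt x (hO'W hx)).2.2
  have hp' := isProperAt_of_mem_atlas hf hp hφ'
  have had' := hu'.isAdapted hp' hsh' hi' hj'
  refine ⟨φ', hφ', hps', ?_, hbox, hO', _,
    fun y => 1 / 2 * nip (pd 1 (f ∘ φ'.symm) y) (pd 1 (f ∘ φ'.symm) y), i, j, had',
    ⟨hu'.isOpen, hu'.smooth, had'.m00, fun y hy => ?_, fun y hy => by ring⟩, fun y hy => ?_,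
    fun y hy => (hu'.pd_zero_meanCurv_of_quotient hp' hsh' hi' hj' hy).1⟩
  · rw [hφp, hσ]; simp
  · obtain ⟨x, hx, rfl⟩ := hsurj y hy
    have hxt := hO'W hx
    have d0 := ((hr.hasPd_comp hu'.isOpen hu'.smooth hx 0).congr_of_eqOn hr.isOpen hx heq).2
    have d1 := ((hr.hasPd_comp hu'.isOpen hu'.smooth hx 1).congr_of_eqOn hr.isOpen hx heq).2
    rw [hjac x hxt] at d0 d1
    simp only [Fin.sum_univ_two, Matrix.of_apply, Matrix.cons_val', Matrix.cons_val_zero,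
      Matrix.cons_val_one, Matrix.cons_val_fin_one, zero_smul, one_smul, add_zero] at d0 d1
    have hF := had.nip_pd_zero_one_ne hxt
    have h00 := had'.m00 _ hy
    have h1 : nip (pd 0 u x) (pd 1 u x) = -nip (pd 0 u x) (pd 1 u x) *
        nip (pd 0 (f ∘ φ'.symm) (σ x, x.2)) (pd 1 (f ∘ φ'.symm) (σ x, x.2)) := by
      conv_lhs => rw [d1, nip_add_right, nip_smul_right, d0, nip_smul_left, nip_smul_left, h00]
      ring
    have h2 : nip (pd 0 u x) (pd 1 u x) * (nip (pd 0 (f ∘ φ'.symm) (σ x, x.2))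
        (pd 1 (f ∘ φ'.symm) (σ x, x.2)) + 1) = 0 := by linear_combination h1
    have h3 := (mul_eq_zero.1 h2).resolve_left hF
    linarith
  · have := hi' y hy
    rw [smul_smul, mul_inv_cancel₀ this, one_smul]

theorem not_shapeHVanishesAt_of_curvAt_ne_zero (hf : IsSurface f)
    (hp : ∀ p, IsProperAt (rep f p) (coord p)) {q : M} (h : curvAt f q ≠ 0) :
    ¬ ShapeHVanishesAt f q := by
  obtain ⟨φ, hφ, hqs⟩ := exists_mem_maximalAtlas q
  rw [shapeHVanishesAt_iff hf hφ hqs]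
  rw [curvAt_eq hf hφ hqs] at h
  exact (isPatch_of_isSurface hf hφ).not_shapeVanishes_of_gaussCurv_ne_zero
    (isProperAt_of_mem_atlas hf hp hφ) (φ.map_source hqs) h

theorem locallyCongruentTo_familyIII (hf : IsSurface f)
    (hp : ∀ p, IsProperAt (rep f p) (coord p)) (hK : curvAt f p ≠ 0) :
    LocallyCongruentTo FamilyIII f p := by
  obtain ⟨φ, hφ, hps, hp0, ⟨I, J, hI, hJ, hIJ⟩, hO, α, m, i, j, had, hs, hH, hH0⟩ :=
    exists_adapted_chart hf hp (isOpen_curvAt_ne_zero hf) hK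
      fun q hq => not_shapeHVanishesAt_of_curvAt_ne_zero hf hp hq
  refine locallyCongruentTo_of_chart hφ hps ?_
  have hx₀ := φ.map_source hps
  have hpr := isProperAt_of_mem_atlas hf hp hφ
  have hKx : ∀ x ∈ φ.target, gaussCurv (f ∘ φ.symm) x ≠ 0 := fun x hx => by
    have := hO x hx
    rwa [mem_ofPred, curvAt_eq hf hφ (φ.map_target hx), φ.right_inv hx] at this
  rw [hIJ] at had hs hH hH0 hx₀ hpr hKx ⊢
  exact had.familyIII hs hI hJ (hp0 ▸ hx₀.1) hpr hH hH0 hKx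

/-- In adapted semi-null coordinates flatness says that `m` is affine in `s`; a further change of
coordinates makes both families of coordinate lines null, one of them consisting of straight
lines. -/
theorem locallyCongruentTo_familyII (hf : IsSurface f)
    (hp : ∀ p, IsProperAt (rep f p) (coord p)) (hK : ∀ᶠ q in 𝓝 p, curvAt f q = 0)
    (hA : ¬ ShapeHVanishesAt f p) : LocallyCongruentTo FamilyII f p := by
  obtain ⟨O, hOs, hO, hpO⟩ := eventually_nhds_iff.1 hK
  obtain ⟨φ, hφ, hps, hp0, ⟨I, J, hI, hJ, hIJ⟩, hφO, α, m, i, j, had, hs, hH, hH0⟩ :=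
    exists_adapted_chart hf hp (hO.inter (isOpen_not_shapeHVanishesAt hf)) ⟨hpO, hA⟩
      fun q hq => hq.2
  have hu := isPatch_of_isSurface hf hφ
  have hx₀ := φ.map_source hps
  have hKx : ∀ x ∈ φ.target, gaussCurv (f ∘ φ.symm) x = 0 := fun x hx => by
    have := hOs _ (hφO x hx).1
    rwa [curvAt_eq hf hφ (φ.map_target hx), φ.right_inv hx] at this
  set u := f ∘ φ.symm with hudef
  have hc0 : ∀ x ∈ φ.target, pd 0 (pd 0 u) x i = 0 := fun x hx => by
    have := hKx x hx
    rw [had.gaussCurv_eq hs hH hx] at this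
    exact (mul_eq_zero.1 this).resolve_right (had.ne_zero x hx)
  have hu00 : ∀ x ∈ φ.target, pd 0 (pd 0 u) x = 0 := fun x hx => by
    rw [had.pd_zero_zero_eq hs hx, hc0 x hx, zero_smul]
  have hmss : ∀ x ∈ φ.target, pd 0 (pd 0 m) x = 0 := fun x hx => by
    have := had.curvM_eq hs hH hx
    rwa [hc0 x hx, zero_mul] at this
  have hm := hs.contDiffOn_m
  have hms := contDiffOn_pd 0 hm φ.open_target
  -- `m = m₀(t) + s m₁(t)`
  obtain ⟨m₁, hm₁s, hm₁, -⟩ := exists_eq_comp_snd hI hJ (hIJ ▸ hms) (hIJ ▸ hmss) (by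
    have := hx₀; rw [hIJ] at this; exact hp0 ▸ this.1)
  obtain ⟨m₀, hm₀s, hm₀, -⟩ := exists_eq_comp_snd hI hJ (U := fun x => m x - x.1 * pd 0 m x)
    (hIJ ▸ hm.sub (contDiff_fst.contDiffOn.mul hms)) (by
      rw [← hIJ]
      intro x hx
      rw [((hasPd_of_contDiffOn 0 hm φ.open_target hx).sub ((hasPd_fst_zero x).mul
        (hasPd_of_contDiffOn 0 hms φ.open_target hx))).2, hmss x hx]
      ring) (by have := hx₀; rw [hIJ] at this; exact hp0 ▸ this.1)
  rw [← hIJ] at hm₁ hm₀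
  have hmx : ∀ x ∈ φ.target, m x = m₀ x.2 + x.1 * m₁ x.2 := fun x hx => by
    rw [← hm₁ x hx, ← hm₀ x hx]; ring
  have hJmem : ∀ x ∈ φ.target, x.2 ∈ J := fun x hx => by rw [hIJ] at hx; exact hx.2
  -- null coordinates `(T(t), exp(-P(t)) s + q(t))`
  obtain ⟨P, hPs, -, hP⟩ := exists_antideriv hJ (hJmem _ hx₀) hm₁s
  obtain ⟨T, hTs, -, hT⟩ := exists_antideriv hJ (hJmem _ hx₀) hPs.exp
  obtain ⟨r, hrs, hr0, hr'⟩ := exists_antideriv hJ (hJmem _ hx₀) (hPs.neg.exp.mul hm₀s).neg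
  have hTS : ∀ {g : ℝ → ℝ}, ContDiffOn ℝ ∞ g J → ContDiffOn ℝ ∞ (fun x : ℝ × ℝ => g x.2) φ.target :=
    fun {g} hg => by rw [hIJ]; exact contDiffOn_comp_snd hg
  set Φ : ℝ × ℝ → ℝ × ℝ := fun x => (T x.2, Real.exp (-P x.2) * x.1 + r x.2) with hΦ
  have hΦs : ContDiffOn ℝ ∞ Φ φ.target :=
    (hTS hTs).prodMk (((hTS hPs.neg.exp).mul contDiff_fst.contDiffOn).add (hTS hrs))
  have hjac : ∀ x ∈ φ.target, jac Φ x = !![0, Real.exp (P x.2); Real.exp (-P x.2),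
      -(Real.exp (-P x.2) * m x)] := fun x hx => by
    have hx2 := hJmem x hx
    have e := (hP _ hx2).neg.exp
    have hz := fun {g g' : ℝ → ℝ} (h : HasDerivAt g (g' x.2) x.2) =>
      hasPd_zero_comp_snd (x := x) h.differentiableAt
    refine jac_prodMk (hasPd_zero_comp_snd (hT _ hx2).differentiableAt)
      ((hasPd_one_comp_snd (hT _ hx2).differentiableAt).congr_deriv (hT _ hx2).deriv)
      ((((hasPd_zero_comp_snd e.differentiableAt).mul (hasPd_fst_zero x)).add
        (hasPd_zero_comp_snd (hr' _ hx2).differentiableAt)).congr_deriv ?_)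
      ((((hasPd_one_comp_snd e.differentiableAt).mul (hasPd_fst_one x)).add
        (hasPd_one_comp_snd (hr' _ hx2).differentiableAt)).congr_deriv ?_)
    · simp
    · rw [(hr' _ hx2).deriv, hmx x hx]
      have := e.deriv
      simp only [Pi.neg_apply] at this ⊢
      rw [this]; ring
  have hdet : (jac Φ (φ p)).det ≠ 0 := by
    rw [hjac _ hx₀, Matrix.det_fin_two_of, ← Real.exp_add]
    simp
  obtain ⟨φ', hφ', hps', hφp, ⟨I', J', hI', hJ', hIJ'⟩, O', hO'W, hr, hsurj, hsymm⟩ :=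
    exists_chart hφ hps φ.open_target subset_rfl hx₀ hΦs hdet
  have hy := isPatch_of_isSurface hf hφ'
  set y := f ∘ φ'.symm with hydef
  have heq : EqOn u (y ∘ Φ) O' := fun q hq => by simp [hudef, hydef, hsymm q hq]
  have d0 : ∀ x ∈ O', pd 0 u x = Real.exp (-P x.2) • pd 1 y (Φ x) := fun x hx => by
    have := ((hr.hasPd_comp hy.isOpen hy.smooth hx 0).congr_of_eqOn hr.isOpen hx heq).2
    rw [hjac x (hO'W hx)] at this
    simpa [Fin.sum_univ_two] using this
  have d1 : ∀ x ∈ O', pd 1 u x = Real.exp (P x.2) • pd 0 y (Φ x) -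
      (Real.exp (-P x.2) * m x) • pd 1 y (Φ x) := fun x hx => by
    have := ((hr.hasPd_comp hy.isOpen hy.smooth hx 1).congr_of_eqOn hr.isOpen hx heq).2
    rw [hjac x (hO'W hx)] at this
    rw [this]
    simp [Fin.sum_univ_two]; module
  have hee : ∀ t, Real.exp (P t) * Real.exp (-P t) = 1 := fun t => by
    rw [← Real.exp_add]; simp
  have hene : ∀ t, Real.exp (-P t) ≠ 0 := fun t => Real.exp_ne_zero _
  have hpos : ∀ t, Real.exp (P t) ≠ 0 := fun t => Real.exp_ne_zero _
  have h11 : ∀ z ∈ φ'.target, nip (pd 1 y z) (pd 1 y z) = 0 := fun z hz => by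
    obtain ⟨x, hx, rfl⟩ := hsurj z hz
    have := hs.m00 x (hO'W hx)
    rw [d0 x hx, nip_smul_left, nip_smul_right] at this
    exact (mul_eq_zero.1 ((mul_eq_zero.1 this).resolve_left (hene _))).resolve_left (hene _)
  have h10 : ∀ z ∈ φ'.target, nip (pd 1 y z) (pd 0 y z) = -1 := fun z hz => by
    have h1 := h11 z hz
    obtain ⟨x, hx, rfl⟩ := hsurj z hz
    have := hs.m01 x (hO'W hx)
    rw [d0 x hx, d1 x hx] at this
    simp only [nip_smul_left, nip_sub_right, nip_smul_right, h1] at this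
    linear_combination this - nip (pd 1 y (Φ x)) (pd 0 y (Φ x)) * hee x.2
  have h00 : ∀ z ∈ φ'.target, nip (pd 0 y z) (pd 0 y z) = 0 := fun z hz => by
    have h1 := h11 z hz
    have h2 := h10 z hz
    obtain ⟨x, hx, rfl⟩ := hsurj z hz
    have := hs.m11 x (hO'W hx)
    rw [d1 x hx] at this
    simp only [nip_smul_left, nip_sub_left, nip_sub_right, nip_smul_right, h1, h2,
      nip_comm (pd 0 y (Φ x)) (pd 1 y (Φ x))] at this
    have h3 : Real.exp (P x.2) * (Real.exp (P x.2) * nip (pd 0 y (Φ x)) (pd 0 y (Φ x))) = 0 := by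
      linear_combination this - 2 * m x * hee x.2
    exact (mul_eq_zero.1 ((mul_eq_zero.1 h3).resolve_left (hpos _))).resolve_left (hpos _)
  have hy11 : ∀ z ∈ φ'.target, pd 1 (pd 1 y) z = 0 := fun z hz => by
    obtain ⟨x, hx, rfl⟩ := hsurj z hz
    have hx2 := hJmem x (hO'W hx)
    have e := (hP _ hx2).neg.exp
    have h1 := hr.hasPd_comp hy.isOpen (hy.contDiffOn_pd 1) hx 0
    rw [hjac x (hO'W hx)] at h1
    have h2 := (((hasPd_zero_comp_snd (x := x) e.differentiableAt).smul h1).congr_of_eqOn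
      hr.isOpen hx d0).2
    rw [hu00 x (hO'W hx)] at h2
    simp only [Fin.sum_univ_two, Matrix.of_apply, Matrix.cons_val', Matrix.cons_val_zero,
      Matrix.cons_val_one, Matrix.cons_val_fin_one, zero_smul, zero_add, add_zero] at h2
    exact (smul_eq_zero.1 ((smul_eq_zero.1 h2.symm).resolve_left (hene _))).resolve_left (hene _)
  have hyH : ∀ z ∈ φ'.target, pd 1 (meanCurv y) z = 0 := fun z hz => by
    obtain ⟨x, hx, rfl⟩ := hsurj z hz
    have h1 := hH0 x (hO'W hx)
    rw [pd_congr_of_eqOn 0 hr.isOpen (meanCurv_congr hr.isOpen heq) hx,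
      hy.pd_meanCurv_comp hr hx, hjac x (hO'W hx)] at h1
    simp only [Fin.sum_univ_two, Matrix.of_apply, Matrix.cons_val', Matrix.cons_val_zero,
      Matrix.cons_val_one, Matrix.cons_val_fin_one, zero_smul, zero_add] at h1
    exact (smul_eq_zero.1 h1).resolve_left (hene _)
  have hΨ := isReparam_swap hy.isOpen
  have hpre : (Prod.swap ⁻¹' φ'.target : Set (ℝ × ℝ)) = J' ×ˢ I' := by
    rw [hIJ']; ext; simp [and_comm]
  have hpr := isProperAt_of_mem_atlas hf hp hφ'
  have hx₀' := φ'.map_source hps'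
  have hJ0 : (0 : ℝ) ∈ J' := by
    rw [hIJ', hφp] at hx₀'
    have := hx₀'.2
    simpa [hΦ, hp0, hr0] using this
  have s0 : ∀ {w : ℝ × ℝ → E42}, ContDiffOn ℝ ∞ w φ'.target → ∀ q ∈ Prod.swap ⁻¹' φ'.target,
      pd 0 (w ∘ Prod.swap) q = pd 1 w q.swap := fun hw q hq => by
    rw [(hΨ.hasPd_comp hy.isOpen hw hq 0).2, jac_swap]; simp [Fin.sum_univ_two]
  have s1 : ∀ {w : ℝ × ℝ → E42}, ContDiffOn ℝ ∞ w φ'.target → ∀ q ∈ Prod.swap ⁻¹' φ'.target,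
      pd 1 (w ∘ Prod.swap) q = pd 0 w q.swap := fun hw q hq => by
    rw [(hΨ.hasPd_comp hy.isOpen hw hq 1).2, jac_swap]; simp [Fin.sum_univ_two]
  refine locallyCongruentTo_of_chart hφ' hps' ?_
  have hsv : IsSemiNull (fun _ => 0) (y ∘ Prod.swap) (Prod.swap ⁻¹' φ'.target) := by
    refine ⟨hΨ.isOpen, (hy.comp hΨ).smooth, fun q hq => ?_, fun q hq => ?_, fun q hq => ?_⟩
    · rw [s0 hy.smooth q hq, h11 _ hq]
    · rw [s0 hy.smooth q hq, s1 hy.smooth q hq, h10 _ hq]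
    · rw [s1 hy.smooth q hq, h00 _ hq, mul_zero]
  have hv00 : ∀ q ∈ Prod.swap ⁻¹' φ'.target, pd 0 (pd 0 (y ∘ Prod.swap)) q = 0 := fun q hq => by
    rw [pd_congr_of_eqOn 0 (v := pd 1 y ∘ Prod.swap) hΨ.isOpen (s0 hy.smooth) hq,
      s0 (hy.contDiffOn_pd 1) q hq, hy11 _ hq]
  have hvH : ∀ q ∈ Prod.swap ⁻¹' φ'.target, pd 0 (meanCurv (y ∘ Prod.swap)) q = 0 :=
    fun q hq => by
      rw [pd_congr_of_eqOn 0 (v := meanCurv y ∘ Prod.swap) hΨ.isOpen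
        (fun q hq => hy.meanCurv_comp hΨ hq) hq, s0 hy.contDiffOn_meanCurv q hq, hyH _ hq]
  have hvp : ∀ q ∈ Prod.swap ⁻¹' φ'.target, IsProperAt (y ∘ Prod.swap) q := fun q hq =>
    (hy.isProperAt_comp hΨ hq).2 (hpr _ hq)
  rw [hpre] at hsv hv00 hvH hvp
  have := hsv.familyII hJ' hI' hJ0 hvp hv00 hvH
  rw [hIJ']
  exact this

end Classification

/-! ### Local classification where `A_H = 0` -/

section ShapeZero

theorem eq_of_pd_eq_zero {F : Type*} [NormedAddCommGroup F] [NormedSpace ℝ F]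
    {U : ℝ × ℝ → F} {W : Set (ℝ × ℝ)} (hW : IsOpen W) (hW' : IsPreconnected W)
    (hU : ContDiffOn ℝ ∞ U W) (h : ∀ k, ∀ x ∈ W, pd k U x = 0) {x y : ℝ × ℝ} (hx : x ∈ W)
    (hy : y ∈ W) : U x = U y := by
  refine hW.is_const_of_fderiv_eq_zero (𝕜 := ℝ) hW' (hU.differentiableOn (by simp))
    (fun z hz => ?_) hx hy
  ext
  · simpa [pd, dir] using h 0 z hz
  · simpa [pd, dir] using h 1 z hz

/-- A product of rotations of the two definite planes brings any null vector to the line of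
`(1, 0, 0, 1)`. -/
theorem exists_isometry_of_isLightlike {c : E42} (hc : IsLightlike c) :
    ∃ A : E42 →ₗ[ℝ] E42, (∀ x y, nip (A x) (A y) = nip x y) ∧
      ∃ r : ℝ, r ≠ 0 ∧ A c = r • ![1, 0, 0, 1] := by
  obtain ⟨hc0, hcc⟩ := hc
  have hcc' : c 0 ^ 2 + c 1 ^ 2 = c 2 ^ 2 + c 3 ^ 2 := by
    unfold nip at hcc; linarith
  set r := √(c 0 ^ 2 + c 1 ^ 2) with hr
  have hr2 : r ^ 2 = c 0 ^ 2 + c 1 ^ 2 := Real.sq_sqrt (by positivity)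
  have hr0 : r ≠ 0 := by
    intro h0
    rw [h0] at hr2
    have h1 : c 0 = 0 := by nlinarith [sq_nonneg (c 0), sq_nonneg (c 1)]
    have h2 : c 1 = 0 := by nlinarith [sq_nonneg (c 0), sq_nonneg (c 1)]
    have h3 : c 2 = 0 := by nlinarith [sq_nonneg (c 2), sq_nonneg (c 3)]
    have h4 : c 3 = 0 := by nlinarith [sq_nonneg (c 2), sq_nonneg (c 3)]
    exact hc0 (by ext k; fin_cases k <;> assumption)
  refine ⟨{ toFun := fun x => ![(c 0 * x 0 + c 1 * x 1) / r, (-(c 1 * x 0) + c 0 * x 1) / r,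
              (c 3 * x 2 - c 2 * x 3) / r, (c 2 * x 2 + c 3 * x 3) / r]
            map_add' := fun x y => by ext k; fin_cases k <;> simp <;> ring
            map_smul' := fun a x => by ext k; fin_cases k <;> simp <;> ring },
    fun x y => ?_, r, hr0, ?_⟩
  · simp only [nip, LinearMap.coe_mk, AddHom.coe_mk, Matrix.cons_val]
    field_simp
    linear_combination (x 0 * y 0 + x 1 * y 1 - x 2 * y 2 - x 3 * y 3) * hr2 -
      (x 2 * y 2 + x 3 * y 3) * hcc'
  · ext k
    fin_cases k
    · simp; field_simp; linear_combination -hr2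
    · simp; left; ring
    · simp; left; ring
    · simp; field_simp; linear_combination -hr2 - hcc'

variable {u : ℝ × ℝ → E42} {W : Set (ℝ × ℝ)}

/-- If `A_H = 0` then `dH` is proportional to `H`, whose direction is therefore constant. -/
theorem IsPatch.exists_fixed_direction (hu : IsPatch u W) (hW : IsPreconnected W)
    (hp : ∀ x ∈ W, IsProperAt u x) (hA : ∀ x ∈ W, ShapeVanishes u x) {i : Fin 4}
    (hi : ∀ x ∈ W, meanCurv u x i ≠ 0) {x₀ : ℝ × ℝ} (hx₀ : x₀ ∈ W) :
    ∃ c : E42, IsLightlike c ∧ ∀ x ∈ W, ∀ k, nip c (pd k u x) = 0 := by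
  have hH : ∀ x ∈ W, nip (meanCurv u x) (meanCurv u x) = 0 := fun x hx => (hp x hx).1.2
  set U : ℝ × ℝ → E42 := fun x => (1 / meanCurv u x i) • meanCurv u x with hU
  have hUs : ContDiffOn ℝ ∞ U W :=
    (contDiffOn_const.div (contDiffOn_pi.1 hu.contDiffOn_meanCurv i) hi).smul
      hu.contDiffOn_meanCurv
  have hd : ∀ k, ∀ x ∈ W, pd k U x = 0 := fun k x hx => by
    obtain ⟨c, hc⟩ := hu.exists_normalDeriv_eq_smul hH hx (hp x hx).1.1 k
    have ht : pd k (meanCurv u) x = c • meanCurv u x := by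
      have := hA x hx k
      rw [shapeOp, neg_eq_zero] at this
      rwa [normalDeriv, normalPart, this, sub_zero] at hc
    have h1 := hu.hasPd_meanCurv hx k
    rw [ht] at h1
    have h2 := ((hasPd_const k (1 : ℝ) x).div (h1.apply i) (hi x hx)).smul h1
    rw [hU, h2.2]
    have := hi x hx
    ext j
    simp only [Pi.add_apply, Pi.smul_apply, smul_eq_mul, Pi.zero_apply]
    field_simp
    ring
  have hconst : ∀ x ∈ W, U x = U x₀ := fun x hx =>
    eq_of_pd_eq_zero hu.isOpen hW hUs hd hx hx₀
  refine ⟨U x₀, ⟨smul_ne_zero (one_div_ne_zero (hi _ hx₀)) (hp _ hx₀).1.1, ?_⟩, fun x hx k => ?_⟩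
  · simp [hU, hH _ hx₀]
  · rw [← hconst x hx, hU, nip_smul_left, hu.nip_meanCurv hx, mul_zero]

theorem IsPatch.exists_congruence_apply_zero_eq_three (hu : IsPatch u W) (hW : IsPreconnected W)
    {c : E42} (hc : IsLightlike c) (h : ∀ x ∈ W, ∀ k, nip c (pd k u x) = 0) {x₀ : ℝ × ℝ}
    (hx₀ : x₀ ∈ W) :
    ∃ (A : E42 →ₗ[ℝ] E42) (b : E42), (∀ x y, nip (A x) (A y) = nip x y) ∧
      ∀ x ∈ W, (A (u x) + b) 0 = (A (u x) + b) 3 := by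
  obtain ⟨A, hA, r, hr, hAc⟩ := exists_isometry_of_isLightlike hc
  have hs : ContDiffOn ℝ ∞ (fun x => A (u x)) W :=
    (LinearMap.toContinuousLinearMap A).contDiff.comp_contDiffOn hu.smooth
  have hs' := contDiffOn_pi.1 hs
  have hconst : ∀ x ∈ W, A (u x) 3 - A (u x) 0 = A (u x₀) 3 - A (u x₀) 0 := fun x hx => by
    refine eq_of_pd_eq_zero hu.isOpen hW ((hs' 3).sub (hs' 0)) (fun k y hy => ?_) hx hx₀
    have h1 := (hu.hasPd hy k).comp_clm (LinearMap.toContinuousLinearMap A)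
    have h2 := h y hy k
    rw [← hA, hAc, nip_smul_left] at h2
    have h3 := (mul_eq_zero.1 h2).resolve_left hr
    have h4 := ((h1.apply 3).sub (h1.apply 0)).2
    refine h4.trans ?_
    simp only [nip, Matrix.cons_val] at h3
    simp only [LinearMap.coe_toContinuousLinearMap']
    linarith
  refine ⟨A, ![A (u x₀) 3 - A (u x₀) 0, 0, 0, 0], hA, fun x hx => ?_⟩
  have := hconst x hx
  simp only [Pi.add_apply, Matrix.cons_val]
  linarith

/-- On the degenerate hyperplane `x₀ = x₃` the induced metric only sees the coordinates `x₁, x₂`,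
which are therefore local coordinates of the surface. -/
theorem IsPatch.coordinates_of_hyperplane (hu : IsPatch u W) (h : ∀ x ∈ W, u x 0 = u x 3)
    {x : ℝ × ℝ} (hx : x ∈ W) :
    pd 0 u x 1 * pd 1 u x 2 - pd 1 u x 1 * pd 0 u x 2 ≠ 0 := by
  have h3 : ∀ k, pd k u x 0 = pd k u x 3 := fun k =>
    ((hu.hasPd hx k).apply 0).eq_of_eqOn ((hu.hasPd hx k).apply 3) hu.isOpen hx h
  have hd := hu.det_ne x hx
  contrapose! hd
  rw [metric_det]
  simp only [nip, h3]
  linear_combination -(pd 0 u x 1 * pd 1 u x 2 - pd 1 u x 1 * pd 0 u x 2) * hd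

theorem IsPatch.familyI (hu : IsPatch u W) (hp : ∀ x ∈ W, IsProperAt u x) {ψ : ℝ × ℝ → ℝ}
    (hψ : ContDiffOn ℝ ∞ ψ W) (h : EqOn u (graphSurface ψ) W) : FamilyI u W := by
  have hH := meanCurv_graph hu hψ h
  have hψ1 := NeutralSurface.contDiffOn_pd 0 (NeutralSurface.contDiffOn_pd 1 hψ hu.isOpen) hu.isOpen
  refine ⟨ψ, hψ, fun x hx h0 => ?_, fun x hx => ?_, h⟩
  · exact (hp x hx).1.1 (by rw [hH x hx, h0, zero_smul])
  · by_contra! hcon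
    obtain ⟨i, hi⟩ := (hp x hx).2.2
    refine hi ?_
    have h1 := (((hasPd_of_contDiffOn i hψ1 hu.isOpen hx).smul
      (hasPd_const i (![1, 0, 0, 1] : E42) x)).congr_of_eqOn hu.isOpen hx hH).2
    have h2 : pd i (pd 0 (pd 1 ψ)) x = 0 := by
      fin_cases i
      exacts [hcon.1, hcon.2]
    rw [normalDeriv, h1, h2, smul_zero, zero_smul, zero_add]
    simp [normalPart, tangentPart]

variable {M : Type*} [TopologicalSpace M] [ChartedSpace (ℝ × ℝ) M]
  [IsManifold 𝓘(ℝ, ℝ × ℝ) ∞ M] {f : M → E42} {p : M}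

/-- Up to a congruence `H` is proportional to `(1, 0, 0, 1)`, so that the surface lies in the
hyperplane `x₀ = x₃` and is a graph over the plane of the coordinates `x₁, x₂`. -/
theorem locallyCongruentTo_familyI (hf : IsSurface f)
    (hp : ∀ p, IsProperAt (rep f p) (coord p)) (hA : ∀ᶠ q in 𝓝 p, ShapeHVanishesAt f q) :
    LocallyCongruentTo FamilyI f p := by
  obtain ⟨O, hOs, hO, hpO⟩ := eventually_nhds_iff.1 hA
  obtain ⟨φ, hφ, hps⟩ := exists_mem_maximalAtlas p
  have hu := isPatch_of_isSurface hf hφ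
  have hpu := isProperAt_of_mem_atlas hf hp hφ
  set u := f ∘ φ.symm with hudef
  have hx₀ := φ.map_source hps
  obtain ⟨i, hi⟩ : ∃ i, meanCurv u (φ p) i ≠ 0 := by
    by_contra! hcon
    exact (hpu _ hx₀).1.1 (by ext k; exact hcon k)
  have hHs := contDiffOn_pi.1 hu.contDiffOn_meanCurv
  have hWo : IsOpen ((φ.target ∩ φ.symm ⁻¹' O) ∩
      (φ.target ∩ (fun x => meanCurv u x i) ⁻¹' {0}ᶜ)) :=
    (φ.isOpen_inter_preimage_symm hO).inter
      ((hHs i).continuousOn.isOpen_inter_preimage φ.open_target isOpen_compl_singleton)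
  obtain ⟨ε, hε, hB⟩ := Metric.isOpen_iff.1 hWo (φ p)
    ⟨⟨hx₀, by simpa [φ.left_inv hps] using hpO⟩, hx₀, hi⟩
  set B := Metric.ball (φ p) ε with hBdef
  have hBφ : B ⊆ φ.target := fun x hx => (hB hx).1.1
  have hpB : φ p ∈ B := Metric.mem_ball_self hε
  have hBc : IsPreconnected B := (convex_ball _ _).isPreconnected
  have huB := hu.mono Metric.isOpen_ball hBφ
  obtain ⟨c, hc, hcu⟩ := huB.exists_fixed_direction hBc (fun x hx => hpu x (hBφ hx))
    (fun x hx => by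
      have := hOs _ (hB hx).1.2
      rwa [shapeHVanishesAt_iff hf hφ (φ.map_target (hBφ hx)), φ.right_inv (hBφ hx)] at this)
    (fun x hx => (hB hx).2.2) hpB
  obtain ⟨A, b, hAi, h03⟩ := huB.exists_congruence_apply_zero_eq_three hBc hc hcu hpB
  set v : ℝ × ℝ → E42 := fun x => A (u x) + b with hv
  have hvp := (isProperAt_congruence hAi huB (v := v) fun x _ => rfl).1
  have hvs := contDiffOn_pi.1 hvp.smooth
  have h2 : √2 ≠ 0 := by positivity
  have h22 : √2 ^ 2 = 2 := by norm_num
  -- the coordinates `(s, t)` with `v₁ = (s - t) / √2` and `v₂ = (s + t) / √2`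
  set Φ : ℝ × ℝ → ℝ × ℝ := fun x => ((v x 1 + v x 2) / √2, (v x 2 - v x 1) / √2) with hΦ
  have hΦs : ContDiffOn ℝ ∞ Φ B :=
    (((hvs 1).add (hvs 2)).div contDiffOn_const fun _ _ => h2).prodMk
      (((hvs 2).sub (hvs 1)).div contDiffOn_const fun _ _ => h2)
  have hdet : (jac Φ (φ p)).det ≠ 0 := by
    have d := fun k j => (hvp.hasPd hpB k).apply j
    have c2 := fun k => hasPd_const k (√2) (φ p)
    have hcd := hvp.coordinates_of_hyperplane h03 hpB
    rw [jac_prodMk (((d 0 1).add (d 0 2)).div (c2 0) h2) (((d 1 1).add (d 1 2)).div (c2 1) h2)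
      (((d 0 2).sub (d 0 1)).div (c2 0) h2) (((d 1 2).sub (d 1 1)).div (c2 1) h2),
      Matrix.det_fin_two_of]
    refine fun h0 => hcd ?_
    field_simp at h0
    linear_combination h0 / 4 - (pd 0 v (φ p) 1 * pd 1 v (φ p) 2 -
      pd 1 v (φ p) 1 * pd 0 v (φ p) 2) / 2 * h22
  obtain ⟨φ', hφ', hps', -, -, O', hO'B, hr, hsurj, hsymm⟩ :=
    exists_chart hφ hps Metric.isOpen_ball hBφ hpB hΦs hdet
  set g : ℝ × ℝ → E42 := fun y => A (f (φ'.symm y)) + b with hg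
  obtain ⟨hgp, hgp'⟩ := isProperAt_congruence hAi (isPatch_of_isSurface hf hφ') (v := g)
    fun x _ => rfl
  have hpr := isProperAt_of_mem_atlas hf hp hφ'
  refine ⟨φ', hφ', hps', fun x => A x + b, ⟨A, b, hAi, fun _ => rfl⟩, g,
    hgp.familyI (fun x hx => (hgp' x hx).2 (hpr x hx)) (contDiffOn_pi.1 hgp.smooth 0)
      fun y hy => ?_, fun q hq => by simp [hg, φ'.left_inv hq]⟩
  obtain ⟨x, hx, rfl⟩ := hsurj y hy
  have hgv : g (Φ x) = v x := by simp [hg, hv, hudef, hsymm x hx]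
  rw [graphSurface, hgv]
  ext k
  fin_cases k
  · rfl
  · simp [hΦ]; field_simp; rw [h22]; ring
  · simp [hΦ]; field_simp; rw [h22]; ring
  · exact (h03 x (hO'B hx)).symm

end ShapeZero

end NeutralSurface

theorem mainTheorem1 {M : Type*} [TopologicalSpace M] [ChartedSpace (ℝ × ℝ) M]
    [IsManifold 𝓘(ℝ, ℝ × ℝ) ∞ M] (f : M → E42) (hf : IsSurface f) :
    -- the classification, on surfaces all of whose points are regular
    ((∀ p, IsRegularPoint f p) →
      ((IsQuasiMinimal f ∧ IsProperBiconservative f) ↔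
        ∀ p, LocallyCongruentTo Families f p)) ∧
    -- no regularity is needed for the sufficiency
    ((∀ p, LocallyCongruentTo Families f p) → IsQuasiMinimal f ∧ IsProperBiconservative f) ∧
    -- the regular points always form an open dense set
    (IsOpen {p | IsRegularPoint f p} ∧ Dense {p | IsRegularPoint f p}) ∧
    -- at the regular points of any such surface, the type of the point determines the family
    (IsQuasiMinimal f → IsProperBiconservative f → ∀ p,
      (curvAt f p ≠ 0 → LocallyCongruentTo FamilyIII f p) ∧
      ((∀ᶠ q in 𝓝 p, curvAt f q = 0) → ¬ ShapeHVanishesAt f p →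
        LocallyCongruentTo FamilyII f p) ∧
      ((∀ᶠ q in 𝓝 p, ShapeHVanishesAt f q) → LocallyCongruentTo FamilyI f p)) := by
  have hiff := quasiMinimal_and_proper_iff hf
  have hsuff : (∀ p, LocallyCongruentTo Families f p) →
      IsQuasiMinimal f ∧ IsProperBiconservative f := fun h =>
    hiff.2 fun p => isProperAt_of_locallyCongruentTo hf (h p)
  have hmono : ∀ {Fam : (ℝ × ℝ → E42) → Set (ℝ × ℝ) → Prop} {p : M},
      (∀ g V, Fam g V → Families g V) → LocallyCongruentTo Fam f p →
        LocallyCongruentTo Families f p := by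
    rintro Fam p hF ⟨φ, hφ, hp, T, hT, g, hg, hfg⟩
    exact ⟨φ, hφ, hp, T, hT, g, hF _ _ hg, hfg⟩
  refine ⟨fun hreg => ⟨fun h p => ?_, hsuff⟩, hsuff, ⟨isOpen_regular hf, dense_regular f⟩,
    fun hq hb p => ?_⟩
  · rcases hreg p with hK | ⟨hK, hA⟩ | hA
    · exact hmono (fun _ _ => Or.inr ∘ Or.inr) (locallyCongruentTo_familyIII hf (hiff.1 h) hK)
    · exact hmono (fun _ _ => Or.inr ∘ Or.inl) (locallyCongruentTo_familyII hf (hiff.1 h) hK hA)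
    · exact hmono (fun _ _ => Or.inl) (locallyCongruentTo_familyI hf (hiff.1 h) hA)
  · have hp := hiff.1 ⟨hq, hb⟩
    exact ⟨locallyCongruentTo_familyIII hf hp, locallyCongruentTo_familyII hf hp,
      locallyCongruentTo_familyI hf hp⟩
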